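/- Let $f:\mathbb{R}\to\mathbb{R}$ be a measurable function such that (a) $f(x)>0$ for all $x\neq 0$; (b) there are $\kappa>0$ and a neighbourhood of $0$ in which $f(x)\geq\kappa$ for all $x\neq 0$; (c) $f\in C^\infty(\mathbb{R}\setminus\{0\})$; (d) $2f(x)f''(x)-f'(x)^2\geq 0$ for all $x\neq 0$. Let $M=\mathbb{R}^+\times\mathbb{R}$ (with $\mathbb{R}^+=(0,+\infty)$) carry the Riemannian metric $g_f=dx\otimes dx+f(x)^2\,dy\otimes dy$, whose volume measure is $d\mu_f=f(x)\,dx\,dy$, and let $$\Delta_f=\mathrm{div}_{\mu_f}\circ\nabla=\frac{\partial^2}{\partial x^2}+\frac{1}{f(x)^2}\frac{\partial^2}{\partial y^2}+\frac{f'(x)}{f(x)}\frac{\partial}{\partial x}$$ be its Laplace–Beltrami operator. Let $H_f=-\Delta_f$ with domain $C_c^\infty(M)$ (complex-valued functions), as an operator in the Hilbert space $L^2(M,d\mu_f)$. (i) If $2f(x)f''(x)-f'(x)^2\geq \dfrac{3}{x^2}f(x)^2$ for every $x\neq 0$, then $H_f$ is essentially self-adjoint (that is, its closure is self-adjoint).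 (ii) If there is $\varepsilon>0$ such that $2f(x)f''(x)-f'(x)^2\leq \dfrac{3-\varepsilon}{x^2}f(x)^2$ for every $x\neq 0$, then $H_f$ is not essentially self-adjoint. (iii) Under the hypothesis of (ii), $H_f$ has infinite deficiency indices: $\dim\ker(H_f^*-\mathrm{i})=\dim\ker(H_f^*+\mathrm{i})=\infty$. -/

import Mathlib

open MeasureTheory TopologicalSpace
open scoped ContDiff Distributions LinearPMap Topology

noncomputable section

namespace Grushin

/-! ### Riemannian geometry of an open subset of the plane in its global coordinates -/

/-- The coordinate vectors of `ℝ × ℝ`. -/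
def coordVec : Fin 2 → ℝ × ℝ := ![(1, 0), (0, 1)]

/-- The partial derivative `∂ᵢ u` of a complex-valued function of two real variables. -/
def partialDeriv (i : Fin 2) (u : ℝ × ℝ → ℂ) (p : ℝ × ℝ) : ℂ :=
  fderiv ℝ u p (coordVec i)

/-- The density `√(det g)` of the Riemannian volume form of the metric `g` (given by its matrix
in the coordinates) with respect to the Lebesgue measure. -/
def volDensity (g : ℝ × ℝ → Matrix (Fin 2) (Fin 2) ℝ) (p : ℝ × ℝ) : ℝ :=
  Real.sqrt (g p).det

/-- The Riemannian volume measure of the metric `g` on the open set `Ω`, as a measure on the plane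
carried by `Ω`. -/
def volMeasure (Ω : Opens (ℝ × ℝ)) (g : ℝ × ℝ → Matrix (Fin 2) (Fin 2) ℝ) : Measure (ℝ × ℝ) :=
  (volume.restrict (Ω : Set (ℝ × ℝ))).withDensity fun p => ENNReal.ofReal (volDensity g p)

/-- The Riemannian gradient, `(∇u)ⁱ = ∑ⱼ gⁱʲ ∂ⱼ u`. -/
def gradient (g : ℝ × ℝ → Matrix (Fin 2) (Fin 2) ℝ) (u : ℝ × ℝ → ℂ) (i : Fin 2) (p : ℝ × ℝ) : ℂ :=
  ∑ j, (((g p)⁻¹ i j : ℝ) : ℂ) * partialDeriv j u p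

/-- The Riemannian divergence, `div X = (det g)^{-1/2} ∑ᵢ ∂ᵢ ((det g)^{1/2} Xⁱ)`. -/
def divergence (g : ℝ × ℝ → Matrix (Fin 2) (Fin 2) ℝ) (X : Fin 2 → ℝ × ℝ → ℂ) (p : ℝ × ℝ) : ℂ :=
  ((volDensity g p : ℝ) : ℂ)⁻¹ *
    ∑ i, partialDeriv i (fun q => ((volDensity g q : ℝ) : ℂ) * X i q) p

/-- The Laplace–Beltrami operator `Δ = div ∘ ∇`. -/
def laplaceBeltrami (g : ℝ × ℝ → Matrix (Fin 2) (Fin 2) ℝ) (u : ℝ × ℝ → ℂ) : ℝ × ℝ → ℂ :=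
  divergence g (gradient g u)

/-! ### The generalised Grushin plane -/

/-- The standing assumptions on the function `f` in the metric `dx² + f(x)² dy²`. Nothing is
required of the value `f 0`. -/
structure IsGrushinProfile (f : ℝ → ℝ) : Prop where
  measurable : Measurable f
  pos : ∀ x, x ≠ 0 → 0 < f x
  bounded_below : ∃ κ > 0, ∀ᶠ x in 𝓝[≠] (0 : ℝ), κ ≤ f x
  smooth : ContDiffOn ℝ ∞ f {0}ᶜ
  nonneg : ∀ x, x ≠ 0 → 0 ≤ 2 * f x * deriv (deriv f) x - deriv f x ^ 2

/-- The open right half-plane `ℝ⁺ × ℝ`. -/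
def halfPlane : Opens (ℝ × ℝ) := ⟨{p | 0 < p.1}, isOpen_lt continuous_const continuous_fst⟩

/-- The metric `dx ⊗ dx + f(x)² dy ⊗ dy`. -/
def metric (f : ℝ → ℝ) (p : ℝ × ℝ) : Matrix (Fin 2) (Fin 2) ℝ := !![1, 0; 0, f p.1 ^ 2]

/-- The Riemannian volume measure `f(x) dx dy` of the generalised Grushin plane. -/
abbrev grushinMeasure (f : ℝ → ℝ) : Measure (ℝ × ℝ) := volMeasure halfPlane (metric f)

/-- The Hilbert space `L²(M, dμ_f)` of complex-valued functions. -/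
abbrev GrushinL2 (f : ℝ → ℝ) : Type := Lp ℂ 2 (grushinMeasure f)

theorem mem_halfPlane {p : ℝ × ℝ} : p ∈ halfPlane ↔ 0 < p.1 := Iff.rfl

theorem volDensity_metric (f : ℝ → ℝ) (p : ℝ × ℝ) : volDensity (metric f) p = |f p.1| := by
  simp [volDensity, metric, Matrix.det_fin_two_of, Real.sqrt_sq_eq_abs]

theorem contDiff_partialDeriv {u : ℝ × ℝ → ℂ} (hu : ContDiff ℝ ∞ u) (i : Fin 2) :
    ContDiff ℝ ∞ (partialDeriv i u) :=
  (hu.fderiv_right (m := ∞) (by simp)).clm_apply contDiff_const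

theorem partialDeriv_add {u v : ℝ × ℝ → ℂ} (hu : ContDiff ℝ ∞ u) (hv : ContDiff ℝ ∞ v)
    (i : Fin 2) : partialDeriv i (u + v) = partialDeriv i u + partialDeriv i v := by
  ext p
  simp [partialDeriv, fderiv_add (hu.differentiable (by simp) p) (hv.differentiable (by simp) p)]

theorem partialDeriv_smul {u : ℝ × ℝ → ℂ} (hu : ContDiff ℝ ∞ u) (c : ℂ)
    (i : Fin 2) : partialDeriv i (c • u) = c • partialDeriv i u := by
  ext p
  simp [partialDeriv, fderiv_const_smul (hu.differentiable (by simp) p)]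

theorem partialDeriv_congr {u v : ℝ × ℝ → ℂ} {p : ℝ × ℝ} (h : u =ᶠ[𝓝 p] v) (i : Fin 2) :
    partialDeriv i u p = partialDeriv i v p := by
  simp [partialDeriv, h.fderiv_eq]

theorem tsupport_partialDeriv_subset (u : ℝ × ℝ → ℂ) (i : Fin 2) :
    tsupport (partialDeriv i u) ⊆ tsupport u :=
  tsupport_fderiv_apply_subset ℝ (coordVec i)

/-- The classical expression `∂ₓ² + f(x)⁻² ∂ᵧ² + (f'(x)/f(x)) ∂ₓ` of the Laplace–Beltrami operator
of the generalised Grushin plane. -/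
def grushinExpr (f : ℝ → ℝ) (u : ℝ × ℝ → ℂ) (p : ℝ × ℝ) : ℂ :=
  partialDeriv 0 (partialDeriv 0 u) p
    + ((1 / f p.1 ^ 2 : ℝ) : ℂ) * partialDeriv 1 (partialDeriv 1 u) p
    + ((deriv f p.1 / f p.1 : ℝ) : ℂ) * partialDeriv 0 u p

theorem differentiableAt_profile {f : ℝ → ℝ} (hf : IsGrushinProfile f) {x : ℝ} (hx : 0 < x) :
    DifferentiableAt ℝ f x :=
  (hf.smooth.contDiffAt (isOpen_compl_singleton.mem_nhds hx.ne')).differentiableAt (by simp)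

theorem laplaceBeltrami_eq {f : ℝ → ℝ} (hf : IsGrushinProfile f) {u : ℝ × ℝ → ℂ}
    (hu : ContDiff ℝ ∞ u) {p : ℝ × ℝ} (hp : p ∈ halfPlane) :
    laplaceBeltrami (metric f) u p = grushinExpr f u p := by
  have hnear : ∀ᶠ q in 𝓝 p, q ∈ halfPlane := halfPlane.isOpen.mem_nhds hp
  have hinv : ∀ q ∈ halfPlane, (metric f q)⁻¹ = !![1, 0; 0, (f q.1 ^ 2)⁻¹] := by
    intro q hq
    have h0 := (hf.pos q.1 (ne_of_gt hq)).ne'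
    apply Matrix.inv_eq_right_inv
    ext i j
    fin_cases i <;> fin_cases j <;> simp [metric, Matrix.mul_apply, h0]
  have hvol : ∀ q ∈ halfPlane, volDensity (metric f) q = f q.1 := by
    intro q hq
    rw [volDensity_metric, abs_of_pos (hf.pos q.1 (ne_of_gt hq))]
  have hfp := (hf.pos p.1 (ne_of_gt hp)).ne'
  have hfc : (f p.1 : ℂ) ≠ 0 := by exact_mod_cast hfp
  have hd := differentiableAt_profile hf hp
  have hF : HasFDerivAt (fun q : ℝ × ℝ => ((f q.1 : ℝ) : ℂ))
      (((deriv f p.1 : ℝ) : ℂ) • (Complex.ofRealCLM.comp (ContinuousLinearMap.fst ℝ ℝ ℝ))) p := by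
    have h1 : HasFDerivAt (fun q : ℝ × ℝ => f q.1)
        (deriv f p.1 • ContinuousLinearMap.fst ℝ ℝ ℝ) p :=
      hd.hasDerivAt.comp_hasFDerivAt p hasFDerivAt_fst
    have h2 := Complex.ofRealCLM.hasFDerivAt.comp p h1
    refine h2.congr_fderiv ?_
    ext <;> simp
  have hG : HasFDerivAt (fun q : ℝ × ℝ => (((f q.1 : ℝ) : ℂ))⁻¹)
      (-(((f p.1 : ℝ) : ℂ) ^ 2)⁻¹ • (((deriv f p.1 : ℝ) : ℂ) •
        (Complex.ofRealCLM.comp (ContinuousLinearMap.fst ℝ ℝ ℝ)))) p := by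
    exact (hasDerivAt_inv hfc).comp_hasFDerivAt p hF
  have h0 : partialDeriv 0 (fun q => ((volDensity (metric f) q : ℝ) : ℂ) *
      gradient (metric f) u 0 q) p
      = f p.1 * partialDeriv 0 (partialDeriv 0 u) p + ((deriv f p.1 : ℝ) : ℂ) * partialDeriv 0 u p := by
    rw [partialDeriv_congr (v := fun q => ((f q.1 : ℝ) : ℂ) * partialDeriv 0 u q)]
    · have := hF.fun_mul ((contDiff_partialDeriv hu 0).differentiable (by simp) p).hasFDerivAt
      rw [partialDeriv, this.fderiv]
      simp [coordVec, partialDeriv]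
      ring
    · filter_upwards [hnear] with q hq
      simp [gradient, hvol q hq, hinv q hq]
  have h1 : partialDeriv 1 (fun q => ((volDensity (metric f) q : ℝ) : ℂ) *
      gradient (metric f) u 1 q) p
      = (f p.1 : ℂ)⁻¹ * partialDeriv 1 (partialDeriv 1 u) p := by
    rw [partialDeriv_congr (v := fun q => (((f q.1 : ℝ) : ℂ))⁻¹ * partialDeriv 1 u q)]
    · have := hG.fun_mul ((contDiff_partialDeriv hu 1).differentiable (by simp) p).hasFDerivAt
      rw [partialDeriv, this.fderiv]
      simp [coordVec, partialDeriv]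
    · filter_upwards [hnear] with q hq
      have hq0 : (f q.1 : ℂ) ≠ 0 := by exact_mod_cast (hf.pos q.1 (ne_of_gt hq)).ne'
      simp [gradient, hvol q hq, hinv q hq]
      field_simp
  rw [laplaceBeltrami, divergence, Fin.sum_univ_two, h0, h1, hvol p hp, grushinExpr]
  push_cast
  field_simp
  ring

theorem grushinExpr_add (f : ℝ → ℝ) {u v : ℝ × ℝ → ℂ} (hu : ContDiff ℝ ∞ u)
    (hv : ContDiff ℝ ∞ v) : grushinExpr f (u + v) = grushinExpr f u + grushinExpr f v := by
  ext p
  simp only [grushinExpr, partialDeriv_add hu hv, Pi.add_apply,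
    partialDeriv_add (contDiff_partialDeriv hu _) (contDiff_partialDeriv hv _)]
  ring

theorem grushinExpr_smul (f : ℝ → ℝ) {u : ℝ × ℝ → ℂ} (hu : ContDiff ℝ ∞ u) (c : ℂ) :
    grushinExpr f (c • u) = c • grushinExpr f u := by
  ext p
  simp only [grushinExpr, partialDeriv_smul hu, Pi.smul_apply,
    partialDeriv_smul (contDiff_partialDeriv hu _), smul_eq_mul]
  ring

theorem ae_mem_halfPlane (f : ℝ → ℝ) : ∀ᵐ p ∂grushinMeasure f, p ∈ halfPlane :=
  (withDensity_absolutelyContinuous _ _).ae_le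
    (ae_restrict_mem halfPlane.isOpen.measurableSet)

theorem grushinMeasure_compact_lt_top {f : ℝ → ℝ} (hf : IsGrushinProfile f) {K : Set (ℝ × ℝ)}
    (hK : IsCompact K) (hKM : K ⊆ halfPlane) : grushinMeasure f K < ⊤ := by
  have hc : ContinuousOn (fun p : ℝ × ℝ => f p.1) K := by
    refine hf.smooth.continuousOn.comp continuousOn_fst fun p hp => ?_
    exact ne_of_gt (hKM hp)
  obtain ⟨C, hC⟩ := hK.bddAbove_image hc
  rw [grushinMeasure, volMeasure, withDensity_apply _ hK.measurableSet,
    Measure.restrict_restrict hK.measurableSet]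
  calc _ ≤ ∫⁻ p in K ∩ halfPlane, ENNReal.ofReal C := by
        refine setLIntegral_mono' (hK.measurableSet.inter halfPlane.isOpen.measurableSet) ?_
        intro p hp
        rw [volDensity_metric, abs_of_pos (hf.pos p.1 (ne_of_gt (hKM hp.1)))]
        exact ENNReal.ofReal_le_ofReal (hC ⟨p, hp.1, rfl⟩)
    _ < ⊤ := by
        rw [setLIntegral_const]
        exact ENNReal.mul_lt_top ENNReal.ofReal_lt_top
          ((measure_mono Set.inter_subset_left).trans_lt hK.measure_lt_top)

theorem memLp_of_continuous {f : ℝ → ℝ} (hf : IsGrushinProfile f) {K : Set (ℝ × ℝ)}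
    (hK : IsCompact K) (hKM : K ⊆ halfPlane) {h : ℝ × ℝ → ℂ} (hc : Continuous h)
    (h0 : ∀ p, p ∉ K → h p = 0) : MemLp h 2 (grushinMeasure f) := by
  have hind : K.indicator h = h := by
    ext p
    by_cases hp : p ∈ K
    · simp [hp]
    · simp [hp, h0 p hp]
  rw [← hind, memLp_indicator_iff_restrict hK.measurableSet]
  have : IsFiniteMeasure ((grushinMeasure f).restrict K) :=
    ⟨by simpa using grushinMeasure_compact_lt_top hf hK hKM⟩
  obtain ⟨C, hC⟩ := hK.exists_bound_of_continuousOn hc.continuousOn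
  exact MemLp.of_bound hc.aestronglyMeasurable C (ae_restrict_of_forall_mem hK.measurableSet hC)

theorem memLp_testFunction {f : ℝ → ℝ} (hf : IsGrushinProfile f) (φ : 𝓓(halfPlane, ℂ)) :
    MemLp φ 2 (grushinMeasure f) :=
  memLp_of_continuous hf φ.hasCompactSupport φ.tsupport_subset φ.continuous
    fun _ hp => image_eq_zero_of_notMem_tsupport hp

theorem memLp_grushinExpr {f : ℝ → ℝ} (hf : IsGrushinProfile f) (φ : 𝓓(halfPlane, ℂ)) :
    MemLp (grushinExpr f φ) 2 (grushinMeasure f) := by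
  have hu : ContDiff ℝ ∞ φ := φ.contDiff
  have hz : ∀ p, p ∉ tsupport φ → grushinExpr f φ p = 0 := by
    intro p hp
    have h1 (i : Fin 2) : partialDeriv i φ p = 0 :=
      image_eq_zero_of_notMem_tsupport fun h => hp (tsupport_partialDeriv_subset _ _ h)
    have h2 (i : Fin 2) : partialDeriv i (partialDeriv i φ) p = 0 :=
      image_eq_zero_of_notMem_tsupport fun h => hp (tsupport_partialDeriv_subset _ _
        (tsupport_partialDeriv_subset _ _ h))
    simp [grushinExpr, h1, h2]
  refine memLp_of_continuous hf φ.hasCompactSupport φ.tsupport_subset ?_ hz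
  rw [continuous_iff_continuousAt]
  intro p
  by_cases hp : p ∈ tsupport φ
  · have hp0 : p.1 ≠ 0 := ne_of_gt (φ.tsupport_subset hp)
    have hne : f p.1 ≠ 0 := (hf.pos _ hp0).ne'
    have hmem : ({0}ᶜ : Set ℝ) ∈ 𝓝 p.1 := isOpen_compl_singleton.mem_nhds hp0
    have hcf : ContinuousAt (fun q : ℝ × ℝ => f q.1) p :=
      ContinuousAt.comp (f := Prod.fst) (hf.smooth.contDiffAt hmem).continuousAt continuousAt_fst
    have hcd : ContinuousAt (fun q : ℝ × ℝ => deriv f q.1) p := by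
      refine ContinuousAt.comp (f := Prod.fst) (g := deriv f) ?_ continuousAt_fst
      exact (hf.smooth.continuousOn_deriv_of_isOpen isOpen_compl_singleton
        (by simp)).continuousAt hmem
    have hc0 := (contDiff_partialDeriv hu 0).continuous.continuousAt (x := p)
    have hc00 := (contDiff_partialDeriv (contDiff_partialDeriv hu 0) 0).continuous.continuousAt
      (x := p)
    have hc11 := (contDiff_partialDeriv (contDiff_partialDeriv hu 1) 1).continuous.continuousAt
      (x := p)
    refine (hc00.add (ContinuousAt.mul ?_ hc11)).add (ContinuousAt.mul ?_ hc0)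
    · exact Complex.continuous_ofReal.continuousAt.comp
        (continuousAt_const.div (hcf.pow 2) (pow_ne_zero 2 hne))
    · exact Complex.continuous_ofReal.continuousAt.comp (hcd.div hcf hne)
  · have : grushinExpr f φ =ᶠ[𝓝 p] fun _ => 0 := by
      filter_upwards [(isClosed_tsupport φ).isOpen_compl.mem_nhds hp] with q hq using hz q hq
    exact continuousAt_const.congr this.symm

theorem laplaceBeltrami_ae_eq {f : ℝ → ℝ} (hf : IsGrushinProfile f) (φ : 𝓓(halfPlane, ℂ)) :
    laplaceBeltrami (metric f) φ =ᵐ[grushinMeasure f] grushinExpr f φ := by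
  filter_upwards [ae_mem_halfPlane f] with p hp using laplaceBeltrami_eq hf φ.contDiff hp

theorem memLp_laplaceBeltrami {f : ℝ → ℝ} (hf : IsGrushinProfile f) (φ : 𝓓(halfPlane, ℂ)) :
    MemLp (laplaceBeltrami (metric f) φ) 2 (grushinMeasure f) :=
  (memLp_congr_ae (laplaceBeltrami_ae_eq hf φ)).2 (memLp_grushinExpr hf φ)

/-- The embedding of `C_c^∞(M)` into `L²(M, dμ_f)`. -/
def toL2 {f : ℝ → ℝ} (hf : IsGrushinProfile f) : 𝓓(halfPlane, ℂ) →ₗ[ℂ] GrushinL2 f where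
  toFun φ := (memLp_testFunction hf φ).toLp φ
  map_add' _ _ := rfl
  map_smul' _ _ := rfl

/-- The map `φ ↦ -Δ_f φ` from `C_c^∞(M)` to `L²(M, dμ_f)`. -/
def negLaplacian {f : ℝ → ℝ} (hf : IsGrushinProfile f) : 𝓓(halfPlane, ℂ) →ₗ[ℂ] GrushinL2 f where
  toFun φ := -(memLp_laplaceBeltrami hf φ).toLp (laplaceBeltrami (metric f) φ)
  map_add' φ ψ := by
    rw [← neg_add, ← MemLp.toLp_add]
    congr 1
    apply MemLp.toLp_congr
    filter_upwards [ae_mem_halfPlane f] with p hp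
    rw [Pi.add_apply, laplaceBeltrami_eq hf (φ + ψ).contDiff hp,
      laplaceBeltrami_eq hf φ.contDiff hp, laplaceBeltrami_eq hf ψ.contDiff hp]
    exact congrFun (grushinExpr_add f φ.contDiff ψ.contDiff) p
  map_smul' c φ := by
    rw [RingHom.id_apply, smul_neg, ← MemLp.toLp_const_smul]
    congr 1
    apply MemLp.toLp_congr
    filter_upwards [ae_mem_halfPlane f] with p hp
    rw [Pi.smul_apply, laplaceBeltrami_eq hf (c • φ).contDiff hp,
      laplaceBeltrami_eq hf φ.contDiff hp]
    exact congrFun (grushinExpr_smul f φ.contDiff c) p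

theorem toL2_injective {f : ℝ → ℝ} (hf : IsGrushinProfile f) : Function.Injective (toL2 hf) := by
  intro φ ψ h
  have hae : φ =ᵐ[grushinMeasure f] ψ := (MemLp.toLp_eq_toLp_iff (memLp_testFunction hf φ) (memLp_testFunction hf ψ)).1 h
  have hvol : φ =ᵐ[volume.restrict (halfPlane : Set (ℝ × ℝ))] ψ := by
    have hm : Measurable fun p => ENNReal.ofReal (volDensity (metric f) p) := by
      simp_rw [volDensity_metric]
      exact (continuous_abs.measurable.comp (hf.measurable.comp measurable_fst)).ennreal_ofReal
    have h1 := (ae_withDensity_iff hm).1 hae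
    filter_upwards [h1, ae_restrict_mem halfPlane.isOpen.measurableSet] with p hp hpM
    refine hp ?_
    rw [volDensity_metric]
    simpa using (hf.pos p.1 (ne_of_gt hpM)).ne'
  have hon := Measure.eqOn_open_of_ae_eq hvol halfPlane.isOpen φ.continuous.continuousOn
    ψ.continuous.continuousOn
  ext p
  by_cases hp : p ∈ halfPlane
  · exact hon hp
  · rw [image_eq_zero_of_notMem_tsupport fun h => hp (φ.tsupport_subset h),
      image_eq_zero_of_notMem_tsupport fun h => hp (ψ.tsupport_subset h)]

/-- The minimal operator `H_f = -Δ_f` with domain `C_c^∞(M)` in `L²(M, dμ_f)`. -/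
def hamiltonian {f : ℝ → ℝ} (hf : IsGrushinProfile f) : GrushinL2 f →ₗ.[ℂ] GrushinL2 f where
  domain := LinearMap.range (toL2 hf)
  toFun := negLaplacian hf ∘ₗ (LinearEquiv.ofInjective (toL2 hf) (toL2_injective hf)).symm

theorem hamiltonian_apply {f : ℝ → ℝ} (hf : IsGrushinProfile f) (φ : 𝓓(halfPlane, ℂ)) :
    hamiltonian hf ⟨toL2 hf φ, LinearMap.mem_range_self _ φ⟩ = negLaplacian hf φ := by
  change negLaplacian hf ((LinearEquiv.ofInjective (toL2 hf) (toL2_injective hf)).symm _) = _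
  congr 1
  exact (LinearEquiv.ofInjective (toL2 hf) (toL2_injective hf)).symm_apply_apply φ

/-! ### Essential self-adjointness and deficiency indices -/

/-- An operator is essentially self-adjoint if its closure is self-adjoint. (With Mathlib's
conventions a self-adjoint operator is densely defined and closed, so this includes that the
operator is densely defined and closable.) -/
def IsEssentiallySelfAdjoint {H : Type*} [NormedAddCommGroup H] [InnerProductSpace ℂ H]
    [CompleteSpace H] (T : H →ₗ.[ℂ] H) : Prop :=
  IsSelfAdjoint T.closure

/-- The deficiency space `ker (T* - z)`. -/
def deficiencySpace {H : Type*} [NormedAddCommGroup H] [InnerProductSpace ℂ H]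
    [CompleteSpace H] (T : H →ₗ.[ℂ] H) (z : ℂ) : Submodule ℂ H :=
  (LinearMap.ker (T†.toFun - z • T†.domain.subtype)).map T†.domain.subtype

/-- The dimension of the deficiency space `ker (T* - z)`, with value `⊤` if it is infinite. The
deficiency indices of `T` are the values at `z = i` and `z = -i`. -/
def deficiencyIndex {H : Type*} [NormedAddCommGroup H] [InnerProductSpace ℂ H]
    [CompleteSpace H] (T : H →ₗ.[ℂ] H) (z : ℂ) : ℕ∞ :=
  Cardinal.toENat (Module.rank ℂ (deficiencySpace T z))

end Grushin

end

noncomputable section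

namespace Grushin

/-! ### Symmetric operators and their deficiency spaces -/

section Abstract

variable {H : Type*} [NormedAddCommGroup H] [InnerProductSpace ℂ H] [CompleteSpace H]
  {T : H →ₗ.[ℂ] H}

set_option linter.unusedSectionVars false

/-! Multiplication by `√f` carries `H_f` to `-∂ₓ² - f⁻² ∂ᵧ² + V` in flat `L²`, with `V = (2 f f'' -
f'²) / (4 f²)`, because `(√f)'' = V √f`. The hypotheses of (i) and (ii) read `V ≥ 3 / (4 x²)` and `V
≤ (3 - ε) / (4 x²)`. The constant `3/4` is the limit-point threshold for an inverse-square
potential: the solution `x ^ (-1/2)` of `F'' = 3 / (4 x²) F` just fails to be square integrable at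
`0`.

(i) It suffices that `ker (H_f* - z)` is trivial for `z = ± i`. For `u` in this kernel put `v = √f ·
conj u` and smooth it in `y` only: `w = b ∗ v`. For each fixed `y`, `w` solves weakly in `x` the
equation `w'' = (V - conj z) w - f⁻² ∂ᵧ² w`, hence has a twice differentiable representative
(`weak_equation_smoothY`, `exists_primitive_of_weak_deriv2`). For `N = |w|²`, completing the square
bounds `N'' + N'/x - N/x²` below by `2 Re (conj w · (w'' - 3 / (4 x²) w))` (`energy_inequality`).
Test this with a weight `θ ≥ 0` and integrate in `y`: since `Re ∫ conj w · ∂ᵧ² w dy ≤ 0` and `Re z =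
0`, the result is `0 ≤ ∬ |w|² (θ'' - θ'/x)` (`energy_nonneg`). For `θ = x² / (1 + x²)` the bracket
is `-8 x² / (1 + x²)³ < 0`, and a cutoff in `log x / n` costs only `O(1/n)`; so `w ∈ L²` forces `w =
0` (`ae_eq_zero_of_energy`). All smoothings of `v` vanish, hence `v = 0`.

(ii), (iii) Comparing `√f` with a power gives `f = O(x ^ (-1 + 2δ))`, so `f` is integrable at `0`
(`integrableOn_profile`) and boxes touching the line `x = 0` have finite volume. The radial
solutions `1` and `h = ∫ₓ¹ dt/f` are both bounded near `0`, as is `f⁻²`, by the lower bound on `f`.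
With a cutoff `χ(x)` and bumps `b_k(y)` of disjoint supports, `χ b_k` and `χ h b_k` therefore lie in
the domain of `H_f*`, and their boundary form is `∫ b_j b_k`, a diagonal matrix with nonzero
diagonal (`boundary_form`). The boundary form vanishes on the closure of `H_f`, so by von Neumann's
decomposition its infinite rank prevents the two deficiency spaces from both being
finite-dimensional (`not_finite_deficiencySpaces`). Complex conjugation exchanges them, so both are
infinite-dimensional. -/

theorem mem_adjoint_graph_iff (hT : Dense (T.domain : Set H)) {x y : H} :
    (x, y) ∈ T†.graph ↔ ∀ v : T.domain, inner ℂ y (v : H) = inner ℂ x (T v) := by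
  constructor
  · intro h v
    obtain ⟨z, hz, hzy⟩ := (LinearPMap.mem_graph_iff _).1 h
    have := LinearPMap.adjoint_isFormalAdjoint hT z v
    simp only at hz hzy
    rwa [hz, hzy] at this
  · intro h
    have hx : x ∈ T†.domain := LinearPMap.mem_adjoint_domain_of_exists x ⟨y, h⟩
    exact (LinearPMap.mem_graph_iff _).2 ⟨⟨x, hx⟩, rfl, LinearPMap.adjoint_apply_eq hT _ h⟩

theorem mem_deficiencySpace_iff_graph {z : ℂ} {x : H} :
    x ∈ deficiencySpace T z ↔ (x, z • x) ∈ T†.graph := by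
  rw [deficiencySpace, LinearPMap.mem_graph_iff]
  constructor
  · rintro ⟨y, hy, rfl⟩
    refine ⟨y, rfl, ?_⟩
    simpa [sub_eq_zero] using hy
  · rintro ⟨y, hy, hyz⟩
    refine ⟨y, ?_, hy⟩
    simp only at hy hyz
    simp only [SetLike.mem_coe, LinearMap.mem_ker, LinearMap.sub_apply, LinearMap.smul_apply,
      Submodule.subtype_apply, sub_eq_zero]
    rw [hy]
    exact hyz

theorem mem_deficiencySpace_iff (hT : Dense (T.domain : Set H)) {z : ℂ} {x : H} :
    x ∈ deficiencySpace T z ↔ ∀ v : T.domain, inner ℂ (z • x) (v : H) = inner ℂ x (T v) := by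
  rw [mem_deficiencySpace_iff_graph, mem_adjoint_graph_iff hT]

theorem closure_graph_le_adjoint (hT : Dense (T.domain : Set H)) (hsym : T.IsFormalAdjoint T) :
    T.graph.topologicalClosure ≤ T†.graph :=
  Submodule.topologicalClosure_minimal _
    (LinearPMap.le_graph_of_le (hsym.le_adjoint hT)) (LinearPMap.adjoint_isClosed hT)

/-- Symmetry makes `⟨T v, v⟩` real, so the cross term `2 Re (i ⟨T v, v⟩)` vanishes. Convergence of
`T v + i v` thus controls `v` and `T v` separately. -/
theorem norm_sq_apply_add_I_smul (hsym : T.IsFormalAdjoint T) (v : T.domain) :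
    ‖T v + Complex.I • (v : H)‖ ^ 2 = ‖T v‖ ^ 2 + ‖(v : H)‖ ^ 2 := by
  have h1 : (inner ℂ (T v) (v : H)).im = 0 := by
    have := congrArg Complex.im (hsym v v)
    rw [← inner_conj_symm (v : H) (T v), Complex.conj_im] at this
    linarith
  rw [@norm_add_sq ℂ, inner_smul_right, norm_smul]
  simp [h1]

/-- A vector in the closure of the range of `T + i` comes from the closure of the graph. -/
theorem exists_mem_closure_graph (hT : Dense (T.domain : Set H)) (hsym : T.IsFormalAdjoint T)
    {y : H} (hy : ∀ n ∈ deficiencySpace T Complex.I, inner ℂ n y = 0) :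
    ∃ a b : H, (a, b) ∈ T.graph.topologicalClosure ∧ b + Complex.I • a = y := by
  set R : Submodule ℂ H := LinearMap.range (T.toFun + Complex.I • T.domain.subtype) with hR
  -- The orthogonal complement of the range of `T + i` lies in `ker (T* - i)`, so `y` is in the
  -- closure of that range.
  have hRo : ∀ n ∈ Rᗮ, n ∈ deficiencySpace T Complex.I := by
    intro n hn
    rw [mem_deficiencySpace_iff hT]
    intro v
    have := (Submodule.mem_orthogonal' _ _).1 hn (T v + Complex.I • (v : H)) ⟨v, rfl⟩
    rw [inner_add_right, inner_smul_right] at this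
    rw [inner_smul_left, Complex.conj_I]
    linear_combination -this
  have hyR : y ∈ R.topologicalClosure := by
    rw [← Submodule.orthogonal_orthogonal_eq_closure, Submodule.mem_orthogonal]
    exact fun n hn => hy n (hRo n hn)
  obtain ⟨s, hs, hsy⟩ := mem_closure_iff_seq_limit.1 hyR
  choose v hv using hs
  have hv' : ∀ n, T (v n) + Complex.I • (v n : H) = s n := hv
  -- The Pythagorean identity makes both the preimages and their images under `T` Cauchy.
  have hsub : ∀ m n, ‖s m - s n‖ ^ 2 = ‖T (v m) - T (v n)‖ ^ 2 + ‖(v m : H) - v n‖ ^ 2 := by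
    intro m n
    have := norm_sq_apply_add_I_smul hsym (v m - v n)
    rw [← hv' m, ← hv' n]
    rw [LinearPMap.map_sub, Submodule.coe_sub, smul_sub] at this
    rw [← this]
    congr 2
    abel
  have hc := hsy.cauchySeq
  have hcv : CauchySeq fun n => (v n : H) := by
    refine cauchySeq_iff_tendsto_dist_atTop_0.2 (squeeze_zero (fun _ => dist_nonneg) ?_
      (cauchySeq_iff_tendsto_dist_atTop_0.1 hc))
    rintro ⟨m, n⟩
    rw [dist_eq_norm, dist_eq_norm]
    refine (sq_le_sq₀ (norm_nonneg _) (norm_nonneg _)).1 ?_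
    rw [hsub]
    nlinarith [sq_nonneg ‖T (v m) - T (v n)‖]
  have hcT : CauchySeq fun n => T (v n) := by
    refine cauchySeq_iff_tendsto_dist_atTop_0.2 (squeeze_zero (fun _ => dist_nonneg) ?_
      (cauchySeq_iff_tendsto_dist_atTop_0.1 hc))
    rintro ⟨m, n⟩
    rw [dist_eq_norm, dist_eq_norm]
    refine (sq_le_sq₀ (norm_nonneg _) (norm_nonneg _)).1 ?_
    rw [hsub]
    nlinarith [sq_nonneg ‖(v m : H) - v n‖]
  obtain ⟨a, ha⟩ := cauchySeq_tendsto_of_complete hcv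
  obtain ⟨b, hb⟩ := cauchySeq_tendsto_of_complete hcT
  refine ⟨a, b, ?_, ?_⟩
  · exact mem_closure_of_tendsto (ha.prodMk_nhds hb)
      (Filter.Eventually.of_forall fun n => LinearPMap.mem_graph T (v n))
  · refine tendsto_nhds_unique (hb.add (ha.const_smul Complex.I)) ?_
    simpa only [hv'] using hsy

/-- Half of von Neumann's decomposition: write `y + i x = b + i a` with `(a, b)` in the closed
graph; then `T* + i` annihilates `x - a`. -/
theorem adjoint_graph_le_sup (hT : Dense (T.domain : Set H)) (hsym : T.IsFormalAdjoint T)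
    {x y : H} (hxy : (x, y) ∈ T†.graph) (hperp : ∀ n ∈ deficiencySpace T Complex.I,
      inner ℂ n (y + Complex.I • x) = 0) :
    ∃ a b : H, (a, b) ∈ T.graph.topologicalClosure ∧
      x - a ∈ deficiencySpace T (-Complex.I) ∧ y - b = -Complex.I • (x - a) := by
  obtain ⟨a, b, hab, h⟩ := exists_mem_closure_graph hT hsym hperp
  have hyb : y - b = -Complex.I • (x - a) := by
    rw [neg_smul, smul_sub, sub_eq_iff_eq_add]
    rw [← sub_eq_iff_eq_add] at h
    rw [← h]
    abel
  refine ⟨a, b, hab, ?_, hyb⟩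
  rw [mem_deficiencySpace_iff_graph, ← hyb]
  exact sub_mem hxy (closure_graph_le_adjoint hT hsym hab)

theorem isClosable_of_symmetric (hT : Dense (T.domain : Set H)) (hsym : T.IsFormalAdjoint T) :
    T.IsClosable :=
  (LinearPMap.adjoint_isClosed hT).isClosable.leIsClosable (hsym.le_adjoint hT)

/-- With nothing in either deficiency space, von Neumann's decomposition identifies the closure of
`T` with `T†`. It remains to see that the closure has the same adjoint as `T`. -/
theorem isEssentiallySelfAdjoint_of_deficiencySpace_eq_bot (hT : Dense (T.domain : Set H))
    (hsym : T.IsFormalAdjoint T) (hp : deficiencySpace T Complex.I = ⊥)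
    (hm : deficiencySpace T (-Complex.I) = ⊥) : IsEssentiallySelfAdjoint T := by
  have hcl := isClosable_of_symmetric hT hsym
  have hdense : Dense (T.closure.domain : Set H) := hT.mono T.le_closure.1
  have hg : T.graph.topologicalClosure = T†.graph := by
    refine le_antisymm (closure_graph_le_adjoint hT hsym) ?_
    rintro ⟨x, y⟩ hxy
    obtain ⟨a, b, hab, h1, h2⟩ := adjoint_graph_le_sup hT hsym hxy (by
      rw [hp]; rintro n rfl; simp)
    rw [hm, Submodule.mem_bot] at h1
    rw [h1, smul_zero, sub_eq_zero] at h2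
    rw [sub_eq_zero.1 h1, h2]
    exact hab
  have hce : T.closure = T† :=
    LinearPMap.eq_of_eq_graph (hcl.graph_closure_eq_closure_graph.symm.trans hg)
  rw [IsEssentiallySelfAdjoint, LinearPMap.isSelfAdjoint_def]
  refine LinearPMap.eq_of_eq_graph ?_
  ext ⟨x, y⟩
  rw [mem_adjoint_graph_iff hdense]
  constructor
  -- Testing against the smaller domain of `T` already gives membership in the graph of `T†`.
  · intro h
    rw [hce, mem_adjoint_graph_iff hT]
    intro v
    have hv := T.le_closure.1 v.2
    have := h ⟨v, hv⟩
    rwa [← T.le_closure.2 (x := v) (y := ⟨v, hv⟩) rfl] at this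
  -- The relation is closed in the pair `(x, y)`, so it may be checked on the graph of `T`, where it
  -- says that `v` belongs to `T†`.
  · intro h v
    rw [← hcl.graph_closure_eq_closure_graph] at h
    have hv : ((v : H), T.closure v) ∈ T†.graph := hce ▸ LinearPMap.mem_graph T.closure v
    have hcont : IsClosed {p : H × H | inner ℂ p.2 (v : H) = inner ℂ p.1 (T.closure v)} :=
      isClosed_eq (by fun_prop) (by fun_prop)
    refine hcont.closure_subset_iff.2 ?_ h
    rintro ⟨a, b⟩ hab
    obtain ⟨w, hw, hwb⟩ := (LinearPMap.mem_graph_iff _).1 hab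
    simp only at hw hwb
    have := (mem_adjoint_graph_iff hT).1 hv w
    rw [hw, hwb] at this
    simp only [Set.mem_ofPred_eq]
    rw [← inner_conj_symm, ← this, inner_conj_symm]

/-- By continuity a vector of the deficiency space is an eigenvector of the adjoint of the closure,
which is the closure itself; a symmetric operator has no eigenvalue `i`. -/
theorem deficiencySpace_eq_bot_of_isEssentiallySelfAdjoint (hT : Dense (T.domain : Set H))
    (hsym : T.IsFormalAdjoint T) (h : IsEssentiallySelfAdjoint T) :
    deficiencySpace T Complex.I = ⊥ := by
  have hcl := isClosable_of_symmetric hT hsym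
  have hdense : Dense (T.closure.domain : Set H) := hT.mono T.le_closure.1
  rw [IsEssentiallySelfAdjoint, LinearPMap.isSelfAdjoint_def] at h
  rw [eq_bot_iff]
  intro n hn
  have h1 : (n, Complex.I • n) ∈ T.closure†.graph := by
    rw [mem_adjoint_graph_iff hdense]
    intro v
    have hv : ((v : H), T.closure v) ∈ T.graph.topologicalClosure := by
      rw [hcl.graph_closure_eq_closure_graph]
      exact LinearPMap.mem_graph T.closure v
    have hcont : IsClosed {p : H × H | inner ℂ (Complex.I • n) p.1 = inner ℂ n p.2} :=
      isClosed_eq (by fun_prop) (by fun_prop)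
    refine hcont.closure_subset_iff.2 ?_ hv
    rintro ⟨a, b⟩ hab
    obtain ⟨w, hw, hwb⟩ := (LinearPMap.mem_graph_iff _).1 hab
    simp only at hw hwb
    have := (mem_deficiencySpace_iff hT).1 hn w
    rwa [hw, hwb] at this
  obtain ⟨w, hw, hwn⟩ := (LinearPMap.mem_graph_iff _).1 (h ▸ h1)
  simp only at hw hwn
  have h2 := (mem_adjoint_graph_iff hdense).1 h1 w
  rw [hwn, hw, inner_smul_left, inner_smul_right, Complex.conj_I, inner_self_eq_norm_sq_to_K] at h2
  have h3 : (‖n‖ : ℂ) ^ 2 = 0 := by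
    have h4 : 2 * Complex.I * (‖n‖ : ℂ) ^ 2 = 0 := by
      simp only [Complex.coe_algebraMap] at h2
      linear_combination -h2
    simpa using h4
  simpa using h3

/-- If the boundary form of a symmetric operator has infinite rank then its deficiency spaces are
not both finite-dimensional. -/
theorem not_finite_deficiencySpaces (hT : Dense (T.domain : Set H)) (hsym : T.IsFormalAdjoint T)
    (u u' w w' : ℕ → H) (hu : ∀ k, (u k, u' k) ∈ T†.graph) (hw : ∀ k, (w k, w' k) ∈ T†.graph)
    (hd : ∀ k, inner ℂ (w k) (u' k) - inner ℂ (w' k) (u k) ≠ 0)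
    (ho : ∀ j k, j ≠ k → inner ℂ (w j) (u' k) - inner ℂ (w' j) (u k) = 0) :
    ¬ (Module.Finite ℂ (deficiencySpace T Complex.I) ∧
      Module.Finite ℂ (deficiencySpace T (-Complex.I))) := by
  rintro ⟨hfp, hfm⟩
  -- `Φ` records the boundary form of a pair against every `w j`. It kills the closure of the graph
  -- of `T`, so on the graph of `T†` it is determined by the two deficiency components.
  let Φ : H × H →ₗ[ℂ] (ℕ → ℂ) := LinearMap.pi fun j =>
    (innerₛₗ ℂ (w j)).comp (LinearMap.snd ℂ H H) - (innerₛₗ ℂ (w' j)).comp (LinearMap.fst ℂ H H)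
  have hΦ : ∀ x y j, Φ (x, y) j = inner ℂ (w j) y - inner ℂ (w' j) x := fun _ _ _ => rfl
  have hΦ0 : ∀ p ∈ T.graph.topologicalClosure, Φ p = 0 := by
    intro p hp
    have hcont : IsClosed {p : H × H | ∀ j, inner ℂ (w j) p.2 - inner ℂ (w' j) p.1 = 0} := by
      simp only [Set.ofPred_forall]
      exact isClosed_iInter fun j => isClosed_eq (by fun_prop) (by fun_prop)
    refine funext fun j => (hcont.closure_subset_iff.2 ?_ hp : _) j
    rintro ⟨a, b⟩ hab j
    obtain ⟨v, hv, hvb⟩ := (LinearPMap.mem_graph_iff _).1 hab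
    simp only at hv hvb
    have := (mem_adjoint_graph_iff hT).1 (hw j) v
    rw [hv, hvb] at this
    simp [this]
  let Lz : ℂ → H →ₗ[ℂ] H × H := fun z => LinearMap.prod LinearMap.id (z • LinearMap.id)
  have hLz : ∀ z x, Lz z x = (x, z • x) := fun _ _ => rfl
  let N : Submodule ℂ (ℕ → ℂ) :=
    (deficiencySpace T Complex.I).map (Φ ∘ₗ Lz Complex.I) ⊔
    (deficiencySpace T (-Complex.I)).map (Φ ∘ₗ Lz (-Complex.I))
  have hNfin : Module.Finite ℂ N := by infer_instance
  have hmem : ∀ k, Φ (u k, u' k) ∈ N := by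
    intro k
    -- On `ker (T* - i)` the operator `T* + i` is multiplication by `2i`. Subtracting `n / (2i)`
    -- from `u k` therefore removes exactly the component `n` of `u' k + i u k`, as the
    -- decomposition requires.
    let n := (deficiencySpace T Complex.I).starProjection (u' k + Complex.I • u k)
    have hn : n ∈ deficiencySpace T Complex.I := Submodule.starProjection_apply_mem _ _
    let c : ℂ := (2 * Complex.I)⁻¹
    have hcn : (c • n, Complex.I • c • n) ∈ T†.graph :=
      mem_deficiencySpace_iff_graph.1 (Submodule.smul_mem _ c hn)
    have hsubk : (u k - c • n, u' k - Complex.I • c • n) ∈ T†.graph := sub_mem (hu k) hcn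
    obtain ⟨a, b, hab, h1, h2⟩ := adjoint_graph_le_sup hT hsym hsubk (by
      intro m hm
      have e : (u' k - Complex.I • c • n) + Complex.I • (u k - c • n)
          = (u' k + Complex.I • u k) - n := by
        have : n = Complex.I • c • n + Complex.I • c • n := by
          rw [smul_smul, ← add_smul]
          have : Complex.I * c + Complex.I * c = 1 := by
            simp only [c]; field_simp; norm_num
          rw [this, one_smul]
        rw [smul_sub]
        exact sub_eq_zero.1 ((by module : _ = n - (Complex.I • c • n + Complex.I • c • n)).trans
          (sub_eq_zero.2 this))
      rw [e]
      exact (Submodule.mem_orthogonal _ _).1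
        (Submodule.sub_starProjection_mem_orthogonal (K := deficiencySpace T Complex.I) _) m hm)
    have hdec : (u k, u' k) = Lz Complex.I (c • n) + (a, b)
        + Lz (-Complex.I) (u k - c • n - a) := by
      rw [hLz, hLz, ← h2, Prod.mk_add_mk, Prod.mk_add_mk, Prod.mk.injEq]
      constructor <;> module
    rw [hdec, map_add, map_add, hΦ0 _ hab, add_zero]
    exact Submodule.add_mem_sup ⟨_, Submodule.smul_mem _ c hn, rfl⟩ ⟨_, h1, rfl⟩
  -- The matrix of boundary values is diagonal with nonzero diagonal, so the `Φ (u k, u' k)` are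
  -- infinitely many independent vectors of the finite-dimensional `N`.
  have hind : LinearIndependent ℂ fun k => (⟨Φ (u k, u' k), hmem k⟩ : N) := by
    refine LinearIndependent.of_comp N.subtype ?_
    rw [linearIndependent_iff']
    intro s g hg i hi
    have := congrFun hg i
    simp only [Function.comp_apply, Submodule.subtype_apply, Finset.sum_apply, Pi.smul_apply,
      Pi.zero_apply, hΦ, smul_eq_mul] at this
    rw [Finset.sum_eq_single i (fun k _ hk => by rw [ho i k hk.symm, mul_zero])
      (fun h => absurd hi h)] at this
    exact (mul_eq_zero.1 this).resolve_right (hd i)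
  exact not_finite_iff_infinite.2 inferInstance hind.finite

theorem deficiencyIndex_eq_top_iff {z : ℂ} :
    deficiencyIndex T z = ⊤ ↔ ¬ Module.Finite ℂ (deficiencySpace T z) := by
  rw [deficiencyIndex, Cardinal.toENat_eq_top, ← not_lt, Module.rank_lt_aleph0_iff]

end Abstract

/-! ### Integration over the Grushin plane and Green's identity -/

section Basics

variable {f : ℝ → ℝ}

theorem measurable_volDensity (hf : IsGrushinProfile f) :
    Measurable fun p => ENNReal.ofReal (volDensity (metric f) p) := by
  simp_rw [volDensity_metric]
  exact (continuous_abs.measurable.comp (hf.measurable.comp measurable_fst)).ennreal_ofReal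

theorem integral_grushinMeasure (hf : IsGrushinProfile f) (h : ℝ × ℝ → ℂ) :
    ∫ p, h p ∂grushinMeasure f = ∫ p in halfPlane, (f p.1 : ℂ) * h p := by
  rw [grushinMeasure, volMeasure, integral_withDensity_eq_integral_toReal_smul
    (measurable_volDensity hf) (by simp)]
  refine setIntegral_congr_fun halfPlane.isOpen.measurableSet fun p hp => ?_
  simp only [volDensity_metric]
  rw [ENNReal.toReal_ofReal (abs_nonneg _), abs_of_pos (hf.pos _ (ne_of_gt hp)),
    Complex.real_smul]

theorem ae_grushinMeasure_iff (hf : IsGrushinProfile f) {P : ℝ × ℝ → Prop} :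
    (∀ᵐ p ∂grushinMeasure f, P p) ↔ ∀ᵐ p ∂volume.restrict (halfPlane : Set (ℝ × ℝ)), P p := by
  rw [grushinMeasure, volMeasure, ae_withDensity_iff (measurable_volDensity hf)]
  constructor
  · intro h
    filter_upwards [h, ae_restrict_mem halfPlane.isOpen.measurableSet] with p hp hpM
    refine hp ?_
    rw [volDensity_metric]
    simpa using (hf.pos p.1 (ne_of_gt hpM)).ne'
  · intro h
    filter_upwards [h] with p hp _ using hp

theorem inner_toLp {h : ℝ × ℝ → ℂ} (hh : MemLp h 2 (grushinMeasure f)) (x : GrushinL2 f) :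
    inner ℂ x (hh.toLp h) = ∫ p, starRingEnd ℂ (x p) * h p ∂grushinMeasure f := by
  rw [L2.inner_def]
  refine integral_congr_ae ?_
  filter_upwards [hh.coeFn_toLp] with p hp
  rw [hp, RCLike.inner_apply']

theorem contDiffAt_profile (hf : IsGrushinProfile f) {x : ℝ} (hx : 0 < x) :
    ContDiffAt ℝ ∞ f x :=
  hf.smooth.contDiffAt (isOpen_compl_singleton.mem_nhds hx.ne')

theorem partialDeriv_mul {a b : ℝ × ℝ → ℂ} {p : ℝ × ℝ} (ha : DifferentiableAt ℝ a p)
    (hb : DifferentiableAt ℝ b p) (i : Fin 2) :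
    partialDeriv i (fun q => a q * b q) p
      = partialDeriv i a p * b p + a p * partialDeriv i b p := by
  rw [partialDeriv, fderiv_fun_mul ha hb]
  simp [partialDeriv]
  ring

theorem partialDeriv_fun_sub {a b : ℝ × ℝ → ℂ} {p : ℝ × ℝ} (ha : DifferentiableAt ℝ a p)
    (hb : DifferentiableAt ℝ b p) (i : Fin 2) :
    partialDeriv i (fun q => a q - b q) p = partialDeriv i a p - partialDeriv i b p := by
  rw [partialDeriv, fderiv_fun_sub ha hb]
  simp [partialDeriv]

theorem partialDeriv_comp_fst {c : ℝ → ℂ} {p : ℝ × ℝ} (hc : DifferentiableAt ℝ c p.1) :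
    partialDeriv 0 (fun q => c q.1) p = deriv c p.1 ∧
      partialDeriv 1 (fun q => c q.1) p = 0 := by
  have h : HasFDerivAt (fun q : ℝ × ℝ => c q.1) _ p :=
    hc.hasFDerivAt.comp p hasFDerivAt_fst
  simp [partialDeriv, h.fderiv, coordVec]

theorem partialDeriv_comp_snd {c : ℝ → ℂ} {p : ℝ × ℝ} (hc : DifferentiableAt ℝ c p.2) :
    partialDeriv 0 (fun q => c q.2) p = 0 ∧
      partialDeriv 1 (fun q => c q.2) p = deriv c p.2 := by
  have h : HasFDerivAt (fun q : ℝ × ℝ => c q.2) _ p :=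
    hc.hasFDerivAt.comp p hasFDerivAt_snd
  simp [partialDeriv, h.fderiv, coordVec]

theorem contDiffAt_partialDeriv {w : ℝ × ℝ → ℂ} {p : ℝ × ℝ} (hw : ContDiffAt ℝ ∞ w p)
    (i : Fin 2) : ContDiffAt ℝ ∞ (partialDeriv i w) p :=
  (hw.fderiv_right (m := ∞) (by simp)).clm_apply contDiffAt_const

theorem partialDeriv_conj (w : ℝ × ℝ → ℂ) (i : Fin 2) :
    partialDeriv i (fun q => starRingEnd ℂ (w q))
      = fun q => starRingEnd ℂ (partialDeriv i w q) := by
  ext p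
  have := Complex.conjCLE.comp_fderiv (f := w) (x := p)
  have h2 := congrArg (fun L : ℝ × ℝ →L[ℝ] ℂ => L (coordVec i)) this
  simpa [partialDeriv, Function.comp_def] using h2

theorem grushinExpr_conj (f : ℝ → ℝ) (w : ℝ × ℝ → ℂ) :
    grushinExpr f (fun q => starRingEnd ℂ (w q))
      = fun q => starRingEnd ℂ (grushinExpr f w q) := by
  ext p
  simp only [grushinExpr, partialDeriv_conj, map_add, map_mul, Complex.conj_ofReal]

theorem integral_partialDeriv_eq_zero {X : ℝ × ℝ → ℂ} (hX : ContDiff ℝ 1 X)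
    (hc : HasCompactSupport X) (i : Fin 2) : ∫ p, partialDeriv i X p = 0 := by
  have h := integral_mul_fderiv_eq_neg_fderiv_mul_of_integrable (μ := volume)
    (f := fun _ : ℝ × ℝ => (1 : ℂ)) (g := X) (v := coordVec i) (by simp)
    (by
      simp only [one_mul]
      exact ((hX.continuous_fderiv (by simp)).clm_apply continuous_const).integrable_of_hasCompactSupport
        (hc.fderiv_apply (𝕜 := ℝ) (coordVec i)))
    (by simpa using hX.continuous.integrable_of_hasCompactSupport hc)
    (fun _ _ => differentiableAt_const _) (fun x _ => hX.differentiable (by simp) x)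
  simpa [partialDeriv] using h

/-- Green's second identity on the Grushin plane. -/
theorem integral_green (hf : IsGrushinProfile f) {w : ℝ × ℝ → ℂ}
    (hw : ContDiffOn ℝ ∞ w halfPlane) (φ : 𝓓(halfPlane, ℂ)) :
    ∫ p in halfPlane, (f p.1 : ℂ) * (w p * grushinExpr f φ p - grushinExpr f w p * φ p) = 0 := by
  have hw' : ∀ p ∈ halfPlane, ContDiffAt ℝ ∞ w p := fun p hp =>
    hw.contDiffAt (halfPlane.isOpen.mem_nhds hp)
  have hφ : ContDiff ℝ ∞ φ := φ.contDiff
  have hfc : ∀ p ∈ halfPlane, ContDiffAt ℝ ∞ (fun x : ℝ => (f x : ℂ)) p.1 := fun p hp =>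
    Complex.ofRealCLM.contDiff.contDiffAt.comp p.1 (contDiffAt_profile hf hp)
  have hf0 : ∀ p ∈ halfPlane, (f p.1 : ℂ) ≠ 0 := fun p hp => by
    exact_mod_cast (hf.pos _ (ne_of_gt hp)).ne'
  -- The integrand is the flat divergence of `(f Y₀, f⁻¹ Y₁)`; the factors `f` and `f⁻¹` are the
  -- volume density times the diagonal entries of the inverse metric.
  let Y : Fin 2 → ℝ × ℝ → ℂ := fun i q => w q * partialDeriv i φ q - φ q * partialDeriv i w q
  let c : Fin 2 → ℝ → ℂ := ![fun x => f x, fun x => (f x : ℂ)⁻¹]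
  have hcs : ∀ i, ∀ p ∈ halfPlane, ContDiffAt ℝ ∞ (c i) p.1 := by
    intro i p hp
    fin_cases i
    · exact hfc p hp
    · exact (hfc p hp).inv (hf0 p hp)
  have hYs : ∀ i, ∀ p ∈ halfPlane, ContDiffAt ℝ ∞ (Y i) p := fun i p hp =>
    ((hw' p hp).mul (contDiff_partialDeriv hφ i).contDiffAt).sub
      (hφ.contDiffAt.mul (contDiffAt_partialDeriv (hw' p hp) i))
  have hY0 : ∀ i, ∀ q, q ∉ tsupport φ → c i q.1 * Y i q = 0 := by
    intro i q hq
    have h1 : φ q = 0 := image_eq_zero_of_notMem_tsupport hq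
    have h2 : partialDeriv i φ q = 0 :=
      image_eq_zero_of_notMem_tsupport fun h => hq (tsupport_partialDeriv_subset _ _ h)
    simp [Y, h1, h2]
  -- `w` is controlled only on the half-plane; the field is globally smooth because it vanishes off
  -- the support of `φ`.
  have hXs : ∀ i, ContDiff ℝ 1 (fun q : ℝ × ℝ => c i q.1 * Y i q) := by
    intro i
    rw [contDiff_iff_contDiffAt]
    intro p
    by_cases hp : p ∈ tsupport φ
    · have hpM := φ.tsupport_subset hp
      have : ContDiffAt ℝ ∞ (fun q : ℝ × ℝ => c i q.1 * Y i q) p :=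
        ((hcs i p hpM).comp p contDiffAt_fst).mul (hYs i p hpM)
      exact this.of_le (by simp)
    · have : (fun q : ℝ × ℝ => c i q.1 * Y i q) =ᶠ[𝓝 p] fun _ => 0 := by
        filter_upwards [(isClosed_tsupport φ).isOpen_compl.mem_nhds hp] with q hq using hY0 i q hq
      exact contDiffAt_const.congr_of_eventuallyEq this
  have hXc : ∀ i, HasCompactSupport (fun q : ℝ × ℝ => c i q.1 * Y i q) := fun i =>
    HasCompactSupport.intro φ.hasCompactSupport (hY0 i)
  have hint : ∀ i, Integrable (partialDeriv i (fun q : ℝ × ℝ => c i q.1 * Y i q)) := fun i =>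
    (((hXs i).continuous_fderiv (by simp)).clm_apply continuous_const).integrable_of_hasCompactSupport
        ((hXc i).fderiv_apply (𝕜 := ℝ) (coordVec i))
  have key : ∀ p ∈ halfPlane,
      (f p.1 : ℂ) * (w p * grushinExpr f φ p - grushinExpr f w p * φ p)
        = partialDeriv 0 (fun q : ℝ × ℝ => c 0 q.1 * Y 0 q) p
          + partialDeriv 1 (fun q : ℝ × ℝ => c 1 q.1 * Y 1 q) p := by
    intro p hp
    have hd : ∀ {g : ℝ × ℝ → ℂ}, ContDiffAt ℝ ∞ g p → DifferentiableAt ℝ g p := fun h =>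
      h.differentiableAt (by simp)
    have hcd : ∀ i, DifferentiableAt ℝ (c i) p.1 := fun i =>
      (hcs i p hp).differentiableAt (by simp)
    have hcd' : ∀ i, DifferentiableAt ℝ (fun q : ℝ × ℝ => c i q.1) p := fun i =>
      (hcd i).comp p differentiableAt_fst
    have hYd : ∀ i j, partialDeriv j (Y i) p = partialDeriv j w p * partialDeriv i φ p
        + w p * partialDeriv j (partialDeriv i φ) p
        - (partialDeriv j φ p * partialDeriv i w p
          + φ p * partialDeriv j (partialDeriv i w) p) := by
      intro i j
      have h1 := (contDiff_partialDeriv hφ i).contDiffAt (x := p)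
      have h2 := contDiffAt_partialDeriv (hw' p hp) i
      rw [partialDeriv_fun_sub (hd ((hw' p hp).mul h1)) (hd (hφ.contDiffAt.mul h2)),
        partialDeriv_mul (hd (hw' p hp)) (hd h1), partialDeriv_mul (hd hφ.contDiffAt) (hd h2)]
    have hc0 : deriv (c 0) p.1 = (deriv f p.1 : ℝ) :=
      ((differentiableAt_profile hf hp).hasDerivAt.ofReal_comp).deriv
    rw [partialDeriv_mul (hcd' 0) (hd (hYs 0 p hp)),
      partialDeriv_mul (hcd' 1) (hd (hYs 1 p hp)),
      (partialDeriv_comp_fst (hcd 0)).1, (partialDeriv_comp_fst (hcd 1)).2, hYd, hYd, hc0]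
    have := hf0 p hp
    simp only [c, Y, grushinExpr, Matrix.cons_val_zero, Matrix.cons_val_one]
    push_cast
    field_simp
    ring
  rw [setIntegral_congr_fun halfPlane.isOpen.measurableSet key,
    setIntegral_eq_integral_of_forall_compl_eq_zero, integral_add (hint 0) (hint 1),
    integral_partialDeriv_eq_zero (hXs 0) (hXc 0), integral_partialDeriv_eq_zero (hXs 1) (hXc 1),
    add_zero]
  intro p hp
  have hp' : p ∉ tsupport φ := fun h => hp (φ.tsupport_subset h)
  have hz : ∀ i, partialDeriv i (fun q : ℝ × ℝ => c i q.1 * Y i q) p = 0 := by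
    intro i
    refine image_eq_zero_of_notMem_tsupport fun h => hp' ?_
    exact closure_minimal (fun q (hq : _ ≠ _) => by_contra fun hq' => hq (hY0 i q hq'))
      (isClosed_tsupport φ) (tsupport_partialDeriv_subset _ _ h)
  rw [hz 0, hz 1, add_zero]

/-! ### The adjoint of the Hamiltonian in terms of test functions -/

theorem negLaplacian_eq (hf : IsGrushinProfile f) (φ : 𝓓(halfPlane, ℂ)) :
    negLaplacian hf φ = -(memLp_grushinExpr hf φ).toLp (grushinExpr f φ) :=
  congrArg Neg.neg (MemLp.toLp_congr _ _ (laplaceBeltrami_ae_eq hf φ))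

theorem forall_domain_hamiltonian_iff (hf : IsGrushinProfile f)
    {P : GrushinL2 f → GrushinL2 f → Prop} :
    (∀ v : (hamiltonian hf).domain, P v (hamiltonian hf v)) ↔
      ∀ φ : 𝓓(halfPlane, ℂ), P (toL2 hf φ) (negLaplacian hf φ) := by
  constructor
  · intro h φ
    have := h ⟨toL2 hf φ, LinearMap.mem_range_self _ φ⟩
    rwa [hamiltonian_apply] at this
  · rintro h ⟨_, φ, rfl⟩
    have := h φ
    rwa [← hamiltonian_apply] at this

theorem integrable_conj_mul {μ : Measure (ℝ × ℝ)} {a b : ℝ × ℝ → ℂ} (ha : MemLp a 2 μ)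
    (hb : MemLp b 2 μ) : Integrable (fun p => starRingEnd ℂ (a p) * b p) μ :=
  ha.star.integrable_mul hb

/-- A test for membership in the graph of the adjoint of the Hamiltonian. -/
theorem inner_toLp_negLaplacian (hf : IsGrushinProfile f) {w : ℝ × ℝ → ℂ}
    (hw : ContDiffOn ℝ ∞ w halfPlane) (h1 : MemLp w 2 (grushinMeasure f))
    (h2 : MemLp (grushinExpr f w) 2 (grushinMeasure f)) (φ : 𝓓(halfPlane, ℂ)) :
    inner ℂ (-(h2.toLp _)) (toL2 hf φ) = inner ℂ (h1.toLp _) (negLaplacian hf φ) := by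
  have hc : ContDiffOn ℝ ∞ (fun q => starRingEnd ℂ (w q)) halfPlane :=
    Complex.conjCLE.contDiff.comp_contDiffOn hw
  have hg := integral_green hf hc φ
  rw [← integral_grushinMeasure hf] at hg
  simp only [grushinExpr_conj] at hg
  rw [integral_sub (integrable_conj_mul h1 (memLp_grushinExpr hf φ))
    (integrable_conj_mul h2 (memLp_testFunction hf φ)), sub_eq_zero] at hg
  have e1 : inner ℂ (h1.toLp _) ((memLp_grushinExpr hf φ).toLp (grushinExpr f φ))
      = ∫ p, starRingEnd ℂ (w p) * grushinExpr f φ p ∂grushinMeasure f := by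
    rw [inner_toLp]
    refine integral_congr_ae ?_
    filter_upwards [h1.coeFn_toLp] with p hp
    rw [hp]
  have e2 : inner ℂ (h2.toLp _) (toL2 hf φ)
      = ∫ p, starRingEnd ℂ (grushinExpr f w p) * φ p ∂grushinMeasure f := by
    rw [show toL2 hf φ = (memLp_testFunction hf φ).toLp φ from rfl, inner_toLp]
    refine integral_congr_ae ?_
    filter_upwards [h2.coeFn_toLp] with p hp
    rw [hp]
  rw [negLaplacian_eq, inner_neg_left, inner_neg_right, e1, e2, hg]

/-- Green's identity with a test function in the role of `w`. -/
theorem hamiltonian_isFormalAdjoint (hf : IsGrushinProfile f) :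
    (hamiltonian hf).IsFormalAdjoint (hamiltonian hf) := by
  rw [LinearPMap.IsFormalAdjoint]
  refine (forall_domain_hamiltonian_iff hf (P := fun a b => ∀ y : (hamiltonian hf).domain,
    inner ℂ b (y : GrushinL2 f) = inner ℂ a (hamiltonian hf y))).2 fun φ => ?_
  refine (forall_domain_hamiltonian_iff hf (P := fun a b =>
    inner ℂ (negLaplacian hf φ) a = inner ℂ (toL2 hf φ) b)).2 fun ψ => ?_
  have hφ : ContDiff ℝ ∞ φ := φ.contDiff
  rw [negLaplacian_eq]
  exact inner_toLp_negLaplacian hf hφ.contDiffOn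
    (memLp_testFunction hf φ) (memLp_grushinExpr hf φ) ψ

/-- A real-valued smooth function with compact support in the half-plane as a test function. -/
def testFunctionOfReal (g : ℝ × ℝ → ℝ) (hg : ContDiff ℝ ∞ g) (hc : HasCompactSupport g)
    (hs : tsupport g ⊆ halfPlane) : 𝓓(halfPlane, ℂ) where
  toFun p := (g p : ℂ)
  contDiff' := Complex.ofRealCLM.contDiff.comp hg
  hasCompactSupport' := hc.comp_left Complex.ofReal_zero
  tsupport_subset' := (closure_mono (Function.support_comp_subset Complex.ofReal_zero g)).trans hs

/-- A vector orthogonal to the domain is locally integrable on the half-plane and integrates to zero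
against every real test function, hence vanishes by the fundamental lemma of the calculus of
variations. -/
theorem dense_domain_hamiltonian (hf : IsGrushinProfile f) :
    Dense ((hamiltonian hf).domain : Set (GrushinL2 f)) := by
  rw [Submodule.dense_iff_topologicalClosure_eq_top,
    Submodule.topologicalClosure_eq_top_iff, eq_bot_iff]
  intro x hx
  rw [Submodule.mem_orthogonal'] at hx
  have hloc : LocallyIntegrableOn (fun p => starRingEnd ℂ (x p)) halfPlane (grushinMeasure f) := by
    rw [locallyIntegrableOn_iff halfPlane.isOpen.isLocallyClosed]
    intro K hKM hK
    have : IsFiniteMeasure ((grushinMeasure f).restrict K) :=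
      ⟨by simpa using grushinMeasure_compact_lt_top hf hK hKM⟩
    exact ((Lp.memLp x).star.restrict K).integrable (by norm_num)
  have h := halfPlane.isOpen.ae_eq_zero_of_integral_contDiff_smul_eq_zero hloc (by
    intro g hg hc hs
    have := hx (toL2 hf (testFunctionOfReal g hg hc hs)) ⟨_, rfl⟩
    rw [show toL2 hf (testFunctionOfReal g hg hc hs) = (memLp_testFunction hf _).toLp _ from rfl,
      inner_toLp] at this
    rw [← this]
    refine integral_congr_ae (Filter.Eventually.of_forall fun p => ?_)
    simp only [Complex.real_smul]
    exact mul_comm _ _)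
  rw [Submodule.mem_bot, Lp.eq_zero_iff_ae_eq_zero]
  filter_upwards [h, ae_mem_halfPlane f] with p hp hpM
  simpa using hp hpM

/-- No condition at `x = 0` appears, since the test functions vanish near the boundary. This is the
source of elements of the adjoint domain in (ii) and (iii). -/
theorem mem_graph_adjoint_hamiltonian (hf : IsGrushinProfile f) {w : ℝ × ℝ → ℂ}
    (hw : ContDiffOn ℝ ∞ w halfPlane) (h1 : MemLp w 2 (grushinMeasure f))
    (h2 : MemLp (grushinExpr f w) 2 (grushinMeasure f)) :
    (h1.toLp w, -(h2.toLp (grushinExpr f w))) ∈ (hamiltonian hf)†.graph := by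
  rw [mem_adjoint_graph_iff (dense_domain_hamiltonian hf)]
  exact (forall_domain_hamiltonian_iff hf (P := fun a b =>
    inner ℂ (-(h2.toLp (grushinExpr f w))) a = inner ℂ (h1.toLp w) b)).2
      (inner_toLp_negLaplacian hf hw h1 h2)

/-- The eigenvalue equation in weak form. The inner product is conjugate-linear in its first slot,
whence `conj x` and `conj z`. -/
theorem mem_deficiencySpace_hamiltonian_iff (hf : IsGrushinProfile f) {z : ℂ} {x : GrushinL2 f} :
    x ∈ deficiencySpace (hamiltonian hf) z ↔ ∀ φ : 𝓓(halfPlane, ℂ),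
      ∫ p, starRingEnd ℂ (x p) * (grushinExpr f φ p + starRingEnd ℂ z * φ p)
        ∂grushinMeasure f = 0 := by
  rw [mem_deficiencySpace_iff (dense_domain_hamiltonian hf), forall_domain_hamiltonian_iff hf
    (P := fun a b => inner ℂ (z • x) a = inner ℂ x b)]
  refine forall_congr' fun φ => ?_
  rw [negLaplacian_eq, inner_neg_right, inner_smul_left, inner_toLp,
    show toL2 hf φ = (memLp_testFunction hf φ).toLp φ from rfl, inner_toLp,
    eq_neg_iff_add_eq_zero, ← integral_const_mul, ← integral_add
      ((integrable_conj_mul (Lp.memLp x) (memLp_testFunction hf φ)).const_mul _)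
      (integrable_conj_mul (Lp.memLp x) (memLp_grushinExpr hf φ))]
  refine Eq.congr_left (integral_congr_ae (Filter.Eventually.of_forall fun p => ?_))
  simp only
  ring

/-- The complex conjugate of a test function. -/
def conjTestFunction (φ : 𝓓(halfPlane, ℂ)) : 𝓓(halfPlane, ℂ) where
  toFun p := starRingEnd ℂ (φ p)
  contDiff' := Complex.conjCLE.contDiff.comp φ.contDiff
  hasCompactSupport' := φ.hasCompactSupport.comp_left (map_zero (starRingEnd ℂ))
  tsupport_subset' :=
    (closure_mono (Function.support_comp_subset (map_zero (starRingEnd ℂ)) φ)).trans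
      φ.tsupport_subset

/-- The Laplacian has real coefficients, so conjugating the weak equation and the test function
gives the equation for `conj z`. -/
theorem star_mem_deficiencySpace (hf : IsGrushinProfile f) {z : ℂ} {x : GrushinL2 f}
    (hx : x ∈ deficiencySpace (hamiltonian hf) z) :
    star x ∈ deficiencySpace (hamiltonian hf) (starRingEnd ℂ z) := by
  rw [mem_deficiencySpace_hamiltonian_iff] at hx ⊢
  intro φ
  have h := congrArg (starRingEnd ℂ) (hx (conjTestFunction φ))
  rw [← integral_conj, map_zero] at h
  rw [← h]
  refine integral_congr_ae ?_
  filter_upwards [Lp.coeFn_star x] with p hp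
  have e : ⇑(conjTestFunction φ) = fun q => starRingEnd ℂ (φ q) := rfl
  rw [hp, e, grushinExpr_conj]
  simp

/-- Conjugation is a conjugate-linear surjection between the two spaces. This turns "not both
finite-dimensional" into "both infinite-dimensional". -/
theorem finite_deficiencySpace_conj (hf : IsGrushinProfile f) {z : ℂ}
    (h : Module.Finite ℂ (deficiencySpace (hamiltonian hf) z)) :
    Module.Finite ℂ (deficiencySpace (hamiltonian hf) (starRingEnd ℂ z)) := by
  let J : deficiencySpace (hamiltonian hf) z →ₛₗ[starRingEnd ℂ]
      deficiencySpace (hamiltonian hf) (starRingEnd ℂ z) :=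
    { toFun := fun x => ⟨star x.1, star_mem_deficiencySpace hf x.2⟩
      map_add' := fun x y => Subtype.ext (by
        refine Lp.ext ?_
        filter_upwards [Lp.coeFn_star (x + y).1, Lp.coeFn_star x.1, Lp.coeFn_star y.1,
          Lp.coeFn_add x.1 y.1, Lp.coeFn_add (star x.1) (star y.1)] with p h1 h2 h3 h4 h5
        rw [Submodule.coe_add] at h1 ⊢
        rw [h1, Pi.star_apply, h4, Submodule.coe_add, h5, Pi.add_apply, Pi.add_apply, h2, h3, star_add]
        rfl)
      map_smul' := fun c x => Subtype.ext (by
        refine Lp.ext ?_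
        filter_upwards [Lp.coeFn_star (c • x).1, Lp.coeFn_star x.1,
          Lp.coeFn_smul c x.1, Lp.coeFn_smul (starRingEnd ℂ c) (star x.1)] with p h1 h2 h3 h4
        rw [Submodule.coe_smul] at h1 ⊢
        rw [h1, Pi.star_apply, h3, Submodule.coe_smul, h4, Pi.smul_apply, Pi.smul_apply, h2, star_smul]
        rfl) }
  refine Module.Finite.of_surjective J fun y => ?_
  have hy := star_mem_deficiencySpace hf y.2
  rw [Complex.conj_conj] at hy
  exact ⟨⟨star y.1, hy⟩, Subtype.ext (star_star y.1)⟩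

end Basics

/-! ### Functions of the form `a(x) b(y)` -/

section Tensor

variable {f : ℝ → ℝ}

/-- The function `(x, y) ↦ a(x) b(y)`. -/
def tensor (a b : ℝ → ℝ) (p : ℝ × ℝ) : ℂ := (a p.1 : ℂ) * (b p.2 : ℂ)

/-- The radial part `a'' + (f'/f) a'` of the Laplace–Beltrami operator. -/
def radialExpr (f a : ℝ → ℝ) (x : ℝ) : ℝ :=
  deriv (deriv a) x + deriv f x / f x * deriv a x

theorem partialDeriv_tensor {a b : ℝ → ℝ} {p : ℝ × ℝ} (ha : DifferentiableAt ℝ a p.1)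
    (hb : DifferentiableAt ℝ b p.2) :
    partialDeriv 0 (tensor a b) p = tensor (deriv a) b p ∧
      partialDeriv 1 (tensor a b) p = tensor a (deriv b) p := by
  have ha' := ha.hasDerivAt.ofReal_comp
  have hb' := hb.hasDerivAt.ofReal_comp
  have h1 := partialDeriv_comp_fst (p := p) (c := fun x => (a x : ℂ)) ha'.differentiableAt
  have h2 := partialDeriv_comp_snd (p := p) (c := fun x => (b x : ℂ)) hb'.differentiableAt
  have d1 : DifferentiableAt ℝ (fun q : ℝ × ℝ => (a q.1 : ℂ)) p :=
    ha'.differentiableAt.comp p differentiableAt_fst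
  have d2 : DifferentiableAt ℝ (fun q : ℝ × ℝ => (b q.2 : ℂ)) p :=
    hb'.differentiableAt.comp p differentiableAt_snd
  have e : tensor a b = fun q => (a q.1 : ℂ) * (b q.2 : ℂ) := rfl
  constructor
  · rw [e, partialDeriv_mul d1 d2, h1.1, h2.1, ha'.deriv]
    simp [tensor]
  · rw [e, partialDeriv_mul d1 d2, h1.2, h2.2, hb'.deriv]
    simp [tensor]

theorem contDiffOn_tensor {a b : ℝ → ℝ} (ha : ContDiffOn ℝ ∞ a (Set.Ioi 0)) (hb : ContDiff ℝ ∞ b) :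
    ContDiffOn ℝ ∞ (tensor a b) halfPlane := by
  have h1 : ContDiffOn ℝ ∞ (fun p : ℝ × ℝ => (a p.1 : ℂ)) halfPlane :=
    Complex.ofRealCLM.contDiff.comp_contDiffOn
      (ha.comp contDiff_fst.contDiffOn fun p hp => hp)
  have h2 : ContDiff ℝ ∞ (fun p : ℝ × ℝ => (b p.2 : ℂ)) :=
    Complex.ofRealCLM.contDiff.comp (hb.comp contDiff_snd)
  exact h1.mul h2.contDiffOn

theorem grushinExpr_tensor {a b : ℝ → ℝ} (ha : ContDiffOn ℝ ∞ a (Set.Ioi 0))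
    (hb : ContDiff ℝ ∞ b) {p : ℝ × ℝ} (hp : p ∈ halfPlane) :
    grushinExpr f (tensor a b) p = ((radialExpr f a p.1 * b p.2
      + 1 / f p.1 ^ 2 * a p.1 * deriv (deriv b) p.2 : ℝ) : ℂ) := by
  have hda : ∀ q ∈ halfPlane, DifferentiableAt ℝ a q.1 := fun q hq =>
    (ha.contDiffAt (Ioi_mem_nhds hq)).differentiableAt (by simp)
  have ha' : ContDiffOn ℝ ∞ (deriv a) (Set.Ioi 0) :=
    ((contDiffOn_infty_iff_deriv_of_isOpen isOpen_Ioi).1 ha).2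
  have hb' : ContDiff ℝ ∞ (deriv b) := (contDiff_infty_iff_deriv.1 hb).2
  have hdb := hb.differentiable (by simp)
  have hnear : ∀ᶠ q in 𝓝 p, q ∈ halfPlane := halfPlane.isOpen.mem_nhds hp
  have e0 : partialDeriv 0 (tensor a b) =ᶠ[𝓝 p] tensor (deriv a) b := by
    filter_upwards [hnear] with q hq using (partialDeriv_tensor (hda q hq) (hdb _)).1
  have e1 : partialDeriv 1 (tensor a b) =ᶠ[𝓝 p] tensor a (deriv b) := by
    filter_upwards [hnear] with q hq using (partialDeriv_tensor (hda q hq) (hdb _)).2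
  rw [grushinExpr, partialDeriv_congr e0, partialDeriv_congr e1, e0.eq_of_nhds,
    (partialDeriv_tensor ((ha'.contDiffAt (Ioi_mem_nhds hp)).differentiableAt (by simp))
      (hdb _)).1,
    (partialDeriv_tensor (hda p hp) (hb'.differentiable (by simp) _)).2]
  simp only [tensor, radialExpr]
  push_cast
  ring

theorem continuousOn_grushinExpr (hf : IsGrushinProfile f) {w : ℝ × ℝ → ℂ}
    (hw : ContDiffOn ℝ ∞ w halfPlane) : ContinuousOn (grushinExpr f w) halfPlane := by
  intro p hp
  have h := hw.contDiffAt (halfPlane.isOpen.mem_nhds hp)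
  have h0 := contDiffAt_partialDeriv h 0
  have h00 := contDiffAt_partialDeriv h0 0
  have h11 := contDiffAt_partialDeriv (contDiffAt_partialDeriv h 1) 1
  have hmem : ({0}ᶜ : Set ℝ) ∈ 𝓝 p.1 := isOpen_compl_singleton.mem_nhds (ne_of_gt hp)
  have hne : f p.1 ≠ 0 := (hf.pos _ (ne_of_gt hp)).ne'
  have hcf : ContinuousAt (fun q : ℝ × ℝ => f q.1) p :=
    ContinuousAt.comp (f := Prod.fst) (hf.smooth.contDiffAt hmem).continuousAt continuousAt_fst
  have hcd : ContinuousAt (fun q : ℝ × ℝ => deriv f q.1) p := by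
    refine ContinuousAt.comp (f := Prod.fst) (g := deriv f) ?_ continuousAt_fst
    exact (hf.smooth.continuousOn_deriv_of_isOpen isOpen_compl_singleton
      (by simp)).continuousAt hmem
  refine ContinuousAt.continuousWithinAt ?_
  refine (h00.continuousAt.add (ContinuousAt.mul ?_ h11.continuousAt)).add
    (ContinuousAt.mul ?_ h0.continuousAt)
  · exact Complex.continuous_ofReal.continuousAt.comp
      (continuousAt_const.div (hcf.pow 2) (pow_ne_zero 2 hne))
  · exact Complex.continuous_ofReal.continuousAt.comp (hcd.div hcf hne)

end Tensor

/-! ### Integrability of the profile at the singularity -/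

section Integrability

variable {f : ℝ → ℝ}

theorem hasDerivAt_profile (hf : IsGrushinProfile f) {x : ℝ} (hx : 0 < x) :
    HasDerivAt f (deriv f x) x := (differentiableAt_profile hf hx).hasDerivAt

theorem contDiffOn_profile (hf : IsGrushinProfile f) : ContDiffOn ℝ ∞ f (Set.Ioi 0) :=
  hf.smooth.mono fun _ hx => ne_of_gt hx

theorem contDiffOn_deriv_profile (hf : IsGrushinProfile f) :
    ContDiffOn ℝ ∞ (deriv f) (Set.Ioi 0) :=
  ((contDiffOn_infty_iff_deriv_of_isOpen isOpen_Ioi).1 (contDiffOn_profile hf)).2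

theorem hasDerivAt_deriv_profile (hf : IsGrushinProfile f) {x : ℝ} (hx : 0 < x) :
    HasDerivAt (deriv f) (deriv (deriv f) x) x :=
  (((contDiffOn_deriv_profile hf).contDiffAt (Ioi_mem_nhds hx)).differentiableAt
    (by simp)).hasDerivAt

/-- A positive solution of `u'' ≤ α(α-1) x⁻² u` is `O(x ^ α)` at `0` if `α ≤ 0`. -/
theorem exists_le_rpow_of_deriv2_le {u u' u'' : ℝ → ℝ} {α : ℝ} (hα : α ≤ 0)
    (hu : ∀ x, 0 < x → HasDerivAt u (u' x) x)
    (hu' : ∀ x, 0 < x → HasDerivAt u' (u'' x) x)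
    (h : ∀ x, 0 < x → u'' x ≤ α * (α - 1) / x ^ 2 * u x) :
    ∃ C, ∀ x ∈ Set.Ioc (0 : ℝ) 1, u x ≤ C * x ^ α := by
  have hpow : ∀ (β x : ℝ), 0 < x → HasDerivAt (fun t : ℝ => t ^ β) (β * x ^ (β - 1)) x :=
    fun β x hx => Real.hasDerivAt_rpow_const (Or.inl hx.ne')
  -- `W` is the Wronskian of `u` with the exact solution `x ^ α`; the differential inequality says
  -- that it is nonincreasing.
  let W : ℝ → ℝ := fun x => u' x * x ^ α - u x * (α * x ^ (α - 1))
  have hW : ∀ x, 0 < x → HasDerivAt W (u'' x * x ^ α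
      - u x * (α * ((α - 1) * x ^ (α - 1 - 1)))) x := by
    intro x hx
    have := ((hu' x hx).mul (hpow α x hx)).sub ((hu x hx).mul ((hpow (α - 1) x hx).const_mul α))
    refine this.congr_deriv ?_
    ring
  have hWanti : AntitoneOn W (Set.Ioi 0) := by
    refine antitoneOn_of_deriv_nonpos (convex_Ioi 0)
      (fun x hx => (hW x hx).continuousAt.continuousWithinAt)
      (fun x hx => (hW x (interior_subset hx)).differentiableAt.differentiableWithinAt) ?_
    intro x hx
    have hx : 0 < x := interior_subset hx
    rw [(hW x hx).deriv]
    have e : x ^ (α - 1 - 1) = x ^ α / x ^ 2 := by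
      rw [show α - 1 - 1 = α - (2 : ℕ) by push_cast; ring, Real.rpow_sub_natCast hx.ne']
    have h1 := mul_le_mul_of_nonneg_right (h x hx) (Real.rpow_nonneg hx.le α)
    rw [e]
    have : u x * (α * ((α - 1) * (x ^ α / x ^ 2))) = α * (α - 1) / x ^ 2 * u x * x ^ α := by ring
    linarith
  -- The derivative of `u x ^ (-α)` is `W x ^ (-2α)`. On `(0, 1]` one has `W ≥ W 1` and, as `α ≤ 0`,
  -- `x ^ (-2α) ≤ 1`; adding `|W 1| x` therefore makes the function monotone.
  have hr : ∀ x, 0 < x → HasDerivAt (fun t => u t * t ^ (-α) + |W 1| * t)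
      (W x * x ^ (-(2 * α)) + |W 1|) x := by
    intro x hx
    have := ((hu x hx).mul (hpow (-α) x hx)).add ((hasDerivAt_id x).const_mul |W 1|)
    refine this.congr_deriv ?_
    have e1 : x ^ α * x ^ (-(2 * α)) = x ^ (-α) := by
      rw [← Real.rpow_add hx]; congr 1; ring
    have e2 : x ^ (α - 1) * x ^ (-(2 * α)) = x ^ (-α - 1) := by
      rw [← Real.rpow_add hx]; congr 1; ring
    simp only [W, mul_one, sub_mul]
    rw [mul_assoc, e1, mul_assoc, mul_assoc, e2]
    ring
  have hmono : MonotoneOn (fun t => u t * t ^ (-α) + |W 1| * t) (Set.Ioc 0 1) := by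
    refine monotoneOn_of_deriv_nonneg (convex_Ioc 0 1)
      (fun x hx => (hr x hx.1).continuousAt.continuousWithinAt)
      (fun x hx => (hr x (interior_subset hx).1).differentiableAt.differentiableWithinAt) ?_
    intro x hx
    have hx : x ∈ Set.Ioc (0 : ℝ) 1 := interior_subset hx
    rw [(hr x hx.1).deriv]
    have h1 : W 1 ≤ W x := hWanti hx.1 (Set.mem_Ioi.2 one_pos) hx.2
    have h2 : x ^ (-(2 * α)) ≤ 1 := Real.rpow_le_one hx.1.le hx.2 (by linarith)
    have h3 : 0 ≤ x ^ (-(2 * α)) := Real.rpow_nonneg hx.1.le _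
    have h4 := neg_abs_le (W 1)
    have h5 := abs_nonneg (W 1)
    nlinarith
  refine ⟨u 1 + |W 1|, fun x hx => ?_⟩
  have h1 := hmono hx (Set.right_mem_Ioc.2 one_pos) hx.2
  simp only [Real.one_rpow, mul_one] at h1
  have h2 : u x * x ^ (-α) ≤ u 1 + |W 1| := by
    have := mul_nonneg (abs_nonneg (W 1)) hx.1.le
    linarith
  have h3 := mul_le_mul_of_nonneg_right h2 (Real.rpow_nonneg hx.1.le α)
  rwa [mul_assoc, ← Real.rpow_add hx.1, neg_add_cancel, Real.rpow_zero, mul_one] at h3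

theorem hasDerivAt_sqrt_profile (hf : IsGrushinProfile f) {x : ℝ} (hx : 0 < x) :
    HasDerivAt (fun t => √(f t)) (deriv f x / (2 * √(f x))) x :=
  (hasDerivAt_profile hf hx).sqrt (hf.pos x hx.ne').ne'

/-- The potential `(2 f f'' - f'²) / (4 f²)` of the transformed operator. -/
def potential (f : ℝ → ℝ) (x : ℝ) : ℝ :=
  (2 * f x * deriv (deriv f) x - deriv f x ^ 2) / (4 * f x ^ 2)

/-- `√f` solves `ψ'' = V ψ`. This both produces the potential under conjugation by `√f` and allows
`√f` to be compared with powers of `x`. -/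
theorem hasDerivAt_deriv_sqrt_profile (hf : IsGrushinProfile f) {x : ℝ} (hx : 0 < x) :
    HasDerivAt (fun t => deriv f t / (2 * √(f t))) (potential f x * √(f x)) x := by
  have hp := hf.pos x hx.ne'
  have hs : √(f x) ≠ 0 := (Real.sqrt_pos.2 hp).ne'
  have := (hasDerivAt_deriv_profile hf hx).div ((hasDerivAt_sqrt_profile hf hx).const_mul 2)
    (by positivity)
  refine this.congr_deriv ?_
  have e : f x = √(f x) ^ 2 := (Real.sq_sqrt hp.le).symm
  rw [potential]
  rw [e, Real.sqrt_sq (Real.sqrt_nonneg _)]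
  field_simp
  ring

/-- Comparison with the exponent `α = -1/2 + δ`, slightly above the critical `-1/2`, bounds `f` by a
multiple of `x ^ (-1 + 2δ)`. -/
theorem integrableOn_profile (hf : IsGrushinProfile f) {ε : ℝ} (hε : 0 < ε)
    (h : ∀ x, x ≠ 0 → 2 * f x * deriv (deriv f) x - deriv f x ^ 2 ≤ (3 - ε) / x ^ 2 * f x ^ 2) :
    IntegrableOn f (Set.Ioc 0 1) := by
  -- `α (α - 1) = 3/4 - 2δ + δ²` is at least `(3 - ε)/4` once `δ ≤ ε/8`; the bound `δ ≤ 1/2` keeps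
  -- `α ≤ 0`.
  set δ := min (ε / 8) (1 / 2) with hδ
  have hδ0 : 0 < δ := by positivity
  have hδ1 : δ ≤ ε / 8 := min_le_left _ _
  have hδ2 : δ ≤ 1 / 2 := min_le_right _ _
  obtain ⟨C, hC⟩ := exists_le_rpow_of_deriv2_le (α := -1 / 2 + δ) (by linarith)
    (fun x hx => hasDerivAt_sqrt_profile hf hx)
    (fun x hx => hasDerivAt_deriv_sqrt_profile hf hx) (by
      intro x hx
      refine mul_le_mul_of_nonneg_right ?_ (Real.sqrt_nonneg _)
      have hp := hf.pos x hx.ne'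
      rw [potential, div_le_iff₀ (by positivity)]
      refine (h x hx.ne').trans ?_
      have : (3 - ε) / 4 ≤ (-1 / 2 + δ) * (-1 / 2 + δ - 1) := by nlinarith
      calc (3 - ε) / x ^ 2 * f x ^ 2 = (3 - ε) / 4 * (4 * f x ^ 2 / x ^ 2) := by ring
        _ ≤ (-1 / 2 + δ) * (-1 / 2 + δ - 1) * (4 * f x ^ 2 / x ^ 2) :=
          mul_le_mul_of_nonneg_right this (by positivity)
        _ = _ := by ring)
  have hint : IntegrableOn (fun x : ℝ => C ^ 2 * x ^ (2 * (-1 / 2 + δ))) (Set.Ioc 0 1) := by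
    rw [← intervalIntegrable_iff_integrableOn_Ioc_of_le zero_le_one]
    exact (intervalIntegral.intervalIntegrable_rpow' (by linarith)).const_mul _
  refine hint.mono' hf.measurable.aestronglyMeasurable
    (ae_restrict_of_forall_mem measurableSet_Ioc fun x hx => ?_)
  have hp := hf.pos x hx.1.ne'
  rw [Real.norm_of_nonneg hp.le]
  calc f x = √(f x) ^ 2 := (Real.sq_sqrt hp.le).symm
    _ ≤ (C * x ^ (-1 / 2 + δ)) ^ 2 := pow_le_pow_left₀ (Real.sqrt_nonneg _) (hC x hx) 2
    _ = _ := by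
      rw [mul_pow]
      congr 1
      rw [← Real.rpow_natCast, ← Real.rpow_mul hx.1.le]
      congr 1
      push_cast
      ring

/-- The hypothesis covers a neighbourhood of `0`, compactness the rest. The result bounds `1/f` and
`1/f²` on `(0, 1]`. -/
theorem exists_profile_lower_bound (hf : IsGrushinProfile f) :
    ∃ κ > 0, ∀ x ∈ Set.Ioc (0 : ℝ) 1, κ ≤ f x := by
  obtain ⟨κ, hκ, h⟩ := hf.bounded_below
  rw [eventually_nhdsWithin_iff, Metric.eventually_nhds_iff] at h
  obtain ⟨r, hr, h⟩ := h
  have hc : ContinuousOn f (Set.Icc (min (r / 2) 1) 1) :=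
    (contDiffOn_profile hf).continuousOn.mono fun x hx => lt_of_lt_of_le (by positivity) hx.1
  obtain ⟨x₀, hx₀, hmin⟩ := isCompact_Icc.exists_isMinOn
    (Set.nonempty_Icc.2 (min_le_right (r / 2) 1)) hc
  have hx₀0 : 0 < x₀ := lt_of_lt_of_le (by positivity) hx₀.1
  refine ⟨min κ (f x₀), lt_min hκ (hf.pos _ hx₀0.ne'), fun x hx => ?_⟩
  by_cases hxr : x < r
  · refine (min_le_left _ _).trans (h ?_ hx.1.ne')
    rw [Real.dist_eq, sub_zero, abs_of_pos hx.1]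
    exact hxr
  · exact (min_le_right _ _).trans (hmin ⟨(min_le_left _ _).trans (by linarith), hx.2⟩)

theorem grushinMeasure_prod_lt_top (hf : IsGrushinProfile f) (hi : IntegrableOn f (Set.Ioc 0 1))
    (R : ℝ) : grushinMeasure f (Set.Ioc 0 1 ×ˢ Set.Icc (-R) R) < ⊤ := by
  have hm : MeasurableSet (Set.Ioc (0 : ℝ) 1 ×ˢ Set.Icc (-R) R) :=
    measurableSet_Ioc.prod measurableSet_Icc
  rw [grushinMeasure, volMeasure, withDensity_apply _ hm, Measure.restrict_restrict hm,
    Set.inter_eq_left.2 (fun p hp => hp.1.1), Measure.volume_eq_prod,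
    ← Measure.prod_restrict]
  have e : ∀ p : ℝ × ℝ, ENNReal.ofReal (volDensity (metric f) p)
      = ENNReal.ofReal |f p.1| * 1 := fun p => by rw [volDensity_metric, mul_one]
  simp_rw [e]
  rw [lintegral_prod_mul (f := fun x => ENNReal.ofReal |f x|) (g := fun _ => 1)
    (continuous_abs.measurable.comp hf.measurable).ennreal_ofReal.aemeasurable aemeasurable_const]
  refine ENNReal.mul_lt_top ?_ (by simp)
  have := hi.hasFiniteIntegral
  simpa [HasFiniteIntegral, Real.enorm_eq_ofReal_abs] using this

/-- The box has finite volume although it touches the singular line, so boundedness there is enough.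
-/
theorem memLp_of_bounded (hf : IsGrushinProfile f) (hi : IntegrableOn f (Set.Ioc 0 1))
    {h : ℝ × ℝ → ℂ} (hc : ContinuousOn h halfPlane) (R C : ℝ)
    (h0 : ∀ p ∈ halfPlane, p ∉ Set.Ioc (0 : ℝ) 1 ×ˢ Set.Icc (-R) R → h p = 0)
    (hb : ∀ p ∈ Set.Ioc (0 : ℝ) 1 ×ˢ Set.Icc (-R) R, ‖h p‖ ≤ C) :
    MemLp h 2 (grushinMeasure f) := by
  have hm : MeasurableSet (Set.Ioc (0 : ℝ) 1 ×ˢ Set.Icc (-R) R) :=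
    measurableSet_Ioc.prod measurableSet_Icc
  have hae : AEStronglyMeasurable h (grushinMeasure f) :=
    (hc.aestronglyMeasurable halfPlane.isOpen.measurableSet).mono_ac
      (withDensity_absolutelyContinuous _ _)
  have hind : (Set.Ioc (0 : ℝ) 1 ×ˢ Set.Icc (-R) R).indicator h =ᵐ[grushinMeasure f] h := by
    filter_upwards [ae_mem_halfPlane f] with p hp
    by_cases hp' : p ∈ Set.Ioc (0 : ℝ) 1 ×ˢ Set.Icc (-R) R
    · rw [Set.indicator_of_mem hp']
    · rw [Set.indicator_of_notMem hp', h0 p hp hp']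
  rw [← memLp_congr_ae hind, memLp_indicator_iff_restrict hm]
  have : IsFiniteMeasure ((grushinMeasure f).restrict (Set.Ioc 0 1 ×ˢ Set.Icc (-R) R)) :=
    ⟨by simpa using grushinMeasure_prod_lt_top hf hi R⟩
  exact MemLp.of_bound hae.restrict C (ae_restrict_of_forall_mem hm hb)

end Integrability

/-! ### Infinite deficiency indices -/

section Deficiency

variable {f : ℝ → ℝ}

/-- A smooth cutoff function, equal to `1` on `(-∞, 1/2]` and to `0` on `[1, ∞)`. -/
def cutoff (x : ℝ) : ℝ := Real.smoothTransition (2 - 2 * x)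

theorem contDiff_cutoff : ContDiff ℝ ∞ cutoff :=
  Real.smoothTransition.contDiff.comp (by fun_prop)

theorem cutoff_of_le {x : ℝ} (hx : x ≤ 1 / 2) : cutoff x = 1 :=
  Real.smoothTransition.one_of_one_le (by linarith)

theorem cutoff_of_ge {x : ℝ} (hx : 1 ≤ x) : cutoff x = 0 :=
  Real.smoothTransition.zero_of_nonpos (by linarith)

theorem hasDerivAt_cutoff (x : ℝ) : HasDerivAt cutoff (deriv cutoff x) x :=
  (contDiff_cutoff.differentiable (by simp) x).hasDerivAt

theorem contDiff_deriv_cutoff : ContDiff ℝ ∞ (deriv cutoff) :=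
  (contDiff_infty_iff_deriv.1 contDiff_cutoff).2

theorem deriv_cutoff_of_lt {x : ℝ} (hx : x < 1 / 2) : deriv cutoff x = 0 := by
  have : cutoff =ᶠ[𝓝 x] fun _ => 1 := by
    filter_upwards [Iio_mem_nhds hx] with y hy using cutoff_of_le (le_of_lt hy)
  rw [this.deriv_eq, deriv_const]

theorem deriv_cutoff_of_gt {x : ℝ} (hx : 1 < x) : deriv cutoff x = 0 := by
  have : cutoff =ᶠ[𝓝 x] fun _ => 0 := by
    filter_upwards [Ioi_mem_nhds hx] with y hy using cutoff_of_ge (le_of_lt hy)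
  rw [this.deriv_eq, deriv_const]

/-- The second radial solution `∫ₓ¹ dt / f(t)` of the Laplace equation. -/
def harmonicRadial (f : ℝ → ℝ) (x : ℝ) : ℝ := -∫ t in (1 : ℝ)..x, (f t)⁻¹

theorem contDiffOn_inv_profile (hf : IsGrushinProfile f) :
    ContDiffOn ℝ ∞ (fun t => (f t)⁻¹) (Set.Ioi 0) :=
  (contDiffOn_profile hf).inv fun x hx => (hf.pos x (ne_of_gt hx)).ne'

theorem hasDerivAt_harmonicRadial (hf : IsGrushinProfile f) {x : ℝ} (hx : 0 < x) :
    HasDerivAt (harmonicRadial f) (-(f x)⁻¹) x := by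
  have hc := (contDiffOn_inv_profile hf).continuousOn
  refine (intervalIntegral.integral_hasDerivAt_right ?_ ?_
    (hc.continuousAt (Ioi_mem_nhds hx))).neg
  · refine (hc.mono fun t ht => ?_).intervalIntegrable
    exact lt_of_lt_of_le (lt_min one_pos hx) ht.1
  · exact hc.stronglyMeasurableAtFilter isOpen_Ioi x hx

theorem contDiffOn_harmonicRadial (hf : IsGrushinProfile f) :
    ContDiffOn ℝ ∞ (harmonicRadial f) (Set.Ioi 0) := by
  rw [contDiffOn_infty_iff_deriv_of_isOpen isOpen_Ioi]
  refine ⟨fun x hx => (hasDerivAt_harmonicRadial hf hx).differentiableAt.differentiableWithinAt, ?_⟩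
  exact (contDiffOn_inv_profile hf).neg.congr fun x hx => (hasDerivAt_harmonicRadial hf hx).deriv

theorem exists_abs_harmonicRadial_le (hf : IsGrushinProfile f) :
    ∃ C, ∀ x ∈ Set.Ioc (0 : ℝ) 1, |harmonicRadial f x| ≤ C := by
  obtain ⟨κ, hκ, h⟩ := exists_profile_lower_bound hf
  refine ⟨κ⁻¹, fun x hx => ?_⟩
  have := intervalIntegral.norm_integral_le_of_norm_le_const (a := 1) (b := x)
    (f := fun t => (f t)⁻¹) (C := κ⁻¹) (by
      intro t ht
      rw [Set.uIoc_of_ge hx.2] at ht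
      have htm : t ∈ Set.Ioc (0 : ℝ) 1 := ⟨hx.1.trans ht.1, ht.2⟩
      rw [norm_inv, Real.norm_of_nonneg (hf.pos t htm.1.ne').le]
      exact inv_anti₀ hκ (h t htm))
  rw [harmonicRadial, abs_neg]
  refine this.trans ?_
  have h1 : |x - 1| ≤ 1 := by rw [abs_le]; constructor <;> linarith [hx.1, hx.2]
  exact mul_le_of_le_one_right (inv_pos.2 hκ).le h1

/-- `h' = -1/f` gives `(f h')' = 0`, so `h` is annihilated by the radial operator and only terms
containing derivatives of the cutoff remain. -/
theorem radialExpr_mul_cutoff (hf : IsGrushinProfile f) {x : ℝ} (hx : 0 < x) :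
    radialExpr f (fun t => cutoff t * harmonicRadial f t) x
      = radialExpr f cutoff x * harmonicRadial f x - 2 * deriv cutoff x / f x := by
  have hp := (hf.pos x hx.ne').ne'
  have h1 : ∀ t, 0 < t → HasDerivAt (fun t => cutoff t * harmonicRadial f t)
      (deriv cutoff t * harmonicRadial f t + cutoff t * -(f t)⁻¹) t := fun t ht =>
    (hasDerivAt_cutoff t).mul (hasDerivAt_harmonicRadial hf ht)
  have h2 : deriv (fun t => cutoff t * harmonicRadial f t) =ᶠ[𝓝 x]
      fun t => deriv cutoff t * harmonicRadial f t + cutoff t * -(f t)⁻¹ := by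
    filter_upwards [Ioi_mem_nhds hx] with t ht using (h1 t ht).deriv
  have h3 : HasDerivAt (deriv cutoff) (deriv (deriv cutoff) x) x :=
    (contDiff_deriv_cutoff.differentiable (by simp) x).hasDerivAt
  have h4 : HasDerivAt (fun t => deriv cutoff t * harmonicRadial f t + cutoff t * -(f t)⁻¹) _ x :=
    (h3.mul (hasDerivAt_harmonicRadial hf hx)).add
      ((hasDerivAt_cutoff x).mul ((hasDerivAt_profile hf hx).inv hp).neg)
  rw [radialExpr, radialExpr, h2.deriv_eq, h4.deriv, h2.eq_of_nhds]
  field_simp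
  ring

theorem radialExpr_cutoff_of_lt {x : ℝ} (hx : x < 1 / 2) : radialExpr f cutoff x = 0 := by
  have : deriv cutoff =ᶠ[𝓝 x] fun _ => 0 := by
    filter_upwards [Iio_mem_nhds hx] with y hy using deriv_cutoff_of_lt hy
  rw [radialExpr, this.deriv_eq, deriv_cutoff_of_lt hx]
  simp

theorem radialExpr_cutoff_of_gt {x : ℝ} (hx : 1 < x) : radialExpr f cutoff x = 0 := by
  have : deriv cutoff =ᶠ[𝓝 x] fun _ => 0 := by
    filter_upwards [Ioi_mem_nhds hx] with y hy using deriv_cutoff_of_gt hy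
  rw [radialExpr, this.deriv_eq, deriv_cutoff_of_gt hx]
  simp

theorem continuousOn_radialExpr_cutoff (hf : IsGrushinProfile f) :
    ContinuousOn (radialExpr f cutoff) (Set.Ioi 0) := by
  have h2 : Continuous (deriv (deriv cutoff)) :=
    (contDiff_infty_iff_deriv.1 contDiff_deriv_cutoff).2.continuous
  exact h2.continuousOn.add (((contDiffOn_deriv_profile hf).continuousOn.div
    (contDiffOn_profile hf).continuousOn fun x hx => (hf.pos x (ne_of_gt hx)).ne').mul
      contDiff_deriv_cutoff.continuous.continuousOn)

theorem exists_bound_of_continuousOn_Ioi {ℓ : ℝ → ℝ} (hc : ContinuousOn ℓ (Set.Ioi 0))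
    (h0 : ∀ x, x < 1 / 2 → ℓ x = 0) : ∃ C, ∀ x ∈ Set.Ioc (0 : ℝ) 1, |ℓ x| ≤ C := by
  obtain ⟨C, hC⟩ := (isCompact_Icc (a := (1 / 2 : ℝ)) (b := 1)).exists_bound_of_continuousOn
    (hc.mono fun x hx => Set.mem_Ioi.2 (by linarith [hx.1]))
  refine ⟨max C 0, fun x hx => ?_⟩
  by_cases h : x < 1 / 2
  · rw [h0 x h, abs_zero]
    exact le_max_right _ _
  · exact (hC x ⟨not_lt.1 h, hx.2⟩).trans (le_max_left _ _)

/-- A smooth bump function centred at `3 k`. -/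
def bump (k : ℕ) : ContDiffBump (3 * k : ℝ) := ⟨1 / 2, 1, by norm_num, by norm_num⟩

theorem contDiff_bump (k : ℕ) : ContDiff ℝ ∞ (bump k) := (bump k).contDiff

theorem contDiff_deriv2_bump (k : ℕ) : ContDiff ℝ ∞ (deriv (deriv (bump k))) :=
  (contDiff_infty_iff_deriv.1 (contDiff_infty_iff_deriv.1 (contDiff_bump k)).2).2

theorem bump_eq_zero {k : ℕ} {y : ℝ} (h : 1 < |y - 3 * k|) :
    bump k y = 0 ∧ deriv (deriv (bump k)) y = 0 := by
  have hy : y ∉ tsupport (bump k) := by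
    rw [(bump k).tsupport_eq, Metric.mem_closedBall, Real.dist_eq]
    exact not_le.2 h
  refine ⟨image_eq_zero_of_notMem_tsupport hy, image_eq_zero_of_notMem_tsupport fun h' => hy ?_⟩
  exact tsupport_deriv_subset (tsupport_deriv_subset h')

/-- Distinct centres are at least `3` apart, while the supports have radius `1`. -/
theorem bump_eq_zero_of_ne {j k : ℕ} (hjk : j ≠ k) (y : ℝ) :
    (bump j y = 0 ∧ deriv (deriv (bump j)) y = 0) ∨
      (bump k y = 0 ∧ deriv (deriv (bump k)) y = 0) := by
  by_contra h
  rw [not_or] at h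
  have hj : |y - 3 * j| ≤ 1 := not_lt.1 fun h' => h.1 (bump_eq_zero h')
  have hk : |y - 3 * k| ≤ 1 := not_lt.1 fun h' => h.2 (bump_eq_zero h')
  rw [abs_le] at hj hk
  rcases lt_or_gt_of_ne hjk with h | h
  · have : (j : ℝ) + 1 ≤ k := by exact_mod_cast h
    linarith
  · have : (k : ℝ) + 1 ≤ j := by exact_mod_cast h
    linarith

theorem exists_abs_le_bump (k : ℕ) : ∃ C, ∀ y, |bump k y| ≤ C ∧ |deriv (deriv (bump k)) y| ≤ C := by
  obtain ⟨C₁, h₁⟩ := (contDiff_bump k).continuous.bounded_above_of_compact_support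
    (bump k).hasCompactSupport
  obtain ⟨C₂, h₂⟩ := (contDiff_deriv2_bump k).continuous.bounded_above_of_compact_support
    (bump k).hasCompactSupport.deriv.deriv
  exact ⟨max C₁ C₂, fun y => ⟨(h₁ y).trans (le_max_left _ _), (h₂ y).trans (le_max_right _ _)⟩⟩

/-- On products the operator gives `(radialExpr f a) b + f⁻² a b''`. Every factor is bounded on `(0,
1]`, `f⁻²` by `κ⁻²`, and the support lies in a box of finite volume. -/
theorem memLp_tensor_bump (hf : IsGrushinProfile f) (hi : IntegrableOn f (Set.Ioc 0 1))
    {a : ℝ → ℝ} (ha : ContDiffOn ℝ ∞ a (Set.Ioi 0)) (ha0 : ∀ x, 1 < x → a x = 0)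
    (hr0 : ∀ x, 1 < x → radialExpr f a x = 0)
    (hab : ∃ C, ∀ x ∈ Set.Ioc (0 : ℝ) 1, |a x| ≤ C)
    (hrb : ∃ C, ∀ x ∈ Set.Ioc (0 : ℝ) 1, |radialExpr f a x| ≤ C) (k : ℕ) :
    MemLp (tensor a (bump k)) 2 (grushinMeasure f) ∧
      MemLp (grushinExpr f (tensor a (bump k))) 2 (grushinMeasure f) := by
  obtain ⟨A, hA⟩ := hab
  obtain ⟨B, hB⟩ := hrb
  obtain ⟨D, hD⟩ := exists_abs_le_bump k
  obtain ⟨κ, hκ, hfκ⟩ := exists_profile_lower_bound hf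
  have hs := contDiffOn_tensor ha (contDiff_bump k)
  have hout : ∀ p ∈ halfPlane, p ∉ Set.Ioc (0 : ℝ) 1 ×ˢ Set.Icc (-(3 * k + 1 : ℝ)) (3 * k + 1) →
      1 < p.1 ∨ (bump k p.2 = 0 ∧ deriv (deriv (bump k)) p.2 = 0) := by
    intro p hp hp'
    by_contra h
    rw [not_or, not_lt] at h
    have h2 : |p.2 - 3 * k| ≤ 1 := not_lt.1 fun h' => h.2 (bump_eq_zero h')
    rw [abs_le] at h2
    have hk : (0 : ℝ) ≤ k := Nat.cast_nonneg k
    exact hp' ⟨⟨hp, h.1⟩, by linarith, by linarith⟩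
  constructor
  · refine memLp_of_bounded hf hi hs.continuousOn (3 * k + 1) (A * D) ?_ ?_
    · intro p hp hp'
      rcases hout p hp hp' with h | h
      · simp [tensor, ha0 _ h]
      · simp [tensor, h.1]
    · intro p hp
      rw [tensor, norm_mul, Complex.norm_real, Complex.norm_real]
      exact mul_le_mul (hA _ hp.1) (hD _).1 (norm_nonneg _) ((abs_nonneg _).trans (hA _ hp.1))
  · refine memLp_of_bounded hf hi (continuousOn_grushinExpr hf hs) (3 * k + 1)
      (B * D + 1 / κ ^ 2 * A * D) ?_ ?_
    · intro p hp hp'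
      rw [grushinExpr_tensor ha (contDiff_bump k) hp]
      rcases hout p hp hp' with h | h
      · simp [ha0 _ h, hr0 _ h]
      · simp [h.1, h.2]
    · intro p hp
      rw [grushinExpr_tensor ha (contDiff_bump k) hp.1.1, Complex.norm_real]
      have hA0 := (abs_nonneg _).trans (hA _ hp.1)
      have hf2 : |1 / f p.1 ^ 2| ≤ 1 / κ ^ 2 := by
        rw [abs_of_nonneg (by positivity)]
        exact one_div_le_one_div_of_le (by positivity)
          (pow_le_pow_left₀ hκ.le (hfκ _ hp.1) 2)
      refine (norm_add_le _ _).trans (add_le_add ?_ ?_)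
      · rw [norm_mul]
        exact mul_le_mul (hB _ hp.1) (hD _).1 (norm_nonneg _) ((abs_nonneg _).trans (hB _ hp.1))
      · rw [norm_mul, norm_mul]
        exact mul_le_mul (mul_le_mul hf2 (hA _ hp.1) (norm_nonneg _) (by positivity)) (hD _).2
          (norm_nonneg _) (by positivity)

theorem contDiffOn_cutoff_mul (hf : IsGrushinProfile f) :
    ContDiffOn ℝ ∞ (fun t => cutoff t * harmonicRadial f t) (Set.Ioi 0) :=
  contDiff_cutoff.contDiffOn.mul (contDiffOn_harmonicRadial hf)

theorem abs_cutoff_le (x : ℝ) : |cutoff x| ≤ 1 := by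
  rw [cutoff, abs_of_nonneg (Real.smoothTransition.nonneg _)]
  exact Real.smoothTransition.le_one _

theorem memLp_tensor_cutoff (hf : IsGrushinProfile f) (hi : IntegrableOn f (Set.Ioc 0 1)) (k : ℕ) :
    MemLp (tensor cutoff (bump k)) 2 (grushinMeasure f) ∧
      MemLp (grushinExpr f (tensor cutoff (bump k))) 2 (grushinMeasure f) :=
  memLp_tensor_bump hf hi contDiff_cutoff.contDiffOn (fun _ hx => cutoff_of_ge hx.le)
    (fun _ hx => radialExpr_cutoff_of_gt hx) ⟨1, fun x _ => abs_cutoff_le x⟩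
    (exists_bound_of_continuousOn_Ioi (continuousOn_radialExpr_cutoff hf)
      fun _ hx => radialExpr_cutoff_of_lt hx) k

theorem memLp_tensor_harmonic (hf : IsGrushinProfile f) (hi : IntegrableOn f (Set.Ioc 0 1))
    (k : ℕ) :
    MemLp (tensor (fun t => cutoff t * harmonicRadial f t) (bump k)) 2 (grushinMeasure f) ∧
      MemLp (grushinExpr f (tensor (fun t => cutoff t * harmonicRadial f t) (bump k))) 2
        (grushinMeasure f) := by
  obtain ⟨C, hC⟩ := exists_abs_harmonicRadial_le hf
  have hne : ∀ x ∈ Set.Ioi (0 : ℝ), f x ≠ 0 := fun x hx => (hf.pos x (ne_of_gt hx)).ne'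
  refine memLp_tensor_bump hf hi (contDiffOn_cutoff_mul hf)
    (fun _ hx => by rw [cutoff_of_ge hx.le, zero_mul])
    (fun x hx => by
      rw [radialExpr_mul_cutoff hf (one_pos.trans hx), radialExpr_cutoff_of_gt hx,
        deriv_cutoff_of_gt hx]
      simp)
    ⟨1 * C, fun x hx => ?_⟩ ?_ k
  · rw [abs_mul]
    exact mul_le_mul (abs_cutoff_le x) (hC x hx) (abs_nonneg _) zero_le_one
  · obtain ⟨B, hB⟩ := exists_bound_of_continuousOn_Ioi
      (ℓ := fun x => radialExpr f cutoff x * harmonicRadial f x - 2 * deriv cutoff x / f x)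
      (((continuousOn_radialExpr_cutoff hf).mul (contDiffOn_harmonicRadial hf).continuousOn).sub
        ((contDiff_deriv_cutoff.continuous.continuousOn.const_mul 2).div
          (contDiffOn_profile hf).continuousOn hne))
      (fun x hx => by simp [radialExpr_cutoff_of_lt hx, deriv_cutoff_of_lt hx])
    exact ⟨B, fun x hx => by rw [radialExpr_mul_cutoff hf hx.1]; exact hB x hx⟩

/-- The integrand is the derivative of `cutoff² / 2`, which falls from `1/2` to `0`. -/
theorem integral_cutoff_mul_deriv :
    ∫ x in Set.Ioi (0 : ℝ), cutoff x * deriv cutoff x = -(1 / 2) := by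
  have h : ∀ x ∈ Set.Ioi (0 : ℝ), HasDerivAt (fun t => cutoff t ^ 2 / 2)
      (cutoff x * deriv cutoff x) x := by
    intro x _
    refine (((hasDerivAt_cutoff x).pow 2).div_const 2).congr_deriv ?_
    norm_num
    ring
  have hcont : Continuous fun x => cutoff x * deriv cutoff x :=
    contDiff_cutoff.continuous.mul contDiff_deriv_cutoff.continuous
  have hint : IntegrableOn (fun x => cutoff x * deriv cutoff x) (Set.Ioi 0) := by
    have h1 : IntegrableOn (fun x => cutoff x * deriv cutoff x) (Set.Icc 0 1) :=
      hcont.continuousOn.integrableOn_Icc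
    refine h1.of_forall_sdiff_eq_zero measurableSet_Ioi fun x hx => ?_
    have : 1 ≤ x := by
      by_contra h'
      exact hx.2 ⟨le_of_lt hx.1, (not_le.1 h').le⟩
    rw [cutoff_of_ge this, zero_mul]
  rw [integral_Ioi_of_hasDerivAt_of_tendsto (m := 0) (contDiff_cutoff.continuous.pow 2
    |>.div_const 2).continuousWithinAt h hint]
  · rw [Pi.pow_apply, cutoff_of_le (by norm_num)]
    norm_num
  · refine tendsto_const_nhds.congr' ?_
    filter_upwards [Filter.eventually_ge_atTop (1 : ℝ)] with x hx
    rw [Pi.pow_apply, cutoff_of_ge hx]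
    norm_num

theorem boundary_form_pointwise (hf : IsGrushinProfile f) (j k : ℕ) {p : ℝ × ℝ}
    (hp : p ∈ halfPlane) :
    (f p.1 : ℂ) * (starRingEnd ℂ (grushinExpr f
        (tensor (fun t => cutoff t * harmonicRadial f t) (bump j)) p) * tensor cutoff (bump k) p
      - starRingEnd ℂ (tensor (fun t => cutoff t * harmonicRadial f t) (bump j) p)
        * grushinExpr f (tensor cutoff (bump k)) p)
      = ((-(2 * (cutoff p.1 * deriv cutoff p.1)) : ℝ) : ℂ)
        * ((bump j p.2 * bump k p.2 : ℝ) : ℂ) := by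
  -- This cancels the `y`-derivative terms even before integration: they are symmetric if `j = k`,
  -- and both zero by disjointness of supports otherwise.
  have hy : bump j p.2 * deriv (deriv (bump k)) p.2 = deriv (deriv (bump j)) p.2 * bump k p.2 := by
    by_cases hjk : j = k
    · subst hjk; ring
    · rcases bump_eq_zero_of_ne hjk p.2 with h | h <;> simp [h.1, h.2]
  have hne := (hf.pos _ (ne_of_gt hp)).ne'
  rw [grushinExpr_tensor (contDiffOn_cutoff_mul hf) (contDiff_bump j) hp,
    grushinExpr_tensor contDiff_cutoff.contDiffOn (contDiff_bump k) hp,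
    radialExpr_mul_cutoff hf hp]
  simp only [tensor, Complex.conj_ofReal, map_mul]
  norm_cast
  field_simp
  linear_combination (-(cutoff p.1 ^ 2 * harmonicRadial f p.1)) * hy

/-- The `x`-integral of `-2 χ χ'` is `1`, which is up to sign the Wronskian `f h'` of the radial
solutions `1` and `h`; what is left is the Gram matrix of the bumps. -/
theorem boundary_form (hf : IsGrushinProfile f) (hi : IntegrableOn f (Set.Ioc 0 1)) (j k : ℕ) :
    inner ℂ ((memLp_tensor_harmonic hf hi j).1.toLp _)
        (-((memLp_tensor_cutoff hf hi k).2.toLp (grushinExpr f (tensor cutoff (bump k)))))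
      - inner ℂ (-((memLp_tensor_harmonic hf hi j).2.toLp (grushinExpr f
        (tensor (fun t => cutoff t * harmonicRadial f t) (bump j)))))
        ((memLp_tensor_cutoff hf hi k).1.toLp _)
      = ((∫ y, bump j y * bump k y : ℝ) : ℂ) := by
  rw [inner_neg_left, inner_neg_right, inner_toLp, inner_toLp]
  rw [integral_congr_ae (g := fun p => starRingEnd ℂ
      (tensor (fun t => cutoff t * harmonicRadial f t) (bump j) p)
        * grushinExpr f (tensor cutoff (bump k)) p) (by
    filter_upwards [(memLp_tensor_harmonic hf hi j).1.coeFn_toLp] with p hp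
    rw [hp]),
    integral_congr_ae (f := fun p => starRingEnd ℂ (((memLp_tensor_harmonic hf hi j).2.toLp _) p)
      * tensor cutoff (bump k) p) (g := fun p => starRingEnd ℂ (grushinExpr f
        (tensor (fun t => cutoff t * harmonicRadial f t) (bump j)) p)
        * tensor cutoff (bump k) p) (by
    filter_upwards [(memLp_tensor_harmonic hf hi j).2.coeFn_toLp] with p hp
    rw [hp]), neg_sub_neg, ← integral_sub
      (integrable_conj_mul (memLp_tensor_harmonic hf hi j).2 (memLp_tensor_cutoff hf hi k).1)
      (integrable_conj_mul (memLp_tensor_harmonic hf hi j).1 (memLp_tensor_cutoff hf hi k).2),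
    integral_grushinMeasure hf,
    setIntegral_congr_fun halfPlane.isOpen.measurableSet
      fun p hp => boundary_form_pointwise hf j k hp]
  have hset : (halfPlane : Set (ℝ × ℝ)) = Set.Ioi 0 ×ˢ Set.univ := by
    ext p
    simp [mem_halfPlane]
  rw [hset, Measure.volume_eq_prod, setIntegral_prod_mul (fun x : ℝ =>
    ((-(2 * (cutoff x * deriv cutoff x)) : ℝ) : ℂ)) (fun y : ℝ => ((bump j y * bump k y : ℝ) : ℂ)),
    integral_complex_ofReal, integral_complex_ofReal, integral_neg, integral_const_mul,
    integral_cutoff_mul_deriv, Measure.restrict_univ]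
  norm_num

theorem integral_bump_mul_self_pos (k : ℕ) : 0 < ∫ y, bump k y * bump k y := by
  have hc : Continuous fun y => bump k y * bump k y :=
    (contDiff_bump k).continuous.mul (contDiff_bump k).continuous
  refine hc.integral_pos_of_hasCompactSupport_nonneg_nonzero ?_ (fun y => mul_self_nonneg _)
    (x := 3 * k) ?_
  · exact (bump k).hasCompactSupport.mul_left
  · rw [(bump k).one_of_mem_closedBall (Metric.mem_closedBall_self (bump k).rIn_pos.le)]
    norm_num

theorem not_finite_deficiencySpaces_hamiltonian (hf : IsGrushinProfile f) {ε : ℝ} (hε : 0 < ε)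
    (h : ∀ x, x ≠ 0 → 2 * f x * deriv (deriv f) x - deriv f x ^ 2 ≤ (3 - ε) / x ^ 2 * f x ^ 2) :
    ¬ Module.Finite ℂ (deficiencySpace (hamiltonian hf) Complex.I) ∧
      ¬ Module.Finite ℂ (deficiencySpace (hamiltonian hf) (-Complex.I)) := by
  have hi := integrableOn_profile hf hε h
  have key := not_finite_deficiencySpaces (dense_domain_hamiltonian hf)
    (hamiltonian_isFormalAdjoint hf) _ _ _ _
    (fun k => mem_graph_adjoint_hamiltonian hf
      (contDiffOn_tensor contDiff_cutoff.contDiffOn (contDiff_bump k))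
      (memLp_tensor_cutoff hf hi k).1 (memLp_tensor_cutoff hf hi k).2)
    (fun k => mem_graph_adjoint_hamiltonian hf
      (contDiffOn_tensor (contDiffOn_cutoff_mul hf) (contDiff_bump k))
      (memLp_tensor_harmonic hf hi k).1 (memLp_tensor_harmonic hf hi k).2)
    (fun k => by
      rw [boundary_form hf hi]
      exact_mod_cast (integral_bump_mul_self_pos k).ne')
    (fun j k hjk => by
      rw [boundary_form hf hi, integral_eq_zero_of_ae]
      · simp
      · refine Filter.Eventually.of_forall fun y => ?_
        rcases bump_eq_zero_of_ne hjk y with h | h <;> simp [h.1])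
  -- Finite dimension of either space would pass to the other by conjugation, contradicting `key`.
  constructor
  · intro hfin
    have := finite_deficiencySpace_conj hf hfin
    rw [Complex.conj_I] at this
    exact key ⟨hfin, this⟩
  · intro hfin
    have := finite_deficiencySpace_conj hf hfin
    rw [map_neg, Complex.conj_I, neg_neg] at this
    exact key ⟨this, hfin⟩

end Deficiency

/-! ### Weak solutions of second order equations on the half-line -/

section HalfLine

/-- Smooth real functions with compact support in `(0, ∞)`. -/
structure IsHalfLineTest (φ : ℝ → ℝ) : Prop where
  contDiff : ContDiff ℝ ∞ φ
  hasCompactSupport : HasCompactSupport φ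
  tsupport_subset : tsupport φ ⊆ Set.Ioi 0

theorem IsHalfLineTest.of_eq_zero {φ : ℝ → ℝ} (hφ : ContDiff ℝ ∞ φ) {p q : ℝ} (hp : 0 < p)
    (h : ∀ x, x ∉ Set.Icc p q → φ x = 0) : IsHalfLineTest φ := by
  have hs : tsupport φ ⊆ Set.Icc p q :=
    closure_minimal (fun x hx => by_contra fun h' => hx (h x h')) isClosed_Icc
  exact ⟨hφ, HasCompactSupport.intro isCompact_Icc fun x hx => h x hx,
    fun x hx => lt_of_lt_of_le hp (hs hx).1⟩

theorem IsHalfLineTest.exists_interval {φ : ℝ → ℝ} (hφ : IsHalfLineTest φ) :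
    ∃ p q, 0 < p ∧ p < q ∧ ∀ x, x ∉ Set.Ioo p q → φ x = 0 := by
  rcases (tsupport φ).eq_empty_or_nonempty with he | hne
  · refine ⟨1, 2, one_pos, one_lt_two, fun x _ => image_eq_zero_of_notMem_tsupport ?_⟩
    rw [he]
    exact Set.notMem_empty x
  · have hK : IsCompact (tsupport φ) := hφ.hasCompactSupport
    have h1 := hφ.tsupport_subset (hK.sInf_mem hne)
    have h2 := csInf_le_csSup hne (ha := hK.bddAbove) (hb := hK.bddBelow)
    refine ⟨sInf (tsupport φ) / 2, sSup (tsupport φ) + 1, half_pos h1, ?_, fun x hx =>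
      image_eq_zero_of_notMem_tsupport fun hx' => hx ?_⟩
    · linarith [half_lt_self (Set.mem_Ioi.1 h1)]
    · have h3 := csInf_le hK.bddBelow hx'
      have h4 := le_csSup hK.bddAbove hx'
      exact ⟨(half_lt_self h1).trans_le h3, by linarith⟩

theorem IsHalfLineTest.deriv {φ : ℝ → ℝ} (hφ : IsHalfLineTest φ) : IsHalfLineTest (deriv φ) :=
  ⟨(contDiff_infty_iff_deriv.1 hφ.contDiff).2, hφ.hasCompactSupport.deriv,
    tsupport_deriv_subset.trans hφ.tsupport_subset⟩

theorem IsHalfLineTest.sub_smul {φ ψ : ℝ → ℝ} (hφ : IsHalfLineTest φ) (hψ : IsHalfLineTest ψ)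
    (c : ℝ) : IsHalfLineTest fun x => φ x - c * ψ x := by
  obtain ⟨p, q, hp, hpq, h⟩ := hφ.exists_interval
  obtain ⟨p', q', hp', hpq', h'⟩ := hψ.exists_interval
  refine IsHalfLineTest.of_eq_zero (hφ.contDiff.sub (contDiff_const.mul hψ.contDiff))
    (lt_min hp hp') (q := max q q') fun x hx => ?_
  rw [h x fun hx' => hx ⟨(min_le_left _ _).trans hx'.1.le, hx'.2.le.trans (le_max_left _ _)⟩,
    h' x fun hx' => hx ⟨(min_le_right _ _).trans hx'.1.le, hx'.2.le.trans (le_max_right _ _)⟩]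
  simp

theorem IsHalfLineTest.integrable_mul {φ : ℝ → ℝ} (hφ : IsHalfLineTest φ) {F : ℝ → ℂ}
    (hF : LocallyIntegrableOn F (Set.Ioi 0)) : Integrable fun x => (φ x : ℂ) * F x := by
  obtain ⟨p, q, hp, -, h⟩ := hφ.exists_interval
  have hK : Set.Icc p q ⊆ Set.Ioi 0 := fun x hx => lt_of_lt_of_le hp hx.1
  have h1 : IntegrableOn (fun x => (φ x : ℂ) * F x) (Set.Icc p q) :=
    (hF.integrableOn_compact_subset hK isCompact_Icc).continuousOn_mul
      (Complex.continuous_ofReal.comp hφ.contDiff.continuous).continuousOn isCompact_Icc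
  rw [← integrableOn_univ]
  refine h1.of_forall_sdiff_eq_zero MeasurableSet.univ fun x hx => ?_
  rw [h x fun hx' => hx.2 (Set.Ioo_subset_Icc_self hx'), Complex.ofReal_zero, zero_mul]

theorem IsHalfLineTest.integral_deriv {φ : ℝ → ℝ} (hφ : IsHalfLineTest φ) :
    ∫ x, _root_.deriv φ x = 0 :=
  integral_eq_zero_of_hasDerivAt_of_integrable
    (fun x => (hφ.contDiff.differentiable (by simp) x).hasDerivAt)
    (hφ.deriv.contDiff.continuous.integrable_of_hasCompactSupport hφ.deriv.hasCompactSupport)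
    (hφ.contDiff.continuous.integrable_of_hasCompactSupport hφ.hasCompactSupport)

/-- The primitive started to the left of the support vanishes again to its right because the total
integral is zero. -/
theorem IsHalfLineTest.exists_primitive {ψ : ℝ → ℝ} (hψ : IsHalfLineTest ψ)
    (h0 : ∫ x, ψ x = 0) : ∃ φ, IsHalfLineTest φ ∧ _root_.deriv φ = ψ := by
  obtain ⟨p, q, hp, hpq, h⟩ := hψ.exists_interval
  have hd : ∀ x, HasDerivAt (fun x => ∫ t in p..x, ψ t) (ψ x) x := fun x =>
    intervalIntegral.integral_hasDerivAt_right (hψ.contDiff.continuous.intervalIntegrable _ _)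
      (hψ.contDiff.continuous.stronglyMeasurableAtFilter _ _) hψ.contDiff.continuous.continuousAt
  have hderiv : _root_.deriv (fun x => ∫ t in p..x, ψ t) = ψ := funext fun x => (hd x).deriv
  refine ⟨fun x => ∫ t in p..x, ψ t, IsHalfLineTest.of_eq_zero (p := p) (q := q) ?_ hp ?_, hderiv⟩
  · rw [contDiff_infty_iff_deriv, hderiv]
    exact ⟨fun x => (hd x).differentiableAt, hψ.contDiff⟩
  · intro x hx
    by_cases hxp : x < p
    · refine intervalIntegral.integral_zero_ae (Filter.Eventually.of_forall fun t ht => h t ?_)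
      rw [Set.uIoc_of_ge hxp.le] at ht
      exact fun ht' => absurd ht'.1 (not_lt.2 ht.2)
    · have hxq : q < x := by
        by_contra h'
        exact hx ⟨not_lt.1 hxp, not_lt.1 h'⟩
      rw [intervalIntegral.integral_of_le (not_lt.1 hxp),
        setIntegral_eq_integral_of_forall_compl_eq_zero, h0]
      intro t ht
      exact h t fun ht' => ht ⟨ht'.1, (ht'.2.trans hxq).le⟩

theorem exists_isHalfLineTest_integral_eq_one : ∃ ρ, IsHalfLineTest ρ ∧ ∫ x, ρ x = 1 := by
  let β : ContDiffBump (3 : ℝ) := ⟨1, 2, one_pos, one_lt_two⟩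
  refine ⟨β.normed volume, ⟨β.contDiff_normed, β.hasCompactSupport_normed, ?_⟩,
    β.integral_normed⟩
  rw [β.tsupport_normed_eq]
  intro x hx
  rw [Metric.mem_closedBall, Real.dist_eq, abs_le] at hx
  have : -2 ≤ x - 3 := hx.1
  rw [Set.mem_Ioi]
  linarith

theorem ae_eq_zero_of_isHalfLineTest {H : ℝ → ℂ} (hH : LocallyIntegrableOn H (Set.Ioi 0))
    (h : ∀ φ, IsHalfLineTest φ → ∫ x, (φ x : ℂ) * H x = 0) : ∀ᵐ x, x ∈ Set.Ioi (0 : ℝ) → H x = 0 :=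
  isOpen_Ioi.ae_eq_zero_of_integral_contDiff_smul_eq_zero hH fun g hg hc hs => by
    simpa only [Complex.real_smul] using h g ⟨hg, hc, hs⟩

/-- The fundamental lemma of du Bois-Reymond. -/
theorem ae_eq_const_of_weak_deriv_eq_zero {H : ℝ → ℂ} (hH : LocallyIntegrableOn H (Set.Ioi 0))
    (h : ∀ φ, IsHalfLineTest φ → ∫ x, ((deriv φ x : ℝ) : ℂ) * H x = 0) :
    ∃ c : ℂ, ∀ᵐ x, x ∈ Set.Ioi (0 : ℝ) → H x = c := by
  obtain ⟨ρ, hρ, hρ1⟩ := exists_isHalfLineTest_integral_eq_one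
  refine ⟨∫ x, (ρ x : ℂ) * H x, ?_⟩
  set c := ∫ x, (ρ x : ℂ) * H x with hc
  have hconst : LocallyIntegrableOn (fun _ : ℝ => c) (Set.Ioi 0) :=
    (locallyIntegrable_const c).locallyIntegrableOn _
  have h0 := ae_eq_zero_of_isHalfLineTest (hH.sub hconst) fun ψ hψ => by
    -- Subtracting `(∫ ψ) ρ` leaves mean zero, hence the derivative of a test function.
    obtain ⟨φ, hφ, hφψ⟩ := (hψ.sub_smul hρ (∫ x, ψ x)).exists_primitive (by
      rw [integral_sub (hψ.contDiff.continuous.integrable_of_hasCompactSupport hψ.hasCompactSupport)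
        ((hρ.contDiff.continuous.integrable_of_hasCompactSupport hρ.hasCompactSupport).const_mul _),
        integral_const_mul, hρ1, mul_one, sub_self])
    have h1 := h φ hφ
    rw [hφψ] at h1
    have e1 : (fun x => (((ψ x - (∫ x, ψ x) * ρ x : ℝ)) : ℂ) * H x)
        = fun x => (ψ x : ℂ) * H x - ((∫ x, ψ x : ℝ) : ℂ) * ((ρ x : ℂ) * H x) := by
      ext x; push_cast; ring
    rw [e1, integral_sub (hψ.integrable_mul hH) ((hρ.integrable_mul hH).const_mul _),
      integral_const_mul, ← hc] at h1
    have e2 : (fun x => (ψ x : ℂ) * (H - fun _ : ℝ => c) x)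
        = fun x => (ψ x : ℂ) * H x - (ψ x : ℂ) * c := by
      ext x; simp [mul_sub]
    rw [e2, integral_sub (hψ.integrable_mul hH) (hψ.integrable_mul hconst), integral_mul_const,
      integral_complex_ofReal, h1]
  filter_upwards [h0] with x hx hx0
  exact sub_eq_zero.1 (hx hx0)

/-- Fubini on the triangle `t ≤ x`: the inner integral of `φ'` over `[t, q]` is `φ q - φ t = -φ t`.
Only integrability of `G` is needed. -/
theorem integral_deriv_mul_primitive {φ : ℝ → ℝ} (hφ : ContDiff ℝ ∞ φ) {p q : ℝ} 
    (hq : φ q = 0) {G : ℝ → ℂ} (hG : IntegrableOn G (Set.Ioc p q)) :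
    ∫ x in Set.Ioc p q, ((deriv φ x : ℝ) : ℂ) * ∫ t in Set.Ioc p x, G t
      = -∫ x in Set.Ioc p q, (φ x : ℂ) * G x := by
  have hφ' : Continuous (deriv φ) := (contDiff_infty_iff_deriv.1 hφ).2.continuous
  let k : ℝ → ℝ → ℂ := fun x t =>
    {r : ℝ × ℝ | r.2 ≤ r.1}.indicator (fun r => ((deriv φ r.1 : ℝ) : ℂ) * G r.2) (x, t)
  have hk : Integrable (Function.uncurry k)
      ((volume.restrict (Set.Ioc p q)).prod (volume.restrict (Set.Ioc p q))) := by
    have h1 : Integrable (fun x => ((deriv φ x : ℝ) : ℂ)) (volume.restrict (Set.Ioc p q)) :=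
      ((Complex.continuous_ofReal.comp hφ').continuousOn.integrableOn_Icc).mono_set
        Set.Ioc_subset_Icc_self
    exact (h1.mul_prod hG).indicator (measurableSet_le measurable_snd measurable_fst)
  have hswap := integral_integral_swap hk
  have hl : ∀ x ∈ Set.Ioc p q, ∫ t in Set.Ioc p q, k x t
      = ((deriv φ x : ℝ) : ℂ) * ∫ t in Set.Ioc p x, G t := by
    intro x hx
    have e : ∀ t, k x t = (Set.Iic x).indicator (fun t => ((deriv φ x : ℝ) : ℂ) * G t) t :=
      fun t => rfl
    simp_rw [e]
    rw [setIntegral_indicator measurableSet_Iic, Set.Ioc_inter_Iic, min_eq_right hx.2,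
      integral_const_mul]
  have hr : ∀ t ∈ Set.Ioc p q, ∫ x in Set.Ioc p q, k x t = -((φ t : ℂ) * G t) := by
    intro t ht
    have e : ∀ x, k x t = (Set.Ici t).indicator (fun x => ((deriv φ x : ℝ) : ℂ) * G t) x :=
      fun t => rfl
    simp_rw [e]
    have hset : Set.Ioc p q ∩ Set.Ici t = Set.Icc t q := by
      ext x
      simp only [Set.mem_inter_iff, Set.mem_Ioc, Set.mem_Ici, Set.mem_Icc]
      exact ⟨fun h => ⟨h.2, h.1.2⟩, fun h => ⟨⟨ht.1.trans_le h.1, h.2⟩, h.1⟩⟩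
    rw [setIntegral_indicator measurableSet_Ici, hset, integral_mul_const, integral_Icc_eq_integral_Ioc,
      ← intervalIntegral.integral_of_le ht.2, intervalIntegral.integral_ofReal,
      intervalIntegral.integral_deriv_eq_sub (fun x _ => hφ.differentiable (by simp) x)
        (hφ'.intervalIntegrable _ _), hq]
    push_cast
    ring
  rw [setIntegral_congr_fun measurableSet_Ioc hl, setIntegral_congr_fun measurableSet_Ioc hr,
    integral_neg] at hswap
  exact hswap

theorem intervalIntegrable_Ioi {G : ℝ → ℂ}
    (hG : LocallyIntegrableOn G (Set.Ioi 0)) {a b : ℝ} (ha : 0 < a) (hb : 0 < b) :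
    IntervalIntegrable G volume a b := by
  rw [intervalIntegrable_iff]
  refine (hG.integrableOn_compact_subset (t := Set.uIcc a b)
    (fun x hx => lt_of_lt_of_le (lt_min ha hb) hx.1) isCompact_uIcc).mono_set Set.uIoc_subset_uIcc

theorem continuousOn_primitive_Ioi {G : ℝ → ℂ} (hG : LocallyIntegrableOn G (Set.Ioi 0)) :
    ContinuousOn (fun x => ∫ t in (1 : ℝ)..x, G t) (Set.Ioi 0) := by
  intro x hx
  have hx : 0 < x := hx
  have h := intervalIntegral.continuousOn_primitive_interval' (a := 1)
    (intervalIntegrable_Ioi hG (a := min (x / 2) 1) (b := max (x + 1) 1)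
      (by positivity) (by positivity)) (by
        rw [Set.uIcc_of_le ((min_le_right _ _).trans (le_max_right _ _))]
        exact ⟨min_le_right _ _, le_max_right _ _⟩)
  rw [Set.uIcc_of_le ((min_le_right _ _).trans (le_max_right _ _))] at h
  refine (h.continuousAt (Icc_mem_nhds ?_ ?_)).continuousWithinAt
  · exact (min_le_left _ _).trans_lt (half_lt_self hx)
  · exact (lt_add_one x).trans_le (le_max_left _ _)

/-- Integration by parts against a primitive of a locally integrable function. -/
theorem IsHalfLineTest.integral_deriv_mul_primitive {φ : ℝ → ℝ} (hφ : IsHalfLineTest φ)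
    {G : ℝ → ℂ} (hG : LocallyIntegrableOn G (Set.Ioi 0)) :
    ∫ x, ((_root_.deriv φ x : ℝ) : ℂ) * ∫ t in (1 : ℝ)..x, G t = -∫ x, (φ x : ℂ) * G x := by
  obtain ⟨p, q, hp, hpq, h⟩ := hφ.exists_interval
  obtain ⟨p', q', hp', hpq', h'⟩ := hφ.deriv.exists_interval
  set P := min p p' with hP
  set Q := max q q' with hQ
  have hP0 : 0 < P := lt_min hp hp'
  have hPQ : P < Q := (min_le_left _ _).trans_lt (hpq.trans_le (le_max_left _ _))
  have z : ∀ x, x ∉ Set.Ioc P Q → φ x = 0 := fun x hx => h x fun hx' =>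
    hx ⟨(min_le_left _ _).trans_lt hx'.1, hx'.2.le.trans (le_max_left _ _)⟩
  have z' : ∀ x, x ∉ Set.Ioc P Q → _root_.deriv φ x = 0 := fun x hx => h' x fun hx' =>
    hx ⟨(min_le_right _ _).trans_lt hx'.1, hx'.2.le.trans (le_max_right _ _)⟩
  have hφQ : φ Q = 0 := h Q fun hx => absurd hx.2 (not_lt.2 (le_max_left _ _))
  have key := Grushin.integral_deriv_mul_primitive hφ.contDiff hφQ
    ((intervalIntegrable_Ioi hG hP0 (hP0.trans hPQ)).1)
  rw [← setIntegral_eq_integral_of_forall_compl_eq_zero (s := Set.Ioc P Q)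
      (fun x hx => by rw [z' x hx, Complex.ofReal_zero, zero_mul]),
    ← setIntegral_eq_integral_of_forall_compl_eq_zero (s := Set.Ioc P Q)
      (f := fun x => (φ x : ℂ) * G x)
      (fun x hx => by rw [z x hx, Complex.ofReal_zero, zero_mul]), ← key]
  -- Changing the base point from `P` to `1` adds a constant, and `φ'` integrates to zero against
  -- constants.
  have e : ∀ x ∈ Set.Ioc P Q, ((_root_.deriv φ x : ℝ) : ℂ) * ∫ t in (1 : ℝ)..x, G t
      = ((_root_.deriv φ x : ℝ) : ℂ) * (∫ t in Set.Ioc P x, G t)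
        + ((_root_.deriv φ x : ℝ) : ℂ) * ∫ t in (1 : ℝ)..P, G t := by
    intro x hx
    rw [← mul_add, ← intervalIntegral.integral_of_le hx.1.le, add_comm,
      intervalIntegral.integral_add_adjacent_intervals (intervalIntegrable_Ioi hG one_pos hP0)
        (intervalIntegrable_Ioi hG hP0 (hP0.trans hx.1))]
  have i0 : Integrable fun x => ((_root_.deriv φ x : ℝ) : ℂ) * ∫ t in (1 : ℝ)..P, G t :=
    hφ.deriv.integrable_mul ((locallyIntegrable_const _).locallyIntegrableOn _)
  have i1 : Integrable fun x => ((_root_.deriv φ x : ℝ) : ℂ) * ∫ t in (1 : ℝ)..x, G t :=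
    hφ.deriv.integrable_mul ((continuousOn_primitive_Ioi hG).locallyIntegrableOn measurableSet_Ioi)
  have i2 : IntegrableOn (fun x => ((_root_.deriv φ x : ℝ) : ℂ) * ∫ t in Set.Ioc P x, G t)
      (Set.Ioc P Q) := by
    refine (i1.sub i0).integrableOn.congr_fun (fun x hx => ?_) measurableSet_Ioc
    rw [Pi.sub_apply, e x hx, add_sub_cancel_right]
  rw [setIntegral_congr_fun measurableSet_Ioc e, integral_add i2 i0.integrableOn]
  rw [setIntegral_eq_integral_of_forall_compl_eq_zero (s := Set.Ioc P Q)
    (f := fun x => ((_root_.deriv φ x : ℝ) : ℂ) * ∫ t in (1 : ℝ)..P, G t)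
    (fun x hx => by rw [z' x hx, Complex.ofReal_zero, zero_mul]), integral_mul_const,
    integral_complex_ofReal, hφ.integral_deriv]
  simp

/-- A weak solution of `F'' = G` on the half-line agrees almost everywhere with a twofold
primitive of `G`. -/
theorem exists_primitive_of_weak_deriv2 {F G : ℝ → ℂ} (hF : LocallyIntegrableOn F (Set.Ioi 0))
    (hG : LocallyIntegrableOn G (Set.Ioi 0)) (h : ∀ φ, IsHalfLineTest φ →
      ∫ x, ((deriv (deriv φ) x : ℝ) : ℂ) * F x = ∫ x, (φ x : ℂ) * G x) :
    ∃ (K : ℝ → ℂ) (c : ℂ), (∀ x, 0 < x → HasDerivAt K (c + ∫ t in (1 : ℝ)..x, G t) x) ∧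
      ∀ᵐ x, x ∈ Set.Ioi (0 : ℝ) → F x = K x := by
  obtain ⟨ρ, hρ, hρ1⟩ := exists_isHalfLineTest_integral_eq_one
  set P : ℝ → ℂ := fun x => ∫ t in (1 : ℝ)..x, G t with hPdef
  have hPc : ContinuousOn P (Set.Ioi 0) := continuousOn_primitive_Ioi hG
  have hPl : LocallyIntegrableOn P (Set.Ioi 0) := hPc.locallyIntegrableOn measurableSet_Ioi
  set Q : ℝ → ℂ := fun x => ∫ t in (1 : ℝ)..x, P t with hQdef
  have hQc : ContinuousOn Q (Set.Ioi 0) := continuousOn_primitive_Ioi hPl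
  have hQl : LocallyIntegrableOn Q (Set.Ioi 0) := hQc.locallyIntegrableOn measurableSet_Ioi
  have hQd : ∀ x, 0 < x → HasDerivAt Q (P x) x := fun x hx =>
    intervalIntegral.integral_hasDerivAt_right (intervalIntegrable_Ioi hPl one_pos hx)
      (hPc.stronglyMeasurableAtFilter isOpen_Ioi x hx) (hPc.continuousAt (Ioi_mem_nhds hx))
  have hFQ := hF.sub hQl
  have h2 : ∀ φ, IsHalfLineTest φ → ∫ x, ((deriv (deriv φ) x : ℝ) : ℂ) * (F - Q) x = 0 := by
    intro φ hφ
    have e : (fun x => ((deriv (deriv φ) x : ℝ) : ℂ) * (F - Q) x)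
        = fun x => ((deriv (deriv φ) x : ℝ) : ℂ) * F x - ((deriv (deriv φ) x : ℝ) : ℂ) * Q x := by
      ext x; simp [mul_sub]
    rw [e, integral_sub (hφ.deriv.deriv.integrable_mul hF) (hφ.deriv.deriv.integrable_mul hQl),
      h φ hφ, hφ.deriv.integral_deriv_mul_primitive hPl, hφ.integral_deriv_mul_primitive hG]
    simp
  -- `F - Q` has zero weak second derivative, so it should be affine. Pairing `d + c x` with `-ρ'`
  -- returns the slope `c`, since `∫ ρ = 1`.
  set c : ℂ := -∫ x, ((deriv ρ x : ℝ) : ℂ) * (F - Q) x with hc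
  have hlin : LocallyIntegrableOn (fun x : ℝ => c * (x : ℂ)) (Set.Ioi 0) :=
    (by fun_prop : Continuous fun x : ℝ => c * (x : ℂ)).locallyIntegrable.locallyIntegrableOn _
  have hlin' : ∀ ψ, IsHalfLineTest ψ →
      ∫ x, ((deriv ψ x : ℝ) : ℂ) * (c * (x : ℂ)) = -(c * ((∫ x, ψ x : ℝ) : ℂ)) := by
    intro ψ hψ
    have h1 := hψ.integral_deriv_mul_primitive
      ((locallyIntegrable_const c).locallyIntegrableOn (Set.Ioi 0))
    have e : (fun x => ((deriv ψ x : ℝ) : ℂ) * ∫ _ in (1 : ℝ)..x, c)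
        = fun x => ((deriv ψ x : ℝ) : ℂ) * (c * (x : ℂ)) - ((deriv ψ x : ℝ) : ℂ) * c := by
      ext x
      rw [intervalIntegral.integral_const, Complex.real_smul]
      push_cast
      ring
    rw [e, integral_sub (hψ.deriv.integrable_mul hlin)
      (hψ.deriv.integrable_mul ((locallyIntegrable_const c).locallyIntegrableOn _)),
      integral_mul_const, integral_complex_ofReal, hψ.integral_deriv, Complex.ofReal_zero,
      zero_mul, sub_zero, integral_mul_const, integral_complex_ofReal, mul_comm] at h1
    simpa [mul_comm] using h1
  obtain ⟨d, hd⟩ := ae_eq_const_of_weak_deriv_eq_zero (hFQ.sub hlin) fun ψ hψ => by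
    obtain ⟨φ, hφ, hφψ⟩ := (hψ.sub_smul hρ (∫ x, ψ x)).exists_primitive (by
      rw [integral_sub (hψ.contDiff.continuous.integrable_of_hasCompactSupport hψ.hasCompactSupport)
        ((hρ.contDiff.continuous.integrable_of_hasCompactSupport hρ.hasCompactSupport).const_mul _),
        integral_const_mul, hρ1, mul_one, sub_self])
    have h3 := h2 φ hφ
    have e1 : (fun x => ((deriv (deriv φ) x : ℝ) : ℂ) * (F - Q) x)
        = fun x => ((deriv ψ x : ℝ) : ℂ) * (F - Q) x
          - ((∫ x, ψ x : ℝ) : ℂ) * (((deriv ρ x : ℝ) : ℂ) * (F - Q) x) := by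
      ext x
      rw [hφψ, deriv_fun_sub (hψ.contDiff.differentiable (by simp) x)
        ((hρ.contDiff.differentiable (by simp) x).const_mul _),
        deriv_const_mul _ (hρ.contDiff.differentiable (by simp) x)]
      push_cast
      ring
    rw [e1, integral_sub (hψ.deriv.integrable_mul hFQ)
      ((hρ.deriv.integrable_mul hFQ).const_mul _), integral_const_mul] at h3
    have e2 : (fun x => ((deriv ψ x : ℝ) : ℂ) * ((F - Q) - fun x : ℝ => c * (x : ℂ)) x)
        = fun x => ((deriv ψ x : ℝ) : ℂ) * (F - Q) x - ((deriv ψ x : ℝ) : ℂ) * (c * (x : ℂ)) := by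
      ext x; simp [mul_sub]
    rw [e2, integral_sub (hψ.deriv.integrable_mul hFQ) (hψ.deriv.integrable_mul hlin), hlin' ψ hψ,
      hc]
    linear_combination h3
  refine ⟨fun x => d + c * (x : ℂ) + Q x, c, fun x hx => ?_, ?_⟩
  · have h1 : HasDerivAt (fun x : ℝ => c * (x : ℂ)) (c * 1) x :=
      ((hasDerivAt_id x).ofReal_comp).const_mul c
    refine ((h1.const_add d).add (hQd x hx)).congr_deriv ?_
    rw [mul_one]
  · filter_upwards [hd] with x hx hx0
    have := hx hx0
    simp only [Pi.sub_apply] at this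
    linear_combination this

/-- The energy inequality behind the limit point criterion. -/
theorem energy_inequality {F F' F'' : ℝ → ℂ} {θ θ' θ'' : ℝ → ℝ} {p q : ℝ} (hp : 0 < p)
    (hpq : p ≤ q) (hF : ∀ x ∈ Set.Icc p q, HasDerivAt F (F' x) x)
    (hF' : ∀ x ∈ Set.Icc p q, HasDerivAt F' (F'' x) x) (hF'' : ContinuousOn F'' (Set.Icc p q))
    (hθ : ∀ x ∈ Set.Icc p q, HasDerivAt θ (θ' x) x)
    (hθ' : ∀ x ∈ Set.Icc p q, HasDerivAt θ' (θ'' x) x) (hθ'' : ContinuousOn θ'' (Set.Icc p q))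
    (h0 : ∀ x ∈ Set.Icc p q, 0 ≤ θ x) (hθp : θ p = 0) (hθq : θ q = 0) (hθp' : θ' p = 0)
    (hθq' : θ' q = 0) :
    ∫ x in p..q, 2 * (starRingEnd ℂ (F x) * (F'' x - 3 / (4 * x ^ 2) * F x)).re * θ x
      ≤ ∫ x in p..q, ‖F x‖ ^ 2 * (θ'' x - θ' x / x) := by
  have hx0 : ∀ x ∈ Set.Icc p q, 0 < x := fun x hx => hp.trans_le hx.1
  let N : ℝ → ℝ := fun x => (F x).re ^ 2 + (F x).im ^ 2
  let N' : ℝ → ℝ := fun x => 2 * ((F x).re * (F' x).re + (F x).im * (F' x).im)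
  let N'' : ℝ → ℝ := fun x => 2 * ((F' x).re ^ 2 + (F' x).im ^ 2
    + (F x).re * (F'' x).re + (F x).im * (F'' x).im)
  have re : ∀ {K : ℝ → ℂ} {K' : ℂ} {x : ℝ}, HasDerivAt K K' x →
      HasDerivAt (fun x => (K x).re) K'.re x := fun h =>
    Complex.reCLM.hasFDerivAt.comp_hasDerivAt _ h
  have im : ∀ {K : ℝ → ℂ} {K' : ℂ} {x : ℝ}, HasDerivAt K K' x →
      HasDerivAt (fun x => (K x).im) K'.im x := fun h =>
    Complex.imCLM.hasFDerivAt.comp_hasDerivAt _ h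
  have hN : ∀ x ∈ Set.Icc p q, HasDerivAt N (N' x) x := by
    intro x hx
    refine (((re (hF x hx)).pow 2).add ((im (hF x hx)).pow 2)).congr_deriv ?_
    simp only [N']
    push_cast
    ring
  have hN' : ∀ x ∈ Set.Icc p q, HasDerivAt N' (N'' x) x := by
    intro x hx
    refine ((((re (hF x hx)).mul (re (hF' x hx))).add
      ((im (hF x hx)).mul (im (hF' x hx)))).const_mul 2).congr_deriv ?_
    simp only [N'']
    ring
  -- The formal adjoint of `N ↦ N'' + N'/x - N/x²` is `θ ↦ θ'' - θ'/x`, so the difference of the two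
  -- pairings is an exact derivative. Its primitive vanishes at both ends by the boundary conditions
  -- on `θ`.
  let E' : ℝ → ℝ := fun x => (N'' x + N' x / x - N x / x ^ 2) * θ x
    - N x * (θ'' x - θ' x / x)
  have hE : ∀ x ∈ Set.Icc p q,
      HasDerivAt (fun x => (N' x + N x / x) * θ x - N x * θ' x) (E' x) x := by
    intro x hx
    have hne := (hx0 x hx).ne'
    have := (((hN' x hx).add ((hN x hx).div (hasDerivAt_id x) hne)).mul (hθ x hx)).sub
      ((hN x hx).mul (hθ' x hx))
    refine this.congr_deriv ?_
    simp only [E', Pi.add_apply, Pi.div_apply, id]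
    field_simp
    ring
  have cF : ContinuousOn F (Set.Icc p q) := fun x hx => (hF x hx).continuousAt.continuousWithinAt
  have cF' : ContinuousOn F' (Set.Icc p q) :=
    fun x hx => (hF' x hx).continuousAt.continuousWithinAt
  have cN : ContinuousOn N (Set.Icc p q) := fun x hx => (hN x hx).continuousAt.continuousWithinAt
  have cN' : ContinuousOn N' (Set.Icc p q) :=
    fun x hx => (hN' x hx).continuousAt.continuousWithinAt
  have cre : ∀ {K : ℝ → ℂ}, ContinuousOn K (Set.Icc p q) →
      ContinuousOn (fun x => (K x).re) (Set.Icc p q) := fun h =>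
    Complex.continuous_re.comp_continuousOn h
  have cim : ∀ {K : ℝ → ℂ}, ContinuousOn K (Set.Icc p q) →
      ContinuousOn (fun x => (K x).im) (Set.Icc p q) := fun h =>
    Complex.continuous_im.comp_continuousOn h
  have cN'' : ContinuousOn N'' (Set.Icc p q) :=
    continuousOn_const.mul (((((cre cF').pow 2).add ((cim cF').pow 2)).add
      ((cre cF).mul (cre hF''))).add ((cim cF).mul (cim hF'')))
  have cθ : ContinuousOn θ (Set.Icc p q) := fun x hx => (hθ x hx).continuousAt.continuousWithinAt
  have cθ' : ContinuousOn θ' (Set.Icc p q) :=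
    fun x hx => (hθ' x hx).continuousAt.continuousWithinAt
  have cx : ContinuousOn (fun x : ℝ => x) (Set.Icc p q) := continuousOn_id
  have hxne : ∀ x ∈ Set.Icc p q, x ≠ 0 := fun x hx => (hx0 x hx).ne'
  have c1 : ContinuousOn (fun x => (N'' x + N' x / x - N x / x ^ 2) * θ x) (Set.Icc p q) :=
    ((cN''.add (cN'.div cx hxne)).sub (cN.div (cx.pow 2) fun x hx => pow_ne_zero 2 (hxne x hx))).mul
      cθ
  have c2 : ContinuousOn (fun x => N x * (θ'' x - θ' x / x)) (Set.Icc p q) :=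
    cN.mul (hθ''.sub (cθ'.div cx hxne))
  have cast : ∀ x : ℝ, (3 / (4 * (x : ℂ) ^ 2)) = ((3 / (4 * x ^ 2) : ℝ) : ℂ) := by
    intro x; push_cast; ring
  have c3 : ContinuousOn (fun x =>
      2 * (starRingEnd ℂ (F x) * (F'' x - 3 / (4 * x ^ 2) * F x)).re * θ x) (Set.Icc p q) := by
    refine (continuousOn_const.mul (cre ((Complex.continuous_conj.comp_continuousOn cF).mul
      (hF''.sub (ContinuousOn.mul ?_ cF))))).mul cθ
    simp_rw [cast]
    exact Complex.continuous_ofReal.comp_continuousOn (continuousOn_const.div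
      (continuousOn_const.mul (cx.pow 2)) fun x hx => by
        have := hx0 x hx
        positivity)
  have ii : ∀ {g : ℝ → ℝ}, ContinuousOn g (Set.Icc p q) → IntervalIntegrable g volume p q :=
    fun h => h.intervalIntegrable_of_Icc hpq
  have hzero : ∫ x in p..q, E' x = 0 := by
    rw [intervalIntegral.integral_eq_sub_of_hasDerivAt
      (fun x hx => hE x (by rwa [Set.uIcc_of_le hpq] at hx)) (ii (c1.sub c2)),
      hθp, hθq, hθp', hθq']
    simp
  rw [intervalIntegral.integral_sub (ii c1) (ii c2), sub_eq_zero] at hzero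
  have hNn : ∀ x, ‖F x‖ ^ 2 = N x := fun x => by
    rw [Complex.sq_norm, Complex.normSq_apply]
    simp only [N]
    ring
  simp_rw [hNn]
  rw [← hzero]
  refine intervalIntegral.integral_mono_on hpq (ii c3) (ii c1) fun x hx => ?_
  refine mul_le_mul_of_nonneg_right ?_ (h0 x hx)
  have hxp := hx0 x hx
  -- Completing the square: `|F' + F / (2x)|²` vanishes exactly for multiples of the critical
  -- solution `x ^ (-1/2)`, and this fixes the constant `3/4`.
  have e : N'' x + N' x / x - N x / x ^ 2
      = 2 * (starRingEnd ℂ (F x) * (F'' x - 3 / (4 * x ^ 2) * F x)).re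
        + 2 * (((F' x).re + (F x).re / (2 * x)) ^ 2 + ((F' x).im + (F x).im / (2 * x)) ^ 2) := by
    rw [cast]
    simp only [N, N', N'', Complex.mul_re, Complex.sub_re, Complex.sub_im, Complex.conj_re,
      Complex.conj_im, Complex.mul_im, Complex.ofReal_re, Complex.ofReal_im]
    field_simp
    ring
  rw [e]
  have : 0 ≤ ((F' x).re + (F x).re / (2 * x)) ^ 2 + ((F' x).im + (F x).im / (2 * x)) ^ 2 := by
    positivity
  linarith

end HalfLine

/-! ### Smoothing in the second variable -/

section SmoothY

/-- The convolution of `v` with `b` in the second variable. -/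
def smoothY (b : ℝ → ℝ) (v : ℝ × ℝ → ℂ) (p : ℝ × ℝ) : ℂ := ∫ t, b (p.2 - t) • v (p.1, t)

variable {b : ℝ → ℝ} {v : ℝ × ℝ → ℂ}

theorem stronglyMeasurable_smoothY (hb : Continuous b) (hv : StronglyMeasurable v) :
    StronglyMeasurable (smoothY b v) := by
  have h : StronglyMeasurable fun r : (ℝ × ℝ) × ℝ => b (r.1.2 - r.2) • v (r.1.1, r.2) :=
    (hb.comp (by fun_prop : Continuous fun r : (ℝ × ℝ) × ℝ => r.1.2 - r.2)).stronglyMeasurable.smul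
      (hv.comp_measurable (by fun_prop))
  exact h.integral_prod_right'

/-- Cauchy–Schwarz after splitting `|b|` as `|b|^(1/2) · |b|^(1/2)`. -/
theorem enorm_smoothY_sq_le (hb : Continuous b) (hv : StronglyMeasurable v) (p : ℝ × ℝ) :
    ‖smoothY b v p‖ₑ ^ (2 : ℝ)
      ≤ (∫⁻ t, ‖b t‖ₑ) * ∫⁻ t, ‖b (p.2 - t)‖ₑ * ‖v (p.1, t)‖ₑ ^ (2 : ℝ) := by
  have hvm : Measurable fun t => ‖v (p.1, t)‖ₑ :=
    (hv.comp_measurable (by fun_prop : Measurable fun t : ℝ => (p.1, t))).enorm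
  have hbm : Measurable fun t => ‖b (p.2 - t)‖ₑ :=
    (hb.comp (by fun_prop : Continuous fun t : ℝ => p.2 - t)).enorm.measurable
  have h1 : ‖smoothY b v p‖ₑ ≤ ∫⁻ t, (‖b (p.2 - t)‖ₑ ^ (1 / 2 : ℝ))
      * (‖b (p.2 - t)‖ₑ ^ (1 / 2 : ℝ) * ‖v (p.1, t)‖ₑ) := by
    refine (enorm_integral_le_lintegral_enorm _).trans (lintegral_mono fun t => ?_)
    rw [enorm_smul, ← mul_assoc, ← ENNReal.rpow_add_of_nonneg _ _ (by norm_num) (by norm_num)]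
    norm_num
  have h2 := ENNReal.lintegral_mul_le_Lp_mul_Lq volume Real.HolderConjugate.two_two
    (f := fun t => ‖b (p.2 - t)‖ₑ ^ (1 / 2 : ℝ))
    (g := fun t => ‖b (p.2 - t)‖ₑ ^ (1 / 2 : ℝ) * ‖v (p.1, t)‖ₑ)
    (hbm.pow_const _).aemeasurable ((hbm.pow_const _).mul hvm).aemeasurable
  have h3 := ENNReal.rpow_le_rpow (h1.trans h2) (by norm_num : (0 : ℝ) ≤ 2)
  refine h3.trans (le_of_eq ?_)
  rw [ENNReal.mul_rpow_of_nonneg _ _ (by norm_num), ← ENNReal.rpow_mul, ← ENNReal.rpow_mul]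
  simp only [ENNReal.mul_rpow_of_nonneg _ _ (by norm_num : (0 : ℝ) ≤ 2), ← ENNReal.rpow_mul]
  norm_num
  congr 1
  exact lintegral_sub_left_eq_self (fun t => ‖b t‖ₑ) p.2

/-- Young's inequality on each line of constant `x`: integrate the pointwise Cauchy–Schwarz bound
and use Tonelli with translation invariance. -/
theorem memLp_smoothY (hb : Continuous b) (hc : HasCompactSupport b) (hv : StronglyMeasurable v)
    (hv2 : MemLp v 2 volume) : MemLp (smoothY b v) 2 volume := by
  refine ⟨(stronglyMeasurable_smoothY hb hv).aestronglyMeasurable, ?_⟩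
  rw [eLpNorm_lt_top_iff_lintegral_rpow_enorm_lt_top (by norm_num) (by norm_num)]
  have hv3 := (eLpNorm_lt_top_iff_lintegral_rpow_enorm_lt_top (by norm_num) (by norm_num)).1 hv2.2
  simp only [ENNReal.toReal_ofNat] at hv3 ⊢
  have hbi : ∫⁻ t, ‖b t‖ₑ < ⊤ := (hb.integrable_of_hasCompactSupport hc).hasFiniteIntegral
  have hvm : Measurable fun p => ‖v p‖ₑ ^ (2 : ℝ) := hv.enorm.pow_const _
  have hbm : Measurable fun t => ‖b t‖ₑ := hb.enorm.measurable
  refine (lintegral_mono (enorm_smoothY_sq_le hb hv)).trans_lt ?_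
  have hm3 : Measurable fun r : (ℝ × ℝ) × ℝ => ‖b (r.1.2 - r.2)‖ₑ * ‖v (r.1.1, r.2)‖ₑ ^ (2 : ℝ) :=
    (hbm.comp (by fun_prop)).mul (hvm.comp (by fun_prop))
  rw [lintegral_const_mul _ hm3.lintegral_prod_right', Measure.volume_eq_prod,
    lintegral_prod _ hm3.lintegral_prod_right'.aemeasurable]
  have e : ∀ x, ∫⁻ y, ∫⁻ t, ‖b (y - t)‖ₑ * ‖v (x, t)‖ₑ ^ (2 : ℝ)
      = (∫⁻ t, ‖b t‖ₑ) * ∫⁻ t, ‖v (x, t)‖ₑ ^ (2 : ℝ) := by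
    intro x
    rw [lintegral_lintegral_swap]
    · have hvx : Measurable fun t => ‖v (x, t)‖ₑ ^ (2 : ℝ) := hvm.comp (by fun_prop)
      rw [← lintegral_const_mul _ hvx]
      refine lintegral_congr fun t => ?_
      have hbt : Measurable fun y => ‖b (y - t)‖ₑ := hbm.comp (by fun_prop)
      rw [lintegral_mul_const _ hbt,
        lintegral_sub_right_eq_self (fun t => ‖b t‖ₑ) t]
    · exact ((hbm.comp (by fun_prop)).mul (hvm.comp (by fun_prop))).aemeasurable
  simp only [e]
  rw [lintegral_const_mul _ hvm.lintegral_prod_right', ← lintegral_prod _ hvm.aemeasurable,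
    ← Measure.volume_eq_prod]
  exact ENNReal.mul_lt_top hbi (ENNReal.mul_lt_top hbi hv3)

theorem integrable_mul_smoothY (hb : Continuous b) (hc : HasCompactSupport b)
    (hv : LocallyIntegrable v) {c : ℝ → ℂ} (hcc : Continuous c) (hcs : HasCompactSupport c)
    (y : ℝ) : Integrable fun p : ℝ × ℝ => (c p.1 * (b (y - p.2) : ℂ)) * v p := by
  have h1 : Continuous fun p : ℝ × ℝ => c p.1 * (b (y - p.2) : ℂ) :=
    (hcc.comp continuous_fst).mul (Complex.continuous_ofReal.comp
      (hb.comp (continuous_const.sub continuous_snd)))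
  have h2 : HasCompactSupport fun p : ℝ × ℝ => c p.1 * (b (y - p.2) : ℂ) := by
    have hc' : HasCompactSupport fun t => b (y - t) := hc.comp_homeomorph (Homeomorph.subLeft y)
    refine HasCompactSupport.intro (hcs.isCompact.prod hc'.isCompact) fun p hp => ?_
    rw [Set.mem_prod, not_and_or] at hp
    rcases hp with h | h
    · rw [image_eq_zero_of_notMem_tsupport h, zero_mul]
    · have : b (y - p.2) = 0 :=
        image_eq_zero_of_notMem_tsupport (f := fun t => b (y - t)) h
      rw [this, Complex.ofReal_zero, mul_zero]
  simpa only [smul_eq_mul] using hv.integrable_smul_left_of_hasCompactSupport h1 h2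

/-- Fubini: testing `v` against `c(x) b(y - ·)` is testing its smoothing at height `y` against `c`.
A planar weak equation thus becomes an equation in `x` for every `y`. -/
theorem integral_mul_smoothY (hb : Continuous b) (hc : HasCompactSupport b)
    (hv : LocallyIntegrable v) {c : ℝ → ℂ} (hcc : Continuous c) (hcs : HasCompactSupport c)
    (y : ℝ) : ∫ p : ℝ × ℝ, (c p.1 * (b (y - p.2) : ℂ)) * v p = ∫ x, c x * smoothY b v (x, y) := by
  have h := integrable_mul_smoothY hb hc hv hcc hcs y
  rw [Measure.volume_eq_prod] at h ⊢
  rw [integral_prod _ h]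
  refine integral_congr_ae (Filter.Eventually.of_forall fun x => ?_)
  simp only [smoothY, mul_assoc, Complex.real_smul]
  rw [integral_const_mul]

/-- This holds for every `y`, not merely almost every one, since `v` is integrable on the product of
a compact set with the support of `b(y - ·)`. -/
theorem locallyIntegrable_smoothY_left (hb : Continuous b) (hc : HasCompactSupport b)
    (hv : LocallyIntegrable v) (y : ℝ) : LocallyIntegrable fun x => smoothY b v (x, y) := by
  rw [locallyIntegrable_iff]
  intro K hK
  have hc' : HasCompactSupport fun t => b (y - t) := hc.comp_homeomorph (Homeomorph.subLeft y)
  have h1 : IntegrableOn (fun p : ℝ × ℝ => b (y - p.2) • v p) (K ×ˢ tsupport fun t => b (y - t)) :=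
    (hv.integrableOn_isCompact (hK.prod hc'.isCompact)).continuousOn_smul
      (hb.comp (continuous_const.sub continuous_snd)).continuousOn (hK.prod hc'.isCompact)
  have h2 : IntegrableOn (fun p : ℝ × ℝ => b (y - p.2) • v p) (K ×ˢ Set.univ) := by
    refine h1.of_forall_sdiff_eq_zero (hK.measurableSet.prod MeasurableSet.univ) fun p hp => ?_
    have : b (y - p.2) = 0 :=
      image_eq_zero_of_notMem_tsupport (f := fun t => b (y - t)) fun h => hp.2 ⟨hp.1.1, h⟩
    rw [this, zero_smul]
  rw [IntegrableOn, Measure.volume_eq_prod, ← Measure.prod_restrict, Measure.restrict_univ] at h2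
  exact h2.integral_prod_left

theorem hasDerivAt_smoothY (hb : ContDiff ℝ ∞ b) (hc : HasCompactSupport b) {x : ℝ}
    (hv : LocallyIntegrable fun t => v (x, t)) (y : ℝ) :
    HasDerivAt (fun y => smoothY b v (x, y)) (smoothY (deriv b) v (x, y)) y :=
  hc.hasDerivAt_convolution_right (ContinuousLinearMap.lsmul ℝ ℝ (E := ℂ)).flip hv
    (hb.of_le (by simp)) y

theorem ae_memLp_slice {w : ℝ × ℝ → ℂ} (hw : StronglyMeasurable w) (hw2 : MemLp w 2 volume) :
    ∀ᵐ x, MemLp (fun y => w (x, y)) 2 volume := by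
  have h := hw2.integrable_norm_pow (by norm_num)
  rw [Measure.volume_eq_prod] at h
  filter_upwards [h.prod_right_ae] with x hx
  have hm : StronglyMeasurable fun y => w (x, y) :=
    hw.comp_measurable (by fun_prop : Measurable fun y : ℝ => (x, y))
  rw [memLp_two_iff_integrable_sq_norm hm.aestronglyMeasurable]
  simpa using hx

/-- Integrating by parts in `y` gives `-∫ |∂ᵧ w|²`. On almost every slice `w`, `∂ᵧ w` and `∂ᵧ² w`
are square integrable, which leaves no boundary terms at infinity. -/
theorem ae_integral_conj_smoothY_nonpos (hb : ContDiff ℝ ∞ b) (hc : HasCompactSupport b)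
    (hv : StronglyMeasurable v) (hv2 : MemLp v 2 volume) :
    ∀ᵐ x, (∫ y, starRingEnd ℂ (smoothY b v (x, y)) * smoothY (deriv (deriv b)) v (x, y)).re ≤ 0 := by
  have hb' : ContDiff ℝ ∞ (deriv b) := (contDiff_infty_iff_deriv.1 hb).2
  have hb'' : ContDiff ℝ ∞ (deriv (deriv b)) := (contDiff_infty_iff_deriv.1 hb').2
  filter_upwards [ae_memLp_slice hv hv2,
    ae_memLp_slice (stronglyMeasurable_smoothY hb.continuous hv)
      (memLp_smoothY hb.continuous hc hv hv2),
    ae_memLp_slice (stronglyMeasurable_smoothY hb'.continuous hv)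
      (memLp_smoothY hb'.continuous hc.deriv hv hv2),
    ae_memLp_slice (stronglyMeasurable_smoothY hb''.continuous hv)
      (memLp_smoothY hb''.continuous hc.deriv.deriv hv hv2)] with x h h0 h1 h2
  have hl : LocallyIntegrable fun t => v (x, t) := h.locallyIntegrable (by norm_num)
  have hd0 := hasDerivAt_smoothY hb hc hl
  have hd1 := hasDerivAt_smoothY hb' hc.deriv hl
  have hd0' : ∀ y, HasDerivAt (fun y => starRingEnd ℂ (smoothY b v (x, y)))
      (starRingEnd ℂ (smoothY (deriv b) v (x, y))) y := fun y =>
    Complex.conjCLE.toContinuousLinearMap.hasFDerivAt.comp_hasDerivAt y (hd0 y)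
  rw [integral_mul_deriv_eq_deriv_mul_of_integrable (fun y _ => hd0' y) (fun y _ => hd1 y)
    (h0.star.integrable_mul h2) (h1.star.integrable_mul h1) (h0.star.integrable_mul h1)]
  have e : ∀ y, starRingEnd ℂ (smoothY (deriv b) v (x, y)) * smoothY (deriv b) v (x, y)
      = ((‖smoothY (deriv b) v (x, y)‖ ^ 2 : ℝ) : ℂ) := fun y => by
    rw [mul_comm, Complex.mul_conj, Complex.normSq_eq_norm_sq]
  simp only [e]
  rw [integral_complex_ofReal, Complex.neg_re, Complex.ofReal_re, neg_nonpos]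
  exact integral_nonneg fun y => by positivity

/-- A square integrable function all of whose smoothings vanish is zero. -/
theorem ae_eq_zero_of_smoothY (hv : StronglyMeasurable v) (hv2 : MemLp v 2 volume)
    (h : ∀ b : ℝ → ℝ, ContDiff ℝ ∞ b → HasCompactSupport b → smoothY b v =ᵐ[volume] 0) :
    v =ᵐ[volume] 0 := by
  -- A sequence of mollifiers, so that one null set serves them all; the fixed ratio `2` of the
  -- radii is what almost everywhere convergence of the convolutions asks for.
  let φ : ℕ → ContDiffBump (0 : ℝ) := fun n =>
    ⟨1 / (n + 1), 2 / (n + 1), by positivity, by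
      rw [div_lt_div_iff_of_pos_right (by positivity)]; norm_num⟩
  have hφ : Filter.Tendsto (fun n => (φ n).rOut) Filter.atTop (𝓝 0) := by
    have := tendsto_one_div_add_atTop_nhds_zero_nat (𝕜 := ℝ).const_mul 2
    simpa only [φ, mul_one_div, mul_zero] using this
  have hφ' : ∀ᶠ n in Filter.atTop, (φ n).rOut ≤ 2 * (φ n).rIn :=
    Filter.Eventually.of_forall fun n => by simp only [φ]; rw [mul_one_div]
  have h1 : ∀ᵐ p : ℝ × ℝ, ∀ n, smoothY ((φ n).normed volume) v p = 0 :=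
    ae_all_iff.2 fun n => h _ (φ n).contDiff_normed (φ n).hasCompactSupport_normed
  rw [Measure.volume_eq_prod] at h1
  have h2 := Measure.ae_ae_of_ae_prod h1
  have hmeas : MeasurableSet {p : ℝ × ℝ | v p = (0 : ℝ × ℝ → ℂ) p} :=
    measurableSet_eq_fun hv.measurable measurable_const
  rw [Filter.EventuallyEq, Measure.volume_eq_prod, Measure.ae_prod_iff_ae_ae hmeas]
  filter_upwards [h2, ae_memLp_slice hv hv2] with x hx hxv
  have hl : LocallyIntegrable fun t => v (x, t) := hxv.locallyIntegrable (by norm_num)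
  filter_upwards [hx, ContDiffBump.ae_convolution_tendsto_right_of_locallyIntegrable (K := 2)
    hφ hφ' hl] with y hy hlim
  have e : ∀ n, (convolution ((φ n).normed volume) (fun t => v (x, t))
      (ContinuousLinearMap.lsmul ℝ ℝ) volume) y = 0 := by
    intro n
    rw [convolution_eq_swap, ← hy n]
    rfl
  simp only [e] at hlim
  exact (tendsto_nhds_unique hlim tendsto_const_nhds)

end SmoothY

/-! ### A Liouville property -/

section Liouville

/-- Nonnegative `C²` weights on `[p, q]` vanishing to first order at the end points. -/
structure IsEnergyWeight (p q : ℝ) (θ θ' θ'' : ℝ → ℝ) : Prop where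
  pos : 0 < p
  le : p ≤ q
  hasDerivAt : ∀ x ∈ Set.Icc p q, HasDerivAt θ (θ' x) x
  hasDerivAt' : ∀ x ∈ Set.Icc p q, HasDerivAt θ' (θ'' x) x
  continuousOn : ContinuousOn θ'' (Set.Icc p q)
  nonneg : ∀ x ∈ Set.Icc p q, 0 ≤ θ x
  left : θ p = 0
  right : θ q = 0
  left' : θ' p = 0
  right' : θ' q = 0

/-- The cutoff function on the logarithmic scale. -/
def logBump : ContDiffBump (0 : ℝ) := ⟨1, 2, one_pos, one_lt_two⟩

theorem contDiff_logBump : ContDiff ℝ ∞ logBump := logBump.contDiff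

theorem contDiff_deriv_logBump : ContDiff ℝ ∞ (deriv logBump) :=
  (contDiff_infty_iff_deriv.1 contDiff_logBump).2

theorem contDiff_deriv2_logBump : ContDiff ℝ ∞ (deriv (deriv logBump)) :=
  (contDiff_infty_iff_deriv.1 contDiff_deriv_logBump).2

theorem exists_bound_logBump :
    ∃ M, 0 ≤ M ∧ ∀ s, |deriv logBump s| ≤ M ∧ |deriv (deriv logBump) s| ≤ M := by
  obtain ⟨C₁, h₁⟩ := contDiff_deriv_logBump.continuous.bounded_above_of_compact_support
    logBump.hasCompactSupport.deriv
  obtain ⟨C₂, h₂⟩ := contDiff_deriv2_logBump.continuous.bounded_above_of_compact_support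
    logBump.hasCompactSupport.deriv.deriv
  exact ⟨max C₁ C₂, (norm_nonneg _).trans ((h₁ 0).trans (le_max_left _ _)),
    fun y => ⟨(h₁ y).trans (le_max_left _ _), (h₂ y).trans (le_max_right _ _)⟩⟩

theorem logBump_eq_zero {s : ℝ} (hs : 2 < |s|) : logBump s = 0 ∧ deriv logBump s = 0 := by
  have hy : s ∉ tsupport logBump := by
    rw [logBump.tsupport_eq, Metric.mem_closedBall, Real.dist_eq, sub_zero]
    exact not_le.2 hs
  exact ⟨image_eq_zero_of_notMem_tsupport hy,
    image_eq_zero_of_notMem_tsupport fun h' => hy (tsupport_deriv_subset h')⟩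

/-- The weight `x² / (1 + x²)`, cut off at scale `exp (± n)`. -/
def weight (n : ℕ) (x : ℝ) : ℝ := x ^ 2 / (1 + x ^ 2) * logBump (Real.log x / n)

/-- The derivative of `weight n`. -/
def weight' (n : ℕ) (x : ℝ) : ℝ :=
  2 * x / (1 + x ^ 2) ^ 2 * logBump (Real.log x / n)
    + x / (1 + x ^ 2) * (deriv logBump (Real.log x / n) / n)

/-- The second derivative of `weight n`. -/
def weight'' (n : ℕ) (x : ℝ) : ℝ :=
  (2 - 6 * x ^ 2) / (1 + x ^ 2) ^ 3 * logBump (Real.log x / n)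
    + 2 / (1 + x ^ 2) ^ 2 * (deriv logBump (Real.log x / n) / n)
    + (1 - x ^ 2) / (1 + x ^ 2) ^ 2 * (deriv logBump (Real.log x / n) / n)
    + 1 / (1 + x ^ 2) * (deriv (deriv logBump) (Real.log x / n) / n ^ 2)

theorem hasDerivAt_comp_log {K : ℝ → ℝ} (hK : ContDiff ℝ ∞ K) (n : ℕ) {x : ℝ} (hx : 0 < x) :
    HasDerivAt (fun x => K (Real.log x / n)) (deriv K (Real.log x / n) * (x⁻¹ / n)) x :=
  (hK.differentiable (by simp) _).hasDerivAt.comp x ((Real.hasDerivAt_log hx.ne').div_const _)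

theorem hasDerivAt_weight {n : ℕ} (hn : n ≠ 0) {x : ℝ} (hx : 0 < x) :
    HasDerivAt (weight n) (weight' n x) x := by
  have h1 : HasDerivAt (fun x : ℝ => x ^ 2) (2 * x) x := by simpa using hasDerivAt_pow 2 x
  have h2 : (1 + x ^ 2) ≠ 0 := by positivity
  have hn' : (n : ℝ) ≠ 0 := by exact_mod_cast hn
  refine ((h1.div (h1.const_add 1) h2).mul (hasDerivAt_comp_log contDiff_logBump n hx)).congr_deriv ?_
  simp only [weight', Pi.div_apply]
  field_simp
  ring

theorem hasDerivAt_weight' {n : ℕ} (hn : n ≠ 0) {x : ℝ} (hx : 0 < x) :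
    HasDerivAt (weight' n) (weight'' n x) x := by
  have h1 : HasDerivAt (fun x : ℝ => 1 + x ^ 2) (2 * x) x := by
    simpa using (hasDerivAt_pow 2 x).const_add 1
  have h2 : (1 + x ^ 2) ≠ 0 := by positivity
  have hn' : (n : ℝ) ≠ 0 := by exact_mod_cast hn
  have h3 := ((((hasDerivAt_id x).const_mul 2).div (h1.pow 2) (pow_ne_zero 2 h2)).mul
    (hasDerivAt_comp_log contDiff_logBump n hx)).add (((hasDerivAt_id x).div h1 h2).mul
      ((hasDerivAt_comp_log contDiff_deriv_logBump n hx).div_const (n : ℝ)))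
  refine h3.congr_deriv ?_
  simp only [weight'', Pi.div_apply, Pi.pow_apply, id]
  field_simp
  ring

theorem isEnergyWeight_weight {n : ℕ} (hn : n ≠ 0) :
    IsEnergyWeight (Real.exp (-(3 * n))) (Real.exp (3 * n)) (weight n) (weight' n) (weight'' n) := by
  have hn' : (n : ℝ) ≠ 0 := by exact_mod_cast hn
  have hpos : ∀ x ∈ Set.Icc (Real.exp (-(3 * n))) (Real.exp (3 * n)), 0 < x := fun x hx =>
    (Real.exp_pos _).trans_le hx.1
  -- The log cutoff is supported in `[-2, 2]`, so at `± 3` it vanishes together with its derivative.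
  have e1 : Real.log (Real.exp (-(3 * n))) / n = -3 := by
    rw [Real.log_exp]; field_simp
  have e2 : Real.log (Real.exp (3 * n)) / n = 3 := by
    rw [Real.log_exp]; field_simp
  have z1 := logBump_eq_zero (s := -3) (by norm_num)
  have z2 := logBump_eq_zero (s := 3) (by norm_num)
  refine ⟨Real.exp_pos _, Real.exp_le_exp.2 (by
      have : (0 : ℝ) ≤ n := Nat.cast_nonneg n
      linarith),
    fun x hx => hasDerivAt_weight hn (hpos x hx),
    fun x hx => hasDerivAt_weight' hn (hpos x hx), ?_, fun x _ => ?_, ?_, ?_, ?_, ?_⟩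
  · have hlog : ∀ {K : ℝ → ℝ}, ContDiff ℝ ∞ K → ContinuousOn (fun x => K (Real.log x / n))
        (Set.Icc (Real.exp (-(3 * n))) (Real.exp (3 * n))) := fun hK x hx =>
      (hasDerivAt_comp_log hK n (hpos x hx)).continuousAt.continuousWithinAt
    have hr : ∀ (a : ℝ → ℝ) (k : ℕ), Continuous a → ContinuousOn (fun x => a x / (1 + x ^ 2) ^ k)
        (Set.Icc (Real.exp (-(3 * n))) (Real.exp (3 * n))) := fun a k ha =>
      (ha.div (by fun_prop) fun x => by positivity).continuousOn
    have hr1 := hr (fun _ => 1) 1 continuous_const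
    simp only [pow_one] at hr1
    exact ((((hr (fun x => 2 - 6 * x ^ 2) 3 (by fun_prop)).mul (hlog contDiff_logBump)).add
      ((hr (fun _ => 2) 2 continuous_const).mul
        ((hlog contDiff_deriv_logBump).div_const _))).add
      ((hr (fun x => 1 - x ^ 2) 2 (by fun_prop)).mul
        ((hlog contDiff_deriv_logBump).div_const _))).add
      (hr1.mul ((hlog contDiff_deriv2_logBump).div_const _))
  · exact mul_nonneg (by positivity) logBump.nonneg
  · rw [weight, e1, z1.1, mul_zero]
  · rw [weight, e2, z2.1, mul_zero]
  · rw [weight', e1, z1.1, z1.2]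
    simp
  · rw [weight', e2, z2.1, z2.2]
    simp

/-- `θ = x² / (1 + x²)` satisfies `θ'' - θ'/x = -8 x² / (1 + x²)³`. Each derivative of the cutoff
brings a factor `1 / (n x)`, whose singularity is absorbed by the weight, so the error is `O(1/n)`
uniformly in `x`. -/
theorem weight_operator_le {M : ℝ} (hM : 0 ≤ M)
    (hb : ∀ s, |deriv logBump s| ≤ M ∧ |deriv (deriv logBump) s| ≤ M) {n : ℕ} (hn : n ≠ 0)
    {x : ℝ} (hx : 0 < x) :
    weight'' n x - weight' n x / x
      ≤ -(8 * x ^ 2 / (1 + x ^ 2) ^ 3 * logBump (Real.log x / n)) + 5 * M / n := by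
  have hn1 : (1 : ℝ) ≤ n := by exact_mod_cast Nat.one_le_iff_ne_zero.2 hn
  have hn0 : (0 : ℝ) < n := by linarith
  obtain ⟨h1, h2⟩ := hb (Real.log x / n)
  set k0 := logBump (Real.log x / n)
  set k1 := deriv logBump (Real.log x / n) with hk1
  set k2 := deriv (deriv logBump) (Real.log x / n) with hk2
  have hX : 0 < 1 + x ^ 2 := by positivity
  have e : weight'' n x - weight' n x / x = -(8 * x ^ 2 / (1 + x ^ 2) ^ 3 * k0)
      + (2 - 2 * x ^ 2) / (1 + x ^ 2) ^ 2 * (k1 / n) + 1 / (1 + x ^ 2) * (k2 / n ^ 2) := by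
    simp only [weight'', weight']
    rw [← hk1, ← hk2]
    field_simp
    ring
  have b1 : |k1 / n| ≤ M / n := by
    rw [abs_div, abs_of_pos hn0]
    exact div_le_div_of_nonneg_right h1 hn0.le
  have b2 : |k2 / n ^ 2| ≤ M / n := by
    rw [abs_div, abs_of_pos (pow_pos hn0 2)]
    refine div_le_div₀ hM h2 hn0 ?_
    nlinarith
  have c1 : |(2 - 2 * x ^ 2) / (1 + x ^ 2) ^ 2| ≤ 4 := by
    rw [abs_le, le_div_iff₀ (by positivity), div_le_iff₀ (by positivity)]
    constructor <;> nlinarith [sq_nonneg x, sq_nonneg (x ^ 2)]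
  have c2 : |1 / (1 + x ^ 2)| ≤ 1 := by
    rw [abs_of_pos (by positivity), div_le_one hX]
    nlinarith [sq_nonneg x]
  have d1 : (2 - 2 * x ^ 2) / (1 + x ^ 2) ^ 2 * (k1 / n) ≤ 4 * (M / n) := by
    refine (le_abs_self _).trans ?_
    rw [abs_mul]
    exact mul_le_mul c1 b1 (abs_nonneg _) (by norm_num)
  have d2 : 1 / (1 + x ^ 2) * (k2 / n ^ 2) ≤ 1 * (M / n) := by
    refine (le_abs_self _).trans ?_
    rw [abs_mul]
    exact mul_le_mul c2 b2 (abs_nonneg _) (by norm_num)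
  have : 5 * M / n = 4 * (M / n) + 1 * (M / n) := by ring
  linarith

theorem measurableSet_strip (p q : ℝ) : MeasurableSet (Set.Ioc p q ×ˢ (Set.univ : Set ℝ)) :=
  measurableSet_Ioc.prod MeasurableSet.univ

theorem integrableOn_strip_mul {g : ℝ × ℝ → ℝ} (hg : Integrable g) {p q : ℝ} {k : ℝ → ℝ}
    (hk : ContinuousOn k (Set.Icc p q)) :
    IntegrableOn (fun r => g r * k r.1) (Set.Ioc p q ×ˢ Set.univ) := by
  obtain ⟨C, hC⟩ := isCompact_Icc.exists_bound_of_continuousOn hk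
  have hm : AEStronglyMeasurable (fun r : ℝ × ℝ => k r.1)
      (volume.restrict (Set.Ioc p q ×ˢ Set.univ)) :=
    (hk.comp continuousOn_fst fun r hr => Set.Ioc_subset_Icc_self hr.1).aestronglyMeasurable
      (measurableSet_strip _ _)
  exact hg.integrableOn.mul_bdd (c := C) hm (ae_restrict_of_forall_mem
    (measurableSet_strip _ _) fun r hr => hC _ (Set.Ioc_subset_Icc_self hr.1))

theorem IsEnergyWeight.continuousOn_operator {p q : ℝ} {θ θ' θ'' : ℝ → ℝ}
    (hθ : IsEnergyWeight p q θ θ' θ'') :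
    ContinuousOn (fun x => θ'' x - θ' x / x) (Set.Icc p q) :=
  hθ.continuousOn.sub (ContinuousOn.div
    (fun x hx => (hθ.hasDerivAt' x hx).continuousAt.continuousWithinAt) continuousOn_id
    fun _ hx => (hθ.pos.trans_le hx.1).ne')

/-- Inserting `weight n` bounds the integral of `g` times a positive density by `5 M (∫ g) / n`,
over any region where the cutoff is already `1`; then `n → ∞`. -/
theorem ae_eq_zero_of_energy {g : ℝ × ℝ → ℝ} (hg : Integrable g) (h0 : ∀ r, 0 ≤ g r)
    (h : ∀ p q θ θ' θ'', IsEnergyWeight p q θ θ' θ'' →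
      0 ≤ ∫ r in Set.Ioc p q ×ˢ Set.univ, g r * (θ'' r.1 - θ' r.1 / r.1)) :
    ∀ᵐ r : ℝ × ℝ, r ∈ halfPlane → g r = 0 := by
  obtain ⟨M, hM, hb⟩ := exists_bound_logBump
  set W := ∫ r, g r with hW
  let d : ℝ × ℝ → ℝ := fun r => 8 * r.1 ^ 2 / (1 + r.1 ^ 2) ^ 3
  have hd0 : ∀ r, 0 ≤ d r := fun r => by simp only [d]; positivity
  have hdc : Continuous d := Continuous.div (by fun_prop) (by fun_prop) fun r => by positivity
  have hd8 : ∀ r, ‖d r‖ ≤ 8 := fun r => by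
    rw [Real.norm_of_nonneg (hd0 r)]
    simp only [d]
    rw [div_le_iff₀ (by positivity)]
    nlinarith [sq_nonneg r.1, sq_nonneg (r.1 ^ 2), sq_nonneg (r.1 ^ 3)]
  have hgd : Integrable fun r => g r * d r :=
    hg.mul_bdd (c := 8) hdc.aestronglyMeasurable (Filter.Eventually.of_forall hd8)
  -- The strip is fixed by `m`; for `n ≥ m` one has `|log x / n| ≤ 1` on it, so the cutoff equals
  -- `1` there.
  have key : ∀ m n : ℕ, n ≠ 0 → m ≤ n →
      ∫ r in Set.Ioc (Real.exp (-m)) (Real.exp m) ×ˢ Set.univ, g r * d r ≤ 5 * M * W / n := by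
    intro m n hn hmn
    have hw := isEnergyWeight_weight hn
    have hn0 : (0 : ℝ) < n := by exact_mod_cast Nat.pos_of_ne_zero hn
    have hmn' : (m : ℝ) ≤ n := by exact_mod_cast hmn
    set S := Set.Ioc (Real.exp (-(3 * n : ℝ))) (Real.exp (3 * n)) ×ˢ (Set.univ : Set ℝ) with hS
    set T := Set.Ioc (Real.exp (-m)) (Real.exp m) ×ˢ (Set.univ : Set ℝ) with hT
    have hTS : T ⊆ S := Set.prod_mono (Set.Ioc_subset_Ioc
      (Real.exp_le_exp.2 (by linarith)) (Real.exp_le_exp.2 (by linarith))) subset_rfl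
    let k : ℝ × ℝ → ℝ := fun r => logBump (Real.log r.1 / n)
    have hkm : Measurable k :=
      contDiff_logBump.continuous.measurable.comp ((Real.measurable_log.comp measurable_fst).div_const _)
    have hgdk : Integrable fun r => g r * d r * k r :=
      hgd.mul_bdd (c := 1) hkm.aestronglyMeasurable (Filter.Eventually.of_forall fun r => by
        rw [Real.norm_of_nonneg logBump.nonneg]
        exact logBump.le_one)
    have hTk : ∫ r in T, g r * d r = ∫ r in T, g r * d r * k r := by
      refine setIntegral_congr_fun (measurableSet_strip _ _) fun r hr => ?_
      have hr1 := hr.1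
      have hr0 : 0 < r.1 := (Real.exp_pos _).trans hr1.1
      have : k r = 1 := by
        refine logBump.one_of_mem_closedBall ?_
        rw [Metric.mem_closedBall, Real.dist_eq, sub_zero, abs_div, abs_of_pos hn0,
          div_le_iff₀ hn0]
        change _ ≤ 1 * (n : ℝ)
        rw [one_mul, abs_le]
        have l1 := (Real.le_log_iff_exp_le hr0).2 hr1.1.le
        have l2 := (Real.log_le_iff_le_exp hr0).2 hr1.2
        constructor <;> linarith
      simp only [this, mul_one]
    have hpt : ∀ r ∈ S, g r * (weight'' n r.1 - weight' n r.1 / r.1)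
        ≤ -(g r * d r * k r) + 5 * M / n * g r := by
      intro r hr
      have hr0 : 0 < r.1 := (Real.exp_pos _).trans hr.1.1
      have := mul_le_mul_of_nonneg_left (weight_operator_le hM hb hn hr0) (h0 r)
      refine this.trans (le_of_eq ?_)
      simp only [d, k]
      ring
    have hint : IntegrableOn (fun r => g r * (weight'' n r.1 - weight' n r.1 / r.1)) S :=
      integrableOn_strip_mul hg hw.continuousOn_operator
    have hneg : Integrable fun r => -(g r * d r * k r) := hgdk.neg
    have hcg : Integrable fun r => 5 * M / n * g r := hg.const_mul _
    have h1 : 0 ≤ ∫ r in S, (-(g r * d r * k r) + 5 * M / n * g r) :=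
      (h _ _ _ _ _ hw).trans (setIntegral_mono_on hint (hneg.add hcg).integrableOn
        (measurableSet_strip _ _) hpt)
    have h2 : ∫ r in S, (-(g r * d r * k r) + 5 * M / n * g r)
        = -(∫ r in S, g r * d r * k r) + 5 * M / n * ∫ r in S, g r := by
      rw [integral_add hneg.integrableOn hcg.integrableOn, integral_neg,
        integral_const_mul]
    have h3 : ∫ r in T, g r * d r * k r ≤ ∫ r in S, g r * d r * k r :=
      setIntegral_mono_set hgdk.integrableOn (Filter.Eventually.of_forall fun r =>
        mul_nonneg (mul_nonneg (h0 r) (hd0 r)) logBump.nonneg) (Filter.Eventually.of_forall hTS)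
    have h4 : ∫ r in S, g r ≤ W :=
      setIntegral_le_integral hg (Filter.Eventually.of_forall h0)
    have h5 : 5 * M / n * ∫ r in S, g r ≤ 5 * M / n * W :=
      mul_le_mul_of_nonneg_left h4 (by positivity)
    rw [hTk]
    have h6 : 0 ≤ -(∫ r in S, g r * d r * k r) + 5 * M / n * ∫ r in S, g r := h2 ▸ h1
    have h7 : 5 * M * W / n = 5 * M / n * W := by ring
    linarith
  have hT0 : ∀ m : ℕ, ∀ᵐ r : ℝ × ℝ, r ∈ Set.Ioc (Real.exp (-m)) (Real.exp m) ×ˢ (Set.univ : Set ℝ) →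
      g r * d r = 0 := by
    intro m
    have hle : ∫ r in Set.Ioc (Real.exp (-m)) (Real.exp m) ×ˢ Set.univ, g r * d r ≤ 0 := by
      refine ge_of_tendsto (tendsto_const_div_atTop_nhds_zero_nat (5 * M * W)) ?_
      filter_upwards [Filter.eventually_ge_atTop (m + 1)] with n hn
      exact key m n (by omega) (by omega)
    have hnn : ∀ r, 0 ≤ g r * d r := fun r => mul_nonneg (h0 r) (hd0 r)
    have := (setIntegral_eq_zero_iff_of_nonneg_ae (Filter.Eventually.of_forall hnn)
      hgd.integrableOn).1 (le_antisymm hle (integral_nonneg hnn))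
    rw [Filter.EventuallyEq, ae_restrict_iff' (measurableSet_strip _ _)] at this
    exact this
  filter_upwards [ae_all_iff.2 hT0] with r hr hr0
  have hr0 : 0 < r.1 := hr0
  obtain ⟨m, hm⟩ := exists_nat_gt |Real.log r.1|
  rw [abs_lt] at hm
  have := hr m ⟨⟨(Real.lt_log_iff_exp_lt hr0).1 hm.1, ((Real.log_lt_iff_lt_exp hr0).1 hm.2).le⟩,
    Set.mem_univ _⟩
  refine (mul_eq_zero.1 this).resolve_right ?_
  simp only [d]
  positivity

end Liouville

/-! ### The energy inequality for the regularised functions -/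

section Energy

/-- Up to null sets `w` is a classical solution of `K'' = A K - B K₂`. In the energy inequality the
part of `Re A` above `3 / (4 x²)` has a favourable sign and is dropped, leaving only the coupling to
`w₂`. -/
theorem energy_inequality_of_weak_equation {A : ℝ → ℂ} {B : ℝ → ℝ} {w w₂ K₂ : ℝ → ℂ}
    (hA : ContinuousOn A (Set.Ioi 0)) (hB : ContinuousOn B (Set.Ioi 0))
    (hA0 : ∀ x, 0 < x → 3 / (4 * x ^ 2) ≤ (A x).re)
    (hw : LocallyIntegrableOn w (Set.Ioi 0)) (hw₂ : LocallyIntegrableOn w₂ (Set.Ioi 0))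
    (hK₂ : ContinuousOn K₂ (Set.Ioi 0)) (hwK₂ : ∀ᵐ x, x ∈ Set.Ioi (0 : ℝ) → w₂ x = K₂ x)
    (h : ∀ φ, IsHalfLineTest φ →
      ∫ x, ((deriv (deriv φ) x : ℝ) : ℂ) * w x = ∫ x, (φ x : ℂ) * (A x * w x - B x * w₂ x))
    {p q : ℝ} {θ θ' θ'' : ℝ → ℝ} (hθ : IsEnergyWeight p q θ θ' θ'') :
    ∫ x in Set.Ioc p q, (starRingEnd ℂ (w x) * w₂ x).re * (-2 * B x * θ x)
      ≤ ∫ x in Set.Ioc p q, ‖w x‖ ^ 2 * (θ'' x - θ' x / x) := by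
  have hBc : ContinuousOn (fun x => (B x : ℂ)) (Set.Ioi 0) :=
    Complex.continuous_ofReal.comp_continuousOn hB
  have hlc : IsLocallyClosed (Set.Ioi (0 : ℝ)) := isOpen_Ioi.isLocallyClosed
  obtain ⟨K, c, hK, hwK⟩ := exists_primitive_of_weak_deriv2 hw
    ((hw.continuousOn_mul hA hlc).sub (hw₂.continuousOn_mul hBc hlc)) h
  have hKc : ContinuousOn K (Set.Ioi 0) := fun x hx => (hK x hx).continuousAt.continuousWithinAt
  -- Replacing `w` and `w₂` by continuous representatives makes the right-hand side continuous, so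
  -- that `K` is genuinely twice differentiable.
  set F'' : ℝ → ℂ := fun x => A x * K x - B x * K₂ x with hF''
  have hF''c : ContinuousOn F'' (Set.Ioi 0) := (hA.mul hKc).sub (hBc.mul hK₂)
  have hK' : ∀ x, 0 < x → HasDerivAt K (c + ∫ t in (1 : ℝ)..x, F'' t) x := by
    intro x hx
    refine (hK x hx).congr_deriv ?_
    congr 1
    refine intervalIntegral.integral_congr_ae ?_
    filter_upwards [hwK, hwK₂] with t h1 h2 ht
    have ht0 : t ∈ Set.Ioi (0 : ℝ) := (lt_min one_pos hx).trans ht.1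
    simp only [Pi.sub_apply, h1 ht0, h2 ht0, hF'']
  have hK'' : ∀ x, 0 < x → HasDerivAt (fun x => c + ∫ t in (1 : ℝ)..x, F'' t) (F'' x) x := by
    intro x hx
    refine HasDerivAt.const_add _ ?_
    exact intervalIntegral.integral_hasDerivAt_right
      (intervalIntegrable_Ioi (hF''c.locallyIntegrableOn measurableSet_Ioi) one_pos hx)
      (hF''c.stronglyMeasurableAtFilter isOpen_Ioi x hx) (hF''c.continuousAt (Ioi_mem_nhds hx))
  have hsub : Set.Icc p q ⊆ Set.Ioi 0 := fun x hx => hθ.pos.trans_le hx.1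
  have hE := energy_inequality hθ.pos hθ.le (fun x hx => hK' x (hsub hx))
    (fun x hx => hK'' x (hsub hx)) (hF''c.mono hsub) hθ.hasDerivAt hθ.hasDerivAt' hθ.continuousOn
    hθ.nonneg hθ.left hθ.right hθ.left' hθ.right'
  have hθc : ContinuousOn θ (Set.Icc p q) := fun x hx =>
    (hθ.hasDerivAt x hx).continuousAt.continuousWithinAt
  have hcK : ContinuousOn (fun x => starRingEnd ℂ (K x)) (Set.Icc p q) :=
    Complex.continuous_conj.comp_continuousOn (hKc.mono hsub)
  have hx2 : ContinuousOn (fun x : ℝ => (3 / (4 * (x : ℂ) ^ 2))) (Set.Icc p q) := by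
    refine ContinuousOn.div continuousOn_const (by fun_prop) fun x hx => ?_
    have : (x : ℂ) ≠ 0 := by exact_mod_cast (ne_of_gt (hsub hx))
    simpa using this
  have hmono : ∫ x in p..q, (starRingEnd ℂ (K x) * K₂ x).re * (-2 * B x * θ x)
      ≤ ∫ x in p..q, 2 * (starRingEnd ℂ (K x) * (F'' x - 3 / (4 * x ^ 2) * K x)).re * θ x := by
    refine intervalIntegral.integral_mono_on hθ.le ?_ ?_ fun x hx => ?_
    · refine ContinuousOn.intervalIntegrable_of_Icc hθ.le (ContinuousOn.mul ?_ ?_)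
      · exact Complex.continuous_re.comp_continuousOn (hcK.mul (hK₂.mono hsub))
      · exact (continuousOn_const.mul (hB.mono hsub)).mul hθc
    · refine ContinuousOn.intervalIntegrable_of_Icc hθ.le (ContinuousOn.mul ?_ hθc)
      refine continuousOn_const.mul (Complex.continuous_re.comp_continuousOn (hcK.mul ?_))
      exact (hF''c.mono hsub).sub (hx2.mul (hKc.mono hsub))
    · have e : (starRingEnd ℂ (K x) * (F'' x - 3 / (4 * x ^ 2) * K x)).re
          = ((A x).re - 3 / (4 * x ^ 2)) * ‖K x‖ ^ 2 - B x * (starRingEnd ℂ (K x) * K₂ x).re := by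
        have e1 : starRingEnd ℂ (K x) * (F'' x - 3 / (4 * x ^ 2) * K x)
            = (A x - ((3 / (4 * x ^ 2) : ℝ) : ℂ)) * (K x * starRingEnd ℂ (K x))
              - (B x : ℂ) * (starRingEnd ℂ (K x) * K₂ x) := by
          simp only [hF'']
          push_cast
          ring
        rw [e1, Complex.mul_conj, Complex.sub_re, Complex.re_mul_ofReal, Complex.re_ofReal_mul,
          Complex.sub_re, Complex.ofReal_re, Complex.normSq_eq_norm_sq]
      have h1 : 0 ≤ ((A x).re - 3 / (4 * x ^ 2)) * ‖K x‖ ^ 2 * θ x :=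
        mul_nonneg (mul_nonneg (sub_nonneg.2 (hA0 x (hsub hx))) (sq_nonneg _)) (hθ.nonneg x hx)
      rw [e]
      linarith
  have hfin := hmono.trans hE
  rw [intervalIntegral.integral_of_le hθ.le, intervalIntegral.integral_of_le hθ.le] at hfin
  rw [setIntegral_congr_ae (g := fun x => (starRingEnd ℂ (K x) * K₂ x).re * (-2 * B x * θ x))
    measurableSet_Ioc, setIntegral_congr_ae (f := fun x => ‖w x‖ ^ 2 * (θ'' x - θ' x / x))
    (g := fun x => ‖K x‖ ^ 2 * (θ'' x - θ' x / x)) measurableSet_Ioc]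
  · exact hfin
  · filter_upwards [hwK] with x h1 hx
    rw [h1 (hsub (Set.Ioc_subset_Icc_self hx))]
  · filter_upwards [hwK, hwK₂] with x h1 h2 hx
    rw [h1 (hsub (Set.Ioc_subset_Icc_self hx)), h2 (hsub (Set.Ioc_subset_Icc_self hx))]

theorem volume_restrict_strip (p q : ℝ) :
    (volume : Measure (ℝ × ℝ)).restrict (Set.Ioc p q ×ˢ Set.univ)
      = (volume.restrict (Set.Ioc p q)).prod volume := by
  rw [Measure.volume_eq_prod, ← Measure.prod_restrict, Measure.restrict_univ]

/-- The two sides are integrated in opposite orders: `y` first on the left, where `Re ∫ conj w · w₂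
dy ≤ 0` meets the factor `-2 B θ ≤ 0`, and `x` first for the comparison `h`, available for every
`y`. -/
theorem energy_nonneg {B : ℝ → ℝ} {w w₂ : ℝ × ℝ → ℂ}
    (hB : ContinuousOn B (Set.Ioi 0)) (hB0 : ∀ x, 0 < x → 0 ≤ B x)
    (hw : MemLp w 2 volume) (hw₂ : MemLp w₂ 2 volume)
    (hneg : ∀ᵐ x, (∫ y, starRingEnd ℂ (w (x, y)) * w₂ (x, y)).re ≤ 0)
    {p q : ℝ} {θ θ' θ'' : ℝ → ℝ} (hθ : IsEnergyWeight p q θ θ' θ'')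
    (h : ∀ y, ∫ x in Set.Ioc p q, (starRingEnd ℂ (w (x, y)) * w₂ (x, y)).re * (-2 * B x * θ x)
      ≤ ∫ x in Set.Ioc p q, ‖w (x, y)‖ ^ 2 * (θ'' x - θ' x / x)) :
    0 ≤ ∫ r in Set.Ioc p q ×ˢ Set.univ, ‖w r‖ ^ 2 * (θ'' r.1 - θ' r.1 / r.1) := by
  have hsub : Set.Icc p q ⊆ Set.Ioi 0 := fun x hx => hθ.pos.trans_le hx.1
  have hP : Integrable fun r => starRingEnd ℂ (w r) * w₂ r := integrable_conj_mul hw hw₂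
  have hk : ContinuousOn (fun x => -2 * B x * θ x) (Set.Icc p q) :=
    (continuousOn_const.mul (hB.mono hsub)).mul fun x hx =>
      (hθ.hasDerivAt x hx).continuousAt.continuousWithinAt
  have i1 := integrableOn_strip_mul hP.re hk
  have i2 := integrableOn_strip_mul (hw.integrable_norm_pow (by norm_num))
    hθ.continuousOn_operator
  simp only [RCLike.re_to_complex] at i1
  rw [IntegrableOn, volume_restrict_strip] at i1 i2
  have l1 : 0 ≤ ∫ r in Set.Ioc p q ×ˢ Set.univ,
      (starRingEnd ℂ (w r) * w₂ r).re * (-2 * B r.1 * θ r.1) := by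
    rw [volume_restrict_strip, integral_prod _ i1]
    refine integral_nonneg_of_ae ?_
    have hP' := hP
    rw [Measure.volume_eq_prod] at hP'
    filter_upwards [ae_restrict_of_ae hneg, ae_restrict_mem measurableSet_Ioc,
      ae_restrict_of_ae hP'.prod_right_ae] with x hx hxm hxi
    have hx' := Set.Ioc_subset_Icc_self hxm
    change 0 ≤ ∫ y, (starRingEnd ℂ (w (x, y)) * w₂ (x, y)).re * (-2 * B x * θ x)
    have e := integral_re hxi
    simp only [RCLike.re_to_complex] at e
    rw [integral_mul_const, e]
    have := mul_nonneg (hB0 x (hsub hx')) (hθ.nonneg x hx')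
    nlinarith
  refine l1.trans ?_
  rw [volume_restrict_strip, integral_prod_symm _ i1, integral_prod_symm _ i2]
  exact integral_mono i1.integral_prod_right i2.integral_prod_right h

end Energy

/-! ### Essential self-adjointness -/

section EssentialSelfAdjointness

variable {f : ℝ → ℝ}

/-- The function `√f · conj u`, extended by zero to the plane; complex conjugation of this
transforms the Hamiltonian into `-∂ₓ² - f⁻² ∂ᵧ² + potential f` in the flat `L²` space. -/
def flatConj (f : ℝ → ℝ) (u : ℝ × ℝ → ℂ) : ℝ × ℝ → ℂ :=
  (halfPlane : Set (ℝ × ℝ)).indicator fun p => (√(f p.1) : ℂ) * starRingEnd ℂ (u p)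

theorem flatConj_of_mem {u : ℝ × ℝ → ℂ} {p : ℝ × ℝ} (hp : p ∈ halfPlane) :
    flatConj f u p = (√(f p.1) : ℂ) * starRingEnd ℂ (u p) :=
  Set.indicator_of_mem (s := (halfPlane : Set (ℝ × ℝ))) hp _

theorem stronglyMeasurable_flatConj (hf : IsGrushinProfile f) {u : ℝ × ℝ → ℂ}
    (hu : StronglyMeasurable u) : StronglyMeasurable (flatConj f u) := by
  refine StronglyMeasurable.indicator ?_ halfPlane.isOpen.measurableSet
  refine StronglyMeasurable.mul ?_ (Complex.continuous_conj.comp_stronglyMeasurable hu)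
  exact (Complex.measurable_ofReal.comp
    (Real.continuous_sqrt.measurable.comp (hf.measurable.comp measurable_fst))).stronglyMeasurable

/-- `|√f u|² dx dy = |u|² dμ_f` on the half-plane. -/
theorem memLp_flatConj (hf : IsGrushinProfile f) {u : ℝ × ℝ → ℂ} (hu : StronglyMeasurable u)
    (hu2 : MemLp u 2 (grushinMeasure f)) : MemLp (flatConj f u) 2 volume := by
  rw [memLp_two_iff_integrable_sq_norm
    (stronglyMeasurable_flatConj hf hu).aestronglyMeasurable]
  have h := hu2.integrable_norm_pow (by norm_num)
  rw [grushinMeasure, volMeasure, integrable_withDensity_iff_integrable_smul'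
    (measurable_volDensity hf) (by simp)] at h
  rw [← IntegrableOn, ← integrable_indicator_iff halfPlane.isOpen.measurableSet] at h
  refine h.congr (Filter.Eventually.of_forall fun p => ?_)
  by_cases hp : p ∈ (halfPlane : Set (ℝ × ℝ))
  · have h0 := hf.pos p.1 (ne_of_gt hp)
    simp only [flatConj, Set.indicator_of_mem hp, volDensity_metric, norm_mul, mul_pow,
      Complex.norm_real, RCLike.norm_conj, Real.norm_eq_abs, sq_abs, Real.sq_sqrt h0.le,
      ENNReal.toReal_ofReal (abs_nonneg _), abs_of_pos h0, smul_eq_mul]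
  · simp [flatConj, Set.indicator_of_notMem hp]

theorem IsHalfLineTest.contDiff_mul {a g : ℝ → ℝ} (ha : IsHalfLineTest a)
    (hg : ∀ x, 0 < x → ContDiffAt ℝ ∞ g x) : ContDiff ℝ ∞ fun x => g x * a x := by
  rw [contDiff_iff_contDiffAt]
  intro x
  by_cases hx : x ∈ tsupport a
  · exact (hg x (ha.tsupport_subset hx)).mul ha.contDiff.contDiffAt
  · refine contDiffAt_const (c := (0 : ℝ)) |>.congr_of_eventuallyEq ?_
    filter_upwards [(isClosed_tsupport a).isOpen_compl.mem_nhds hx] with t ht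
    rw [image_eq_zero_of_notMem_tsupport ht, mul_zero]

theorem IsHalfLineTest.continuous_mul {a : ℝ → ℝ} (ha : IsHalfLineTest a) {g : ℝ → ℂ}
    (hg : ContinuousOn g (Set.Ioi 0)) : Continuous fun x => (a x : ℂ) * g x := by
  rw [continuous_iff_continuousAt]
  intro x
  by_cases hx : x ∈ tsupport a
  · exact (Complex.continuous_ofReal.comp ha.contDiff.continuous).continuousAt.mul
      (hg.continuousAt (Ioi_mem_nhds (ha.tsupport_subset hx)))
  · refine continuousAt_const (y := (0 : ℂ)) |>.congr ?_
    filter_upwards [(isClosed_tsupport a).isOpen_compl.mem_nhds hx] with t ht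
    rw [image_eq_zero_of_notMem_tsupport ht, Complex.ofReal_zero, zero_mul]

theorem IsHalfLineTest.div_sqrt_profile (hf : IsGrushinProfile f) {a : ℝ → ℝ}
    (ha : IsHalfLineTest a) : IsHalfLineTest fun x => (√(f x))⁻¹ * a x := by
  have hs : Function.support (fun x => (√(f x))⁻¹ * a x) ⊆ Function.support a :=
    Function.support_mul_subset_right _ _
  refine ⟨ha.contDiff_mul fun x hx => ?_, ha.hasCompactSupport.mono hs,
    (closure_mono hs).trans ha.tsupport_subset⟩
  have h0 := hf.pos x hx.ne'
  exact ((contDiffAt_profile hf hx).sqrt h0.ne').inv (Real.sqrt_pos.2 h0).ne'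

/-- Conjugation of the radial operator by `√f`. -/
theorem sqrt_mul_radialExpr (hf : IsGrushinProfile f) {a : ℝ → ℝ} (ha : ContDiff ℝ ∞ a) {x : ℝ}
    (hx : 0 < x) :
    deriv (deriv fun t => √(f t) * a t) x
      = √(f x) * radialExpr f a x + potential f x * (√(f x) * a x) := by
  have hda := fun t => (ha.differentiable (by simp) t).hasDerivAt
  have hda' := fun t => ((contDiff_infty_iff_deriv.1 ha).2.differentiable (by simp) t).hasDerivAt
  have h1 : deriv (fun t => √(f t) * a t) =ᶠ[𝓝 x]
      fun t => deriv f t / (2 * √(f t)) * a t + √(f t) * deriv a t := by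
    filter_upwards [Ioi_mem_nhds hx] with t ht
    exact ((hasDerivAt_sqrt_profile hf ht).mul (hda t)).deriv
  have h2 := ((hasDerivAt_deriv_sqrt_profile hf hx).mul (hda x)).add
    ((hasDerivAt_sqrt_profile hf hx).mul (hda' x))
  rw [h1.deriv_eq]
  refine h2.deriv.trans ?_
  have h0 := hf.pos x hx.ne'
  have hs : √(f x) ≠ 0 := (Real.sqrt_pos.2 h0).ne'
  have e : f x = √(f x) ^ 2 := (Real.sq_sqrt h0.le).symm
  have e2 : deriv f x / f x = deriv f x / √(f x) ^ 2 := by rw [← e]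
  rw [radialExpr, e2]
  field_simp
  ring

theorem contDiff_deriv2 {g : ℝ → ℝ} (hg : ContDiff ℝ ∞ g) : ContDiff ℝ ∞ (deriv (deriv g)) :=
  (contDiff_infty_iff_deriv.1 (contDiff_infty_iff_deriv.1 hg).2).2

theorem continuousOn_potential (hf : IsGrushinProfile f) :
    ContinuousOn (potential f) (Set.Ioi 0) := by
  have h0 := (contDiffOn_profile hf).continuousOn
  have h1 := contDiffOn_deriv_profile hf
  have h2 : ContinuousOn (deriv (deriv f)) (Set.Ioi 0) :=
    h1.continuousOn_deriv_of_isOpen isOpen_Ioi (by simp)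
  refine (((continuousOn_const.mul h0).mul h2).sub (h1.continuousOn.pow 2)).div
    (continuousOn_const.mul (h0.pow 2)) fun x hx => ?_
  have := hf.pos x (ne_of_gt hx)
  positivity

theorem continuousOn_potential_sub (hf : IsGrushinProfile f) (c : ℂ) :
    ContinuousOn (fun x => (potential f x : ℂ) - c) (Set.Ioi 0) :=
  (Complex.continuous_ofReal.comp_continuousOn (continuousOn_potential hf)).sub continuousOn_const

theorem continuousOn_one_div_sq (hf : IsGrushinProfile f) :
    ContinuousOn (fun x => 1 / f x ^ 2) (Set.Ioi 0) :=
  continuousOn_const.div ((contDiffOn_profile hf).continuousOn.pow 2) fun x hx =>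
    pow_ne_zero 2 (hf.pos x (ne_of_gt hx)).ne'

variable {z : ℂ} {u : GrushinL2 f}

/-- The weak eigenvalue equation is tested on `(a/√f)(x) b(y)`; conjugation by `√f` then replaces
the first-order term by the potential and the measure by Lebesgue measure. -/
theorem integral_flatConj_eq_zero (hf : IsGrushinProfile f)
    (hu : u ∈ deficiencySpace (hamiltonian hf) z) {a b : ℝ → ℝ} (ha : IsHalfLineTest a)
    (hb : ContDiff ℝ ∞ b) (hbc : HasCompactSupport b) :
    ∫ p : ℝ × ℝ, (((deriv (deriv a) p.1 : ℝ) : ℂ)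
        - (a p.1 : ℂ) * (potential f p.1 - starRingEnd ℂ z)) * (b p.2 : ℂ) * flatConj f u p
      + (a p.1 : ℂ) * ((1 / f p.1 ^ 2 : ℝ) : ℂ) * ((deriv (deriv b) p.2 : ℝ) : ℂ)
        * flatConj f u p = 0 := by
  set A : ℝ → ℝ := fun x => (√(f x))⁻¹ * a x with hA
  have hAt : IsHalfLineTest A := ha.div_sqrt_profile hf
  have hcs : HasCompactSupport fun p : ℝ × ℝ => A p.1 * b p.2 := by
    refine HasCompactSupport.intro (hAt.hasCompactSupport.isCompact.prod hbc.isCompact)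
      fun p hp => ?_
    rw [Set.mem_prod, not_and_or] at hp
    rcases hp with hp | hp
    · rw [image_eq_zero_of_notMem_tsupport hp, zero_mul]
    · rw [image_eq_zero_of_notMem_tsupport hp, mul_zero]
  have hts : tsupport (fun p : ℝ × ℝ => A p.1 * b p.2) ⊆ halfPlane := by
    have h1 : tsupport (fun p : ℝ × ℝ => A p.1 * b p.2) ⊆ Prod.fst ⁻¹' tsupport A := by
      refine closure_minimal (fun p hp => subset_tsupport _ ?_)
        ((isClosed_tsupport A).preimage continuous_fst)
      exact left_ne_zero_of_mul hp
    exact h1.trans fun p hp => hAt.tsupport_subset hp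
  let φ := testFunctionOfReal (fun p : ℝ × ℝ => A p.1 * b p.2)
    ((hAt.contDiff.comp contDiff_fst).mul (hb.comp contDiff_snd)) hcs hts
  have hφ : (φ : ℝ × ℝ → ℂ) = tensor A b := by
    ext p
    exact Complex.ofReal_mul _ _
  have h := (mem_deficiencySpace_hamiltonian_iff hf).1 hu φ
  rw [integral_grushinMeasure hf, ← integral_indicator halfPlane.isOpen.measurableSet] at h
  rw [← h]
  refine integral_congr_ae (Filter.Eventually.of_forall fun p => ?_)
  by_cases hp : p ∈ (halfPlane : Set (ℝ × ℝ))
  · have h0 := hf.pos p.1 (ne_of_gt hp)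
    have hs : √(f p.1) ≠ 0 := (Real.sqrt_pos.2 h0).ne'
    have hsc : (√(f p.1) : ℂ) ≠ 0 := by exact_mod_cast hs
    have e : (f p.1 : ℂ) = (√(f p.1) : ℂ) * (√(f p.1) : ℂ) := by
      exact_mod_cast (Real.mul_self_sqrt h0.le).symm
    have ea : a p.1 = √(f p.1) * A p.1 := by simp only [hA]; field_simp
    have eV : deriv (deriv a) p.1 = √(f p.1) * radialExpr f A p.1 + potential f p.1 * a p.1 := by
      have h1 : (fun t => √(f t) * A t) =ᶠ[𝓝 p.1] a := by
        filter_upwards [Ioi_mem_nhds hp] with t ht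
        have := (Real.sqrt_pos.2 (hf.pos t (ne_of_gt ht))).ne'
        simp only [hA]
        field_simp
      rw [← h1.deriv.deriv_eq, sqrt_mul_radialExpr hf hAt.contDiff hp, ea]
    simp only [Set.indicator_of_mem hp]
    rw [hφ, grushinExpr_tensor hAt.contDiff.contDiffOn hb hp, flatConj_of_mem hp, tensor, eV, ea]
    push_cast
    generalize (1 : ℂ) / (f p.1 : ℂ) ^ 2 = r
    rw [e]
    ring
  · simp [flatConj, Set.indicator_of_notMem hp]

/-- Choosing `b(y - ·)` as the second factor and applying Fubini turns the planar equation into one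
in `x`. The two signs from differentiating `b(y - ·)` twice cancel. -/
theorem weak_equation_smoothY (hf : IsGrushinProfile f)
    (hu : u ∈ deficiencySpace (hamiltonian hf) z) {a b : ℝ → ℝ} (ha : IsHalfLineTest a)
    (hb : ContDiff ℝ ∞ b) (hbc : HasCompactSupport b) (y : ℝ)
    (hv : LocallyIntegrable (flatConj f u)) :
    ∫ x, ((deriv (deriv a) x : ℝ) : ℂ) * smoothY b (flatConj f u) (x, y)
      = ∫ x, (a x : ℂ) * ((potential f x - starRingEnd ℂ z) * smoothY b (flatConj f u) (x, y)
        - ((1 / f x ^ 2 : ℝ) : ℂ) * smoothY (deriv (deriv b)) (flatConj f u) (x, y)) := by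
  have hb'' := contDiff_deriv2 hb
  have hbc'' : HasCompactSupport (deriv (deriv b)) := hbc.deriv.deriv
  have hlc : IsLocallyClosed (Set.Ioi (0 : ℝ)) := isOpen_Ioi.isLocallyClosed
  have hA := continuousOn_potential_sub hf (starRingEnd ℂ z)
  have hB : ContinuousOn (fun x => ((1 / f x ^ 2 : ℝ) : ℂ)) (Set.Ioi 0) :=
    Complex.continuous_ofReal.comp_continuousOn (continuousOn_one_div_sq hf)
  have hw := (locallyIntegrable_smoothY_left hb.continuous hbc hv y).locallyIntegrableOn
    (Set.Ioi (0 : ℝ))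
  have hw₂ := (locallyIntegrable_smoothY_left hb''.continuous hbc'' hv y).locallyIntegrableOn
    (Set.Ioi (0 : ℝ))
  have hc₁ : Continuous fun x => ((deriv (deriv a) x : ℝ) : ℂ)
      - (a x : ℂ) * (potential f x - starRingEnd ℂ z) :=
    (Complex.continuous_ofReal.comp ha.deriv.deriv.contDiff.continuous).sub
      (ha.continuous_mul hA)
  have hs₁ : HasCompactSupport fun x => ((deriv (deriv a) x : ℝ) : ℂ)
      - (a x : ℂ) * (potential f x - starRingEnd ℂ z) := by
    refine HasCompactSupport.intro ha.hasCompactSupport fun x hx => ?_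
    rw [image_eq_zero_of_notMem_tsupport hx, image_eq_zero_of_notMem_tsupport
      fun h => hx (tsupport_deriv_subset (tsupport_deriv_subset h))]
    simp
  have hc₂ := ha.continuous_mul hB
  have hs₂ : HasCompactSupport fun x => (a x : ℂ) * ((1 / f x ^ 2 : ℝ) : ℂ) := by
    refine HasCompactSupport.intro ha.hasCompactSupport fun x hx => ?_
    rw [image_eq_zero_of_notMem_tsupport hx, Complex.ofReal_zero, zero_mul]
  have hbd : ∀ t, deriv (deriv fun t => b (y - t)) t = deriv (deriv b) (y - t) := by
    intro t
    have : (deriv fun t => b (y - t)) = fun t => -deriv b (y - t) :=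
      funext fun t => deriv_comp_const_sub b y t
    rw [this, deriv.fun_neg, deriv_comp_const_sub, neg_neg]
  have h := integral_flatConj_eq_zero hf hu ha (b := fun t => b (y - t))
    (hb.comp (contDiff_const.sub contDiff_id)) (hbc.comp_homeomorph (Homeomorph.subLeft y))
  simp only [hbd] at h
  rw [integral_add (integrable_mul_smoothY hb.continuous hbc hv hc₁ hs₁ y)
      (integrable_mul_smoothY hb''.continuous hbc'' hv hc₂ hs₂ y),
    integral_mul_smoothY hb.continuous hbc hv hc₁ hs₁ y,
    integral_mul_smoothY hb''.continuous hbc'' hv hc₂ hs₂ y] at h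
  have i1 := ha.deriv.deriv.integrable_mul hw
  have i2 := ha.integrable_mul (hw.continuousOn_mul hA hlc)
  have i3 := ha.integrable_mul (hw₂.continuousOn_mul hB hlc)
  have e1 : ∫ x, (((deriv (deriv a) x : ℝ) : ℂ) - (a x : ℂ) * (potential f x - starRingEnd ℂ z))
        * smoothY b (flatConj f u) (x, y)
      = (∫ x, ((deriv (deriv a) x : ℝ) : ℂ) * smoothY b (flatConj f u) (x, y))
        - ∫ x, (a x : ℂ) * ((potential f x - starRingEnd ℂ z)
          * smoothY b (flatConj f u) (x, y)) := by
    rw [← integral_sub i1 i2]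
    exact integral_congr_ae (Filter.Eventually.of_forall fun x => by ring)
  have e2 : ∫ x, (a x : ℂ) * ((potential f x - starRingEnd ℂ z) * smoothY b (flatConj f u) (x, y)
        - ((1 / f x ^ 2 : ℝ) : ℂ) * smoothY (deriv (deriv b)) (flatConj f u) (x, y))
      = (∫ x, (a x : ℂ) * ((potential f x - starRingEnd ℂ z) * smoothY b (flatConj f u) (x, y)))
        - ∫ x, (a x : ℂ) * (((1 / f x ^ 2 : ℝ) : ℂ)
          * smoothY (deriv (deriv b)) (flatConj f u) (x, y)) := by
    rw [← integral_sub i2 i3]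
    exact integral_congr_ae (Filter.Eventually.of_forall fun x => by ring)
  rw [e1] at h
  simp only [mul_assoc] at h
  rw [e2]
  linear_combination h

/-- Applied with `b''` in place of `b`, this supplies the continuous representative of `∂ᵧ² w`
needed in the energy inequality. -/
theorem exists_continuousOn_smoothY (hf : IsGrushinProfile f)
    (hu : u ∈ deficiencySpace (hamiltonian hf) z) {b : ℝ → ℝ}
    (hb : ContDiff ℝ ∞ b) (hbc : HasCompactSupport b) (y : ℝ)
    (hv : LocallyIntegrable (flatConj f u)) :
    ∃ K : ℝ → ℂ, ContinuousOn K (Set.Ioi 0) ∧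
      ∀ᵐ x, x ∈ Set.Ioi (0 : ℝ) → smoothY b (flatConj f u) (x, y) = K x := by
  have hb'' := contDiff_deriv2 hb
  have hlc : IsLocallyClosed (Set.Ioi (0 : ℝ)) := isOpen_Ioi.isLocallyClosed
  have hA := continuousOn_potential_sub hf (starRingEnd ℂ z)
  have hB : ContinuousOn (fun x => ((1 / f x ^ 2 : ℝ) : ℂ)) (Set.Ioi 0) :=
    Complex.continuous_ofReal.comp_continuousOn (continuousOn_one_div_sq hf)
  have hw := (locallyIntegrable_smoothY_left hb.continuous hbc hv y).locallyIntegrableOn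
    (Set.Ioi (0 : ℝ))
  have hw₂ := (locallyIntegrable_smoothY_left hb''.continuous hbc.deriv.deriv hv
    y).locallyIntegrableOn (Set.Ioi (0 : ℝ))
  obtain ⟨K, c, hK, hwK⟩ := exists_primitive_of_weak_deriv2 hw
    ((hw.continuousOn_mul hA hlc).sub (hw₂.continuousOn_mul hB hlc))
    fun a ha => weak_equation_smoothY hf hu ha hb hbc y hv
  exact ⟨K, fun x hx => (hK x hx).continuousAt.continuousWithinAt, hwK⟩

theorem three_div_le_potential (hf : IsGrushinProfile f) (h : ∀ x : ℝ, x ≠ 0 →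
    3 / x ^ 2 * f x ^ 2 ≤ 2 * f x * deriv (deriv f) x - deriv f x ^ 2) {x : ℝ} (hx : 0 < x) :
    3 / (4 * x ^ 2) ≤ potential f x := by
  have h0 := hf.pos x hx.ne'
  rw [potential, le_div_iff₀ (by positivity)]
  refine le_trans (le_of_eq ?_) (h x hx.ne')
  field_simp

theorem smoothY_flatConj_ae_eq_zero (hf : IsGrushinProfile f) (h : ∀ x : ℝ, x ≠ 0 →
    3 / x ^ 2 * f x ^ 2 ≤ 2 * f x * deriv (deriv f) x - deriv f x ^ 2) (hz : z.re = 0)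
    (hu : u ∈ deficiencySpace (hamiltonian hf) z) {b : ℝ → ℝ}
    (hb : ContDiff ℝ ∞ b) (hbc : HasCompactSupport b) :
    smoothY b (flatConj f u) =ᵐ[volume] 0 := by
  have hum := Lp.stronglyMeasurable u
  have hvm := stronglyMeasurable_flatConj hf hum
  have hv2 := memLp_flatConj hf hum (Lp.memLp u)
  have hv : LocallyIntegrable (flatConj f u) := hv2.locallyIntegrable (by norm_num)
  have hb'' := contDiff_deriv2 hb
  have hbc'' : HasCompactSupport (deriv (deriv b)) := hbc.deriv.deriv
  have hw2 := memLp_smoothY hb.continuous hbc hvm hv2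
  have hA := continuousOn_potential_sub hf (starRingEnd ℂ z)
  have hg := hw2.integrable_norm_pow (by norm_num)
  have key := ae_eq_zero_of_energy hg (fun r => by positivity) fun p q θ θ' θ'' hθ => by
    refine energy_nonneg (continuousOn_one_div_sq hf) (fun x hx => by positivity) hw2
      (memLp_smoothY hb''.continuous hbc'' hvm hv2)
      (ae_integral_conj_smoothY_nonpos hb hbc hvm hv2) hθ fun y => ?_
    obtain ⟨K, hK, hwK⟩ := exists_continuousOn_smoothY hf hu hb'' hbc'' y hv
    refine energy_inequality_of_weak_equation hA (continuousOn_one_div_sq hf) (fun x hx => ?_)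
      ((locallyIntegrable_smoothY_left hb.continuous hbc hv y).locallyIntegrableOn _)
      ((locallyIntegrable_smoothY_left hb''.continuous hbc'' hv y).locallyIntegrableOn _)
      hK hwK (fun a ha => weak_equation_smoothY hf hu ha hb hbc y hv) hθ
    -- Since `Re z = 0`, the spectral parameter drops out of the real part of the coefficient.
    rw [Complex.sub_re, Complex.ofReal_re, Complex.conj_re, hz, sub_zero]
    exact three_div_le_potential hf h hx
  filter_upwards [key] with p hp
  by_cases hpM : p ∈ halfPlane
  · simpa using hp hpM
  · have : ∀ t, flatConj f u (p.1, t) = 0 := fun t =>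
      Set.indicator_of_notMem (s := (halfPlane : Set (ℝ × ℝ))) (a := (p.1, t)) hpM _
    simp [smoothY, this]

/-- All smoothings of `√f · conj u` vanish, hence so does this function itself, and `√f > 0` on the
half-plane. -/
theorem deficiencySpace_hamiltonian_eq_bot (hf : IsGrushinProfile f) (h : ∀ x : ℝ, x ≠ 0 →
    3 / x ^ 2 * f x ^ 2 ≤ 2 * f x * deriv (deriv f) x - deriv f x ^ 2) (hz : z.re = 0) :
    deficiencySpace (hamiltonian hf) z = ⊥ := by
  rw [eq_bot_iff]
  intro u hu
  have hum := Lp.stronglyMeasurable u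
  have h0 := ae_eq_zero_of_smoothY (stronglyMeasurable_flatConj hf hum)
    (memLp_flatConj hf hum (Lp.memLp u))
    fun b hb hbc => smoothY_flatConj_ae_eq_zero hf h hz hu hb hbc
  rw [Submodule.mem_bot, Lp.eq_zero_iff_ae_eq_zero]
  refine (ae_grushinMeasure_iff hf).2 ?_
  filter_upwards [ae_restrict_of_ae h0, ae_restrict_mem halfPlane.isOpen.measurableSet]
    with p hp hpM
  have hpM' : p ∈ halfPlane := hpM
  rw [flatConj_of_mem hpM'] at hp
  have hs : (√(f p.1) : ℂ) ≠ 0 := by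
    exact_mod_cast (Real.sqrt_pos.2 (hf.pos p.1 (ne_of_gt hpM'))).ne'
  simpa [hs] using hp

theorem isEssentiallySelfAdjoint_hamiltonian (hf : IsGrushinProfile f) (h : ∀ x : ℝ, x ≠ 0 →
    3 / x ^ 2 * f x ^ 2 ≤ 2 * f x * deriv (deriv f) x - deriv f x ^ 2) :
    IsEssentiallySelfAdjoint (hamiltonian hf) :=
  isEssentiallySelfAdjoint_of_deficiencySpace_eq_bot (dense_domain_hamiltonian hf)
    (hamiltonian_isFormalAdjoint hf) (deficiencySpace_hamiltonian_eq_bot hf h (by simp))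
    (deficiencySpace_hamiltonian_eq_bot hf h (by simp))

end EssentialSelfAdjointness

end Grushin

end

/-! ### The theorem -/

theorem mainTheorem1 (f : ℝ → ℝ) (hf : Grushin.IsGrushinProfile f) :
    ((∀ x : ℝ, x ≠ 0 →
        3 / x ^ 2 * f x ^ 2 ≤ 2 * f x * deriv (deriv f) x - deriv f x ^ 2) →
      Grushin.IsEssentiallySelfAdjoint (Grushin.hamiltonian hf)) ∧
    ((∃ ε : ℝ, 0 < ε ∧ ∀ x : ℝ, x ≠ 0 →
        2 * f x * deriv (deriv f) x - deriv f x ^ 2 ≤ (3 - ε) / x ^ 2 * f x ^ 2) →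
      ¬ Grushin.IsEssentiallySelfAdjoint (Grushin.hamiltonian hf)) ∧
    ((∃ ε : ℝ, 0 < ε ∧ ∀ x : ℝ, x ≠ 0 →
        2 * f x * deriv (deriv f) x - deriv f x ^ 2 ≤ (3 - ε) / x ^ 2 * f x ^ 2) →
      Grushin.deficiencyIndex (Grushin.hamiltonian hf) Complex.I = ⊤ ∧
      Grushin.deficiencyIndex (Grushin.hamiltonian hf) (-Complex.I) = ⊤) := by
  refine ⟨Grushin.isEssentiallySelfAdjoint_hamiltonian hf, ?_, ?_⟩
  · rintro ⟨ε, hε, h⟩ hsa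
    -- Essential self-adjointness would make the deficiency space at `i` zero, in particular
    -- finite-dimensional.
    refine (Grushin.not_finite_deficiencySpaces_hamiltonian hf hε h).1 ?_
    rw [Grushin.deficiencySpace_eq_bot_of_isEssentiallySelfAdjoint
      (Grushin.dense_domain_hamiltonian hf) (Grushin.hamiltonian_isFormalAdjoint hf) hsa]
    infer_instance
  · rintro ⟨ε, hε, h⟩
    rw [Grushin.deficiencyIndex_eq_top_iff, Grushin.deficiencyIndex_eq_top_iff]
    exact Grushin.not_finite_deficiencySpaces_hamiltonian hf hε h
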